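/- Let $G$ be a countable discrete group, $K\subseteq G$ a finite subgroup, and $B$ a $\mathbb Z/2$-graded $G$-$C^*$-algebra with action $\beta$. For $\mathbb Z/2$-graded $G$-$C^*$-algebras $A,D$ let $KK^G(A,D)$ be Kasparov's group of homotopy classes of $G$-equivariant Kasparov cycles $[\mathcal E,\Phi,u,T]$ ($\mathcal E$ a countably generated graded Hilbert $D$-module with $G$-action $u$, $\Phi:A\to\mathcal L(\mathcal E)$ a graded $G$-equivariant $*$-homomorphism, $T\in\mathcal L(\mathcal E)$ odd, with $(T-T^*)\Phi(a)$, $(T^2-1)\Phi(a)$, $(u_gTu_g^{-1}-T)\Phi(a)$ and the graded commutators $[T,\Phi(a)]$ compact for all $a\in A$, $g\in G$), with addition given by direct sum. For $n\ge 0$ put $KK^G_n(A,B)=KK^G(A,B\hat\otimes Cl_n)$, where $Cl_n$ is the $n$-th complex Clifford algebra with its standard grading and trivial action. Let $\iota:\mathbb C\to C_0(G/K)$ be the $K$-equivariant inclusion $\lambda\mapsto\lambda\delta_{eK}$. Then for every $n\ge 0$ (in particular for $n=0,1$) the compression map $$\operatorname{comp}_K: KK^G_n(C_0(G/K),B)\xrightarrow{\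 \operatorname{res}\ }KK^K_n(C_0(G/K),B)\xrightarrow{\ \iota^*\ }KK^K_n(\mathbb C,B),$$ where $\operatorname{res}$ restricts all actions to $K$, is an isomorphism of abelian groups. Its inverse is the following. Write $D=B\hat\otimes Cl_n$, with $G$-action again denoted by $\beta$. Every class in $KK^K(\mathbb C,D)$ is represented by a cycle $(\mathcal E,1,\gamma,T)$ in which $\mathbb C$ acts on $\mathcal E$ by scalars and $T$ commutes with the action $\gamma$ of $K$. For each such cycle, let $\operatorname{Ind}_K^G\mathcal E$ be the set of all $\xi:G\to\mathcal E$ such that $\xi(gk)=\gamma_{k^{-1}}(\xi(g))$ for all $g\in G$, $k\in K$, and such that $\sum_{g\in G}\beta_g(\langle\xi(g),\xi(g)\rangle)$ converges in norm in $D$, with the grading of $\mathcal E$ applied pointwise and $$\langle\xi,\eta\rangle=\frac1{|K|}\sum_{g\in G}\beta_g(\langle\xi(g),\eta(g)\rangle),\qquad (\xi\cdot b)(g)=\xi(g)\beta_{g^{-1}}(b),$$ $$(M(f)\xi)(g)=f(gK)\xi(g),\qquad ((\operatorname{Ind}\gamma)_h\xi)(g)=\xi(h^{-1}g),\qquad (\tilde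 T\xi)(g)=T(\xi(g))$$ for $b\in D$, $f\in C_0(G/K)$, $g,h\in G$. Then $(\operatorname{Ind}_K^G\mathcal E,M,\operatorname{Ind}\gamma,\tilde T)$ is a $G$-equivariant Kasparov $C_0(G/K)$-$D$ cycle, and $\operatorname{comp}_K^{-1}[\mathcal E,1,\gamma,T]=[\operatorname{Ind}_K^G\mathcal E,M,\operatorname{Ind}\gamma,\tilde T]$. -/

import Mathlib

set_option linter.unusedSectionVars false

open scoped RightActions ZeroAtInfty
open MulOpposite

universe u v w w'

/-- A `ℤ/2`-graded `G`-C*-algebra for a discrete group `G`: a C*-algebra, an action of `G` by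
*-automorphisms (each `act g` is invertible, with inverse `act g⁻¹`), and a *-automorphism `grading`
of order two (the grading operator; `grading = id` is the trivial grading) that commutes with the
action. For discrete `G` strong continuity of the action is automatic. -/
structure GradedGAlgebra (G : Type v) [Group G] where
  carrier : Type u
  [cstar : NonUnitalCStarAlgebra carrier]
  act : G →* (carrier →⋆ₙₐ[ℂ] carrier)
  grading : carrier →⋆ₙₐ[ℂ] carrier
  grading_grading : ∀ a, grading (grading a) = a
  grading_act : ∀ g a, grading (act g a) = act g (grading a)

namespace GradedGAlgebra

variable {G : Type v} [Group G]

instance : CoeSort (GradedGAlgebra.{u} G) (Type u) := ⟨GradedGAlgebra.carrier⟩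

attribute [instance] GradedGAlgebra.cstar

/-- The usual order of the C*-algebra `Bᵐᵒᵖ` (`0 ≤ x` iff `x` is positive). -/
noncomputable instance (B : GradedGAlgebra.{u} G) : PartialOrder (B.carrier)ᵐᵒᵖ :=
  CStarAlgebra.spectralOrder _

instance (B : GradedGAlgebra.{u} G) : StarOrderedRing (B.carrier)ᵐᵒᵖ :=
  CStarAlgebra.spectralOrderedRing _

/-- Restriction of the action to a subgroup. -/
def res (K : Subgroup G) (B : GradedGAlgebra.{u} G) : GradedGAlgebra.{u} K where
  carrier := B
  act := B.act.comp K.subtype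
  grading := B.grading
  grading_grading := B.grading_grading
  grading_act g := B.grading_act g

theorem continuous_starHom {A : Type u} {B : Type w} [NonUnitalCStarAlgebra A]
    [NonUnitalCStarAlgebra B] (φ : A →⋆ₙₐ[ℂ] B) : Continuous φ :=
  AddMonoidHomClass.continuous_of_bound φ 1 fun a => by
    simpa using NonUnitalStarAlgHom.norm_apply_le φ a

/-- Pointwise application of a *-homomorphism to a path. -/
def mapPath {B : Type u} [NonUnitalCStarAlgebra B] (φ : B →⋆ₙₐ[ℂ] B) :
    C(unitInterval, B) →⋆ₙₐ[ℂ] C(unitInterval, B) where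
  toFun f := ⟨fun t => φ (f t), (continuous_starHom φ).comp f.continuous⟩
  map_smul' c f := by ext t; simp
  map_zero' := by ext t; simp
  map_add' f h := by ext t; simp
  map_mul' f h := by ext t; simp
  map_star' f := by ext t; simp [map_star]

/-- The cylinder algebra `B[0,1] = C([0,1], B)` with pointwise action and grading. -/
noncomputable def path (B : GradedGAlgebra.{u} G) : GradedGAlgebra.{u} G where
  carrier := C(unitInterval, B)
  act :=
    { toFun := fun g => mapPath (B.act g)
      map_one' := by ext f t; simp [mapPath]
      map_mul' := fun g h => by
        ext f t
        exact DFunLike.congr_fun (B.act.map_mul g h) (f t) }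
  grading := mapPath B.grading
  grading_grading f := ContinuousMap.ext fun t => B.grading_grading (f t)
  grading_act g f := ContinuousMap.ext fun t => B.grading_act g (f t)


/-- The complex numbers with trivial action and trivial grading. -/
noncomputable def complex (G : Type v) [Group G] : GradedGAlgebra.{0} G where
  carrier := ℂ
  act := 1
  grading := NonUnitalStarAlgHom.id ℂ ℂ
  grading_grading _ := rfl
  grading_act _ _ := rfl

section cosets

variable [TopologicalSpace G] [DiscreteTopology G] (K : Subgroup G)

/-- Translation of functions on `G/K`: `(g • f)(x) = f (g⁻¹ x)`. -/
noncomputable def translate (g : G) : C₀(G ⧸ K, ℂ) →⋆ₙₐ[ℂ] C₀(G ⧸ K, ℂ) where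
  toFun f :=
    { toFun := fun x => f (g⁻¹ • x)
      continuous_toFun := f.continuous.comp (continuous_const_smul g⁻¹)
      zero_at_infty' := (zero_at_infty f).comp
        (Homeomorph.smul g⁻¹).isClosedEmbedding.tendsto_cocompact }
  map_smul' _ _ := rfl
  map_zero' := rfl
  map_add' _ _ := rfl
  map_mul' _ _ := rfl
  map_star' _ := rfl

theorem translate_apply (g : G) (f : C₀(G ⧸ K, ℂ)) (x : G ⧸ K) :
    translate K g f x = f (g⁻¹ • x) := rfl

/-- `C₀(G/K)` with the translation action and trivial grading (`G` discrete). -/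
noncomputable def cosets : GradedGAlgebra.{v} G where
  carrier := C₀(G ⧸ K, ℂ)
  act :=
    { toFun := translate K
      map_one' := by ext f x; simp [translate_apply]
      map_mul' := fun g h => by
        ext f x
        change f ((g * h)⁻¹ • x) = f (h⁻¹ • g⁻¹ • x)
        rw [mul_inv_rev, mul_smul] }
  grading := NonUnitalStarAlgHom.id ℂ _
  grading_grading _ := rfl
  grading_act _ _ := rfl

open Classical in
/-- The characteristic function of the point `x` of `G/K`. -/
noncomputable def delta (x : G ⧸ K) : C₀(G ⧸ K, ℂ) where
  toFun := fun y => if y = x then 1 else 0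
  continuous_toFun := by
    have : DiscreteTopology (G ⧸ K) := QuotientGroup.discreteTopology (isOpen_discrete _)
    exact continuous_of_discreteTopology
  zero_at_infty' := by
    have : DiscreteTopology (G ⧸ K) := QuotientGroup.discreteTopology (isOpen_discrete _)
    rw [Filter.cocompact_eq_cofinite]
    refine tendsto_const_nhds.congr' ?_
    have h : ({x} : Set (G ⧸ K))ᶜ ∈ Filter.cofinite := by simp
    filter_upwards [h] with y hy
    simp only [Set.mem_compl_iff, Set.mem_singleton_iff] at hy
    simp [hy]

end cosets

/-- A `G`-equivariant graded *-homomorphism. -/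
structure Hom (A : GradedGAlgebra.{u} G) (A' : GradedGAlgebra.{w} G) where
  toHom : A →⋆ₙₐ[ℂ] A'
  map_act : ∀ g a, toHom (A.act g a) = A'.act g (toHom a)
  map_grading : ∀ a, toHom (A.grading a) = A'.grading (toHom a)

section cosets

variable [TopologicalSpace G] [DiscreteTopology G] (K : Subgroup G)

open Classical in
theorem delta_apply (x y : G ⧸ K) : delta K x y = if y = x then 1 else 0 := rfl

/-- The *-homomorphism `λ ↦ λ δ_x` from `ℂ` to `C₀(G/K)`. -/
noncomputable def scalarDelta (x : G ⧸ K) : ℂ →⋆ₙₐ[ℂ] C₀(G ⧸ K, ℂ) where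
  toFun c := c • delta K x
  map_smul' c d := ZeroAtInftyContinuousMap.ext fun y => mul_assoc c d (delta K x y)
  map_zero' := ZeroAtInftyContinuousMap.ext fun y => zero_mul (delta K x y)
  map_add' c d := ZeroAtInftyContinuousMap.ext fun y => add_mul c d (delta K x y)
  map_mul' c d := by
    ext y
    by_cases h : y = x <;> simp [delta_apply, h]
  map_star' c := by
    ext y
    change star c * delta K x y = star (c * delta K x y)
    by_cases h : y = x
    · simp [delta_apply, h]
    · simp [delta_apply, h]

theorem scalarDelta_smul (k : K) (c : ℂ) :
    scalarDelta K (QuotientGroup.mk 1) c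
      = translate K (k : G) (scalarDelta K (QuotientGroup.mk 1) c) := by
  refine ZeroAtInftyContinuousMap.ext fun y => ?_
  change c * delta K (QuotientGroup.mk 1) y
    = c * delta K (QuotientGroup.mk 1) ((k : G)⁻¹ • y)
  have hk : (k : G) • (QuotientGroup.mk 1 : G ⧸ K) = QuotientGroup.mk 1 := by
    rw [MulAction.Quotient.smul_mk, QuotientGroup.eq]
    simp
  have h : ((k : G)⁻¹ • y = QuotientGroup.mk 1) ↔ y = QuotientGroup.mk 1 := by
    rw [inv_smul_eq_iff, hk]
  by_cases hy : y = QuotientGroup.mk 1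
  · rw [delta_apply, delta_apply, if_pos hy, if_pos (h.2 hy)]
  · rw [delta_apply, delta_apply, if_neg hy, if_neg (mt h.1 hy)]

/-- The `K`-equivariant inclusion `ℂ → C₀(G/K)`, `λ ↦ λ δ_{eK}`. -/
noncomputable def pointInclusion : Hom (complex K) ((cosets K).res K) where
  toHom := scalarDelta K (QuotientGroup.mk 1)
  map_act k c := scalarDelta_smul K k c
  map_grading _ := rfl

end cosets

section Clifford
open CStarMatrix
variable (B : GradedGAlgebra.{u} G)

noncomputable local instance : PartialOrder B.carrier := CStarAlgebra.spectralOrder _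
local instance : StarOrderedRing B.carrier := CStarAlgebra.spectralOrderedRing _

/-- The graded tensor product `B ⊗̂ Cl₁`, where `Cl₁ = ℂ1 + ℂe` with `e² = 1`, `e* = e` and `e` odd.
Its elements are `a + b e` with `a, b ∈ B`, subject to `e b = ε(b) e` (`ε` the grading of `B`).
It is realized faithfully in `M₂(B)` by `a + b e ↦ (a, b; ε(b), ε(a))`. -/
noncomputable def cliffordSubalgebra :
    NonUnitalStarSubalgebra ℂ (CStarMatrix (Fin 2) (Fin 2) B) where
  carrier := {m | m 1 1 = B.grading (m 0 0) ∧ m 1 0 = B.grading (m 0 1)}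
  add_mem' := by
    rintro a b ⟨h1, h2⟩ ⟨h3, h4⟩
    simp [h1, h2, h3, h4]
  zero_mem' := by simp
  mul_mem' := by
    rintro a b ⟨h1, h2⟩ ⟨h3, h4⟩
    simp [CStarMatrix.mul_apply, h1, h2, h3, h4, B.grading_grading, add_comm]
  smul_mem' := by
    rintro c a ⟨h1, h2⟩
    simp [h1, h2]
  star_mem' := by
    rintro a ⟨h1, h2⟩
    simp [CStarMatrix.star_apply, h1, h2, B.grading_grading, map_star]

theorem isClosed_cliffordSubalgebra :
    IsClosed (B.cliffordSubalgebra : Set (CStarMatrix (Fin 2) (Fin 2) B)) := by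
  have hc (i j : Fin 2) : Continuous fun m : CStarMatrix (Fin 2) (Fin 2) B => m i j :=
    (continuous_apply_apply i j : Continuous fun m : Matrix (Fin 2) (Fin 2) B => m i j)
  exact (isClosed_eq (hc 1 1) ((continuous_starHom _).comp (hc 0 0))).inter
    (isClosed_eq (hc 1 0) ((continuous_starHom _).comp (hc 0 1)))

noncomputable instance : NonUnitalCStarAlgebra B.cliffordSubalgebra :=
  NonUnitalStarSubalgebra.nonUnitalCStarAlgebra _ (h_closed := B.isClosed_cliffordSubalgebra)

/-- `φ` applied to the diagonal entries, and `s φ` applied to the off-diagonal entries. -/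
noncomputable def signedMap (φ : B →⋆ₙₐ[ℂ] B) (s : ℤˣ) :
    CStarMatrix (Fin 2) (Fin 2) B →⋆ₙₐ[ℂ] CStarMatrix (Fin 2) (Fin 2) B where
  toFun m := CStarMatrix.ofMatrix fun i j => if i = j then φ (m i j) else s • φ (m i j)
  map_smul' c m := by
    refine CStarMatrix.ext fun i j => ?_
    change ite (i = j) (φ (c • m i j)) (s • φ (c • m i j)) = c • ite (i = j) _ (s • φ (m i j))
    rcases Int.units_eq_one_or s with rfl | rfl <;> split_ifs <;> simp
  map_zero' := by
    refine CStarMatrix.ext fun i j => ?_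
    change ite (i = j) (φ 0) (s • φ 0) = 0
    split_ifs <;> simp
  map_add' m n := by
    refine CStarMatrix.ext fun i j => ?_
    change ite (i = j) (φ (m i j + n i j)) (s • φ (m i j + n i j))
      = ite (i = j) _ (s • φ (m i j)) + ite (i = j) _ (s • φ (n i j))
    split_ifs <;> simp
  map_mul' m n := by
    refine CStarMatrix.ext fun i j => ?_
    change ite (i = j) (φ ((m * n) i j)) (s • φ ((m * n) i j)) = _
    simp only [CStarMatrix.mul_apply, Fin.sum_univ_two]
    change _ = ite (i = 0) _ (s • φ (m i 0)) * ite (0 = j) _ (s • φ (n 0 j))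
      + ite (i = 1) _ (s • φ (m i 1)) * ite (1 = j) _ (s • φ (n 1 j))
    rcases Int.units_eq_one_or s with rfl | rfl <;> fin_cases i <;> fin_cases j <;>
      simp
  map_star' m := by
    refine CStarMatrix.ext fun i j => ?_
    change ite (i = j) (φ (star (m j i))) (s • φ (star (m j i)))
      = star (ite (j = i) _ (s • φ (m j i)))
    rcases Int.units_eq_one_or s with rfl | rfl <;> simp only [eq_comm (a := i) (b := j)] <;>
      split_ifs <;> simp [map_star]

variable {B} in
theorem signedMap_apply (φ : B →⋆ₙₐ[ℂ] B) (s : ℤˣ) (m : CStarMatrix (Fin 2) (Fin 2) B)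
    (i j : Fin 2) :
    B.signedMap φ s m i j = if i = j then φ (m i j) else s • φ (m i j) := rfl

/-- The map `a + b e ↦ φ(a) + s φ(b) e` of `B ⊗̂ Cl₁`, for a graded *-homomorphism `φ` of `B` and a
sign `s`. -/
noncomputable def cliffordMap (φ : B →⋆ₙₐ[ℂ] B) (hφ : ∀ b, φ (B.grading b) = B.grading (φ b))
    (s : ℤˣ) : B.cliffordSubalgebra →⋆ₙₐ[ℂ] B.cliffordSubalgebra :=
  NonUnitalStarAlgHom.codRestrict
    ((B.signedMap φ s).comp (NonUnitalStarSubalgebraClass.subtype B.cliffordSubalgebra))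
    B.cliffordSubalgebra fun m => by
      obtain ⟨m, h1, h2⟩ := m
      constructor
      · change φ (m 1 1) = B.grading (φ (m 0 0))
        rw [h1, hφ]
      · change s • φ (m 1 0) = B.grading (s • φ (m 0 1))
        rw [h2, hφ]
        rcases Int.units_eq_one_or s with rfl | rfl <;> simp

theorem cliffordMap_apply (φ : B →⋆ₙₐ[ℂ] B) (hφ : ∀ b, φ (B.grading b) = B.grading (φ b))
    (s : ℤˣ) (m : B.cliffordSubalgebra) (i j : Fin 2) :
    (B.cliffordMap φ hφ s m).1 i j = if i = j then φ (m.1 i j) else s • φ (m.1 i j) := rfl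

/-- The graded `G`-C*-algebra `B ⊗̂ Cl₁`: `G` acts by `a + b e ↦ β_g(a) + β_g(b) e`, and the grading
is `a + b e ↦ ε(a) - ε(b) e`. -/
noncomputable def clifford : GradedGAlgebra.{u} G where
  carrier := B.cliffordSubalgebra
  act :=
    { toFun := fun g => B.cliffordMap (B.act g) (fun b => (B.grading_act g b).symm) 1
      map_one' := by
        refine NonUnitalStarAlgHom.ext fun m => Subtype.ext (CStarMatrix.ext fun i j => ?_)
        simp [cliffordMap_apply]
      map_mul' := fun g h => by
        refine NonUnitalStarAlgHom.ext fun m => Subtype.ext (CStarMatrix.ext fun i j => ?_)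
        change _ = (B.cliffordMap (B.act g) (fun b => (B.grading_act g b).symm) 1
          (B.cliffordMap (B.act h) (fun b => (B.grading_act h b).symm) 1 m)).1 i j
        simp only [cliffordMap_apply, map_mul, one_smul, ite_self]
        rfl }
  grading := B.cliffordMap B.grading (fun _ => rfl) (-1)
  grading_grading m := by
    refine Subtype.ext (CStarMatrix.ext fun i j => ?_)
    rw [cliffordMap_apply, cliffordMap_apply]
    split_ifs <;> simp [B.grading_grading]
  grading_act g m := by
    refine Subtype.ext (CStarMatrix.ext fun i j => ?_)
    change (B.cliffordMap B.grading (fun _ => rfl) (-1)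
        (B.cliffordMap (B.act g) (fun b => (B.grading_act g b).symm) 1 m)).1 i j
      = (B.cliffordMap (B.act g) (fun b => (B.grading_act g b).symm) 1
        (B.cliffordMap B.grading (fun _ => rfl) (-1) m)).1 i j
    simp only [cliffordMap_apply]
    split_ifs <;> simp [B.grading_act]

end Clifford


end GradedGAlgebra


section HilbertModule

variable {B : Type u} [NonUnitalCStarAlgebra B] [PartialOrder Bᵐᵒᵖ] [StarOrderedRing Bᵐᵒᵖ]
variable {E : Type w} [NormedAddCommGroup E] [NormedSpace ℂ E] [SMul Bᵐᵒᵖ E] [CStarModule Bᵐᵒᵖ E]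

/-- The `B`-valued inner product of a right Hilbert `B`-module: linear in the second variable, with
`⟨x, y b⟩ = ⟨x, y⟩ b`. Mathlib's `CStarModule A E` uses a left `A`-action with
`⟨x, a • y⟩ = a ⟨x, y⟩`; a right Hilbert `B`-module is therefore a `CStarModule Bᵐᵒᵖ E`, its right
action is `x <• b`, and the inner product is read in `B` instead of `Bᵐᵒᵖ`. -/
def hinner (B : Type u) [NonUnitalCStarAlgebra B] [PartialOrder Bᵐᵒᵖ]
    {E : Type w} [NormedAddCommGroup E] [NormedSpace ℂ E] [SMul Bᵐᵒᵖ E] [CStarModule Bᵐᵒᵖ E]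
    (x y : E) : B := unop (inner Bᵐᵒᵖ x y)

/-- `E` is countably generated as a Hilbert `B`-module: for some countable set `s`, the span of the
products `x b` with `x ∈ s` and `b ∈ B` is dense. -/
def IsCountablyGenerated (B : Type u) [NonUnitalCStarAlgebra B] 
    (E : Type w) [NormedAddCommGroup E] [NormedSpace ℂ E] [SMul Bᵐᵒᵖ E] : Prop :=
  ∃ s : Set E, s.Countable ∧
    Dense (Submodule.span ℂ {z : E | ∃ x ∈ s, ∃ b : B, z = x <• b} : Set E)

theorem hinner_ext {x y : E} (h : ∀ z, hinner B z x = hinner B z y) : x = y := by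
  rw [← sub_eq_zero, ← CStarModule.inner_self (A := Bᵐᵒᵖ), CStarModule.inner_sub_right, sub_eq_zero]
  exact unop_injective (h _)

theorem hinner_smul (x y : E) (b : B) : hinner B x (y <• b) = hinner B x y * b := by
  simp [hinner]

theorem hinner_add (x y z : E) : hinner B x (y + z) = hinner B x y + hinner B x z := by
  simp [hinner]

theorem hinner_sub (x y z : E) : hinner B x (y - z) = hinner B x y - hinner B x z := by
  simp [hinner]

theorem hinner_csmul (x y : E) (c : ℂ) : hinner B x (c • y) = c • hinner B x y := by
  simp [hinner]

theorem star_hinner (x y : E) : star (hinner B x y) = hinner B y x := by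
  rw [hinner, ← unop_star, CStarModule.star_inner, hinner]

theorem hinner_csmul_left (x y : E) (r : ℝ) :
    hinner B ((r : ℂ) • x) y = (r : ℂ) • hinner B x y := by
  rw [← star_hinner, hinner_csmul, star_smul, star_hinner]
  simp

theorem hinner_add_left (x y z : E) : hinner B (x + y) z = hinner B x z + hinner B y z := by
  rw [← star_hinner, hinner_add, star_add, star_hinner, star_hinner]

theorem hadd_smul (x y : E) (b : B) : (x + y) <• b = x <• b + y <• b := by
  refine hinner_ext (B := B) fun z => ?_
  rw [hinner_add, hinner_smul, hinner_smul, hinner_smul, hinner_add, add_mul]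

theorem hsmul_add (x : E) (b c : B) : x <• (b + c) = x <• b + x <• c := by
  refine hinner_ext (B := B) fun z => ?_
  rw [hinner_add, hinner_smul, hinner_smul, hinner_smul, mul_add]

theorem hsmul_csmul (x : E) (b : B) (c : ℂ) : (c • x) <• b = c • (x <• b) := by
  refine hinner_ext (B := B) fun z => ?_
  rw [hinner_csmul, hinner_smul, hinner_smul, hinner_csmul, smul_mul_assoc]

theorem hsmul_csmul' (x : E) (b : B) (c : ℂ) : x <• (c • b) = c • (x <• b) := by
  refine hinner_ext (B := B) fun z => ?_
  rw [hinner_csmul, hinner_smul, hinner_smul, mul_smul_comm]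

theorem hnorm_smul_le (x : E) (b : B) : ‖x <• b‖ ≤ ‖x‖ * ‖b‖ := by
  have h : ‖x <• b‖ ^ 2 ≤ (‖x‖ * ‖b‖) ^ 2 := by
    rw [CStarModule.norm_sq_eq Bᵐᵒᵖ, CStarModule.inner_op_smul_right,
      CStarModule.inner_op_smul_left, mul_pow, CStarModule.norm_sq_eq Bᵐᵒᵖ (x := x)]
    calc _ ≤ ‖op b‖ * (‖inner Bᵐᵒᵖ x x‖ * ‖star (op b)‖) :=
          (norm_mul_le _ _).trans (by gcongr; exact norm_mul_le _ _)
      _ = _ := by rw [norm_star, norm_op]; ring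
  exact abs_le_of_sq_le_sq' h (by positivity) |>.2

theorem hinner_norm_le (x y : E) : ‖hinner B x y‖ ≤ ‖x‖ * ‖y‖ := by
  rw [hinner, norm_unop]
  exact CStarModule.norm_inner_le E

/-- The operator `θ_{x,y} : z ↦ x ⟨y, z⟩`. -/
noncomputable def rankOne (B : Type u) [NonUnitalCStarAlgebra B] [PartialOrder Bᵐᵒᵖ] [StarOrderedRing Bᵐᵒᵖ]
    {E : Type w} [NormedAddCommGroup E] [NormedSpace ℂ E] [SMul Bᵐᵒᵖ E] [CStarModule Bᵐᵒᵖ E]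
    (x y : E) : E →L[ℂ] E :=
  LinearMap.mkContinuous
    { toFun := fun z => x <• hinner B y z
      map_add' := fun z z' => by rw [hinner_add, hsmul_add]
      map_smul' := fun c z => by rw [hinner_csmul, hsmul_csmul']; rfl }
    (‖x‖ * ‖y‖) fun z => by
      refine (hnorm_smul_le x _).trans ?_
      rw [mul_assoc]
      exact mul_le_mul_of_nonneg_left (hinner_norm_le y z) (norm_nonneg x)

theorem rankOne_apply (x y z : E) : rankOne B x y z = x <• hinner B y z := rfl

/-- The compact operators of a Hilbert `B`-module: the closed linear span of the `θ_{x,y}`. -/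
noncomputable def compactOps (B : Type u) [NonUnitalCStarAlgebra B] [PartialOrder Bᵐᵒᵖ] [StarOrderedRing Bᵐᵒᵖ]
    (E : Type w) [NormedAddCommGroup E] [NormedSpace ℂ E] [SMul Bᵐᵒᵖ E] [CStarModule Bᵐᵒᵖ E] :
    Submodule ℂ (E →L[ℂ] E) :=
  (Submodule.span ℂ (Set.range fun p : E × E => rankOne B p.1 p.2)).topologicalClosure

theorem rankOne_mem (x y : E) : rankOne B x y ∈ compactOps B E :=
  Submodule.le_topologicalClosure _ (Submodule.subset_span ⟨(x, y), rfl⟩)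

theorem mem_compactOps_of_map {B' : Type*} [NonUnitalCStarAlgebra B'] [PartialOrder B'ᵐᵒᵖ]
    [StarOrderedRing B'ᵐᵒᵖ] {F : Type*} [NormedAddCommGroup F] [NormedSpace ℂ F] [SMul B'ᵐᵒᵖ F]
    [CStarModule B'ᵐᵒᵖ F] (L : (E →L[ℂ] E) →ₗ[ℂ] (F →L[ℂ] F)) (hL : Continuous L)
    (h : ∀ x y, L (rankOne B x y) ∈ compactOps B' F) {k : E →L[ℂ] E} (hk : k ∈ compactOps B E) :
    L k ∈ compactOps B' F := by
  have hle : Submodule.span ℂ (Set.range fun p : E × E => rankOne B p.1 p.2)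
      ≤ (compactOps B' F).comap L :=
    Submodule.span_le.2 (by rintro _ ⟨p, rfl⟩; exact h _ _)
  have hcl : IsClosed ((compactOps B' F).comap L : Set (E →L[ℂ] E)) :=
    (Submodule.isClosed_topologicalClosure _).preimage hL
  exact Submodule.topologicalClosure_minimal _ hle hcl hk

end HilbertModule

/-- A `G`-equivariant Kasparov `A`-`B` cycle `(E, u, Φ, T)`, for a discrete group `G`:
a countably generated `ℤ/2`-graded right Hilbert `B`-module `E` with grading operator `gr`; a compatible
action `u` of `G` by even maps; a graded equivariant *-homomorphism `Φ` from `A` to the adjointable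
operators; and an odd adjointable operator `T` with adjoint `Tadj`, such that for all `a`, `g` the
operators `(T - T*) Φ(a)`, `(T² - 1) Φ(a)`, `(u_g T u_g⁻¹ - T) Φ(a)` and the graded commutator
`T Φ(a) - Φ(ε(a)) T` are compact. -/
structure KasparovCycle {G : Type v} [Group G] (A : GradedGAlgebra.{w} G)
    (B : GradedGAlgebra.{u} G) where
  E : Type u
  [normedAddCommGroup : NormedAddCommGroup E]
  [normedSpace : NormedSpace ℂ E]
  [completeSpace : CompleteSpace E]
  [smul : SMul (B.carrier)ᵐᵒᵖ E]
  [cstarModule : CStarModule (B.carrier)ᵐᵒᵖ E]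
  countablyGenerated : IsCountablyGenerated B.carrier E
  gr : E →L[ℂ] E
  gr_gr : ∀ x, gr (gr x) = x
  gr_inner : ∀ x y, hinner B.carrier (gr x) (gr y) = B.grading (hinner B.carrier x y)
  gr_smul : ∀ (x : E) (b : B), gr (x <• b) = gr x <• B.grading b
  u : G →* (E →L[ℂ] E)
  u_inner : ∀ g x y, hinner B.carrier (u g x) (u g y) = B.act g (hinner B.carrier x y)
  u_smul : ∀ g (x : E) (b : B), u g (x <• b) = u g x <• B.act g b
  u_gr : ∀ g x, u g (gr x) = gr (u g x)
  Φ : A →ₙₐ[ℂ] (E →L[ℂ] E)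
  Φ_adjoint : ∀ a x y, hinner B.carrier (Φ a x) y = hinner B.carrier x (Φ (star a) y)
  Φ_gr : ∀ a x, gr (Φ a x) = Φ (A.grading a) (gr x)
  Φ_u : ∀ g a x, u g (Φ a x) = Φ (A.act g a) (u g x)
  T : E →L[ℂ] E
  Tadj : E →L[ℂ] E
  T_adjoint : ∀ x y, hinner B.carrier (T x) y = hinner B.carrier x (Tadj y)
  T_gr : ∀ x, gr (T x) = -T (gr x)
  compact_sub_adj : ∀ a, (T - Tadj) * Φ a ∈ compactOps B.carrier E
  compact_sq : ∀ a, (T * T - 1) * Φ a ∈ compactOps B.carrier E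
  compact_equivariance : ∀ g a, (u g * T * u g⁻¹ - T) * Φ a ∈ compactOps B.carrier E
  compact_commutator : ∀ a, T * Φ a - Φ (A.grading a) * T ∈ compactOps B.carrier E

namespace KasparovCycle

attribute [instance] normedAddCommGroup normedSpace completeSpace smul cstarModule

variable {G : Type v} [Group G] {A : GradedGAlgebra.{w} G} {B : GradedGAlgebra.{u} G}

/-- Evaluation of a path in `B` at `t`. -/
def _root_.GradedGAlgebra.evalAt (B : GradedGAlgebra.{u} G) (t : unitInterval) (f : B.path) : B :=
  DFunLike.coe (F := C(unitInterval, B)) f t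

/-- The cycle `X` over `B` is (unitarily equivalent to) the fibre at `t` of the cycle `Z` over
`C([0,1], B)`: it is the quotient of `Z` by the null space of `⟨·,·⟩(t)`, with all the structure
induced from `Z`. -/
def IsEvaluation (t : unitInterval) (Z : KasparovCycle A B.path) (X : KasparovCycle A B) : Prop :=
  ∃ π : Z.E →ₗ[ℂ] X.E, Function.Surjective π ∧
    (∀ x y, hinner B.carrier (π x) (π y) = B.evalAt t (hinner B.path.carrier x y)) ∧
    (∀ (x : Z.E) (f : B.path), π (x <• f) = π x <• B.evalAt t f) ∧
    (∀ x, π (Z.gr x) = X.gr (π x)) ∧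
    (∀ g x, π (Z.u g x) = X.u g (π x)) ∧
    (∀ a x, π (Z.Φ a x) = X.Φ a (π x)) ∧
    (∀ x, π (Z.T x) = X.T (π x))

/-- Homotopy of Kasparov cycles: some cycle over `C([0,1], B)` has fibres `X` at `0` and `Y` at `1`. -/
def Homotopic (X Y : KasparovCycle A B) : Prop :=
  ∃ Z : KasparovCycle A B.path, IsEvaluation 0 Z X ∧ IsEvaluation 1 Z Y

end KasparovCycle


section PathModule

open unitInterval

variable {B : Type u} [NonUnitalCStarAlgebra B] [PartialOrder Bᵐᵒᵖ] [StarOrderedRing Bᵐᵒᵖ]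
variable {E : Type w} [NormedAddCommGroup E] [NormedSpace ℂ E] [SMul Bᵐᵒᵖ E] [CStarModule Bᵐᵒᵖ E]

/-- Continuous paths in `E`; if `v` holds, only those that vanish at `1`. -/
def pathSpace (E : Type w) [NormedAddCommGroup E] [NormedSpace ℂ E] (v : Prop) :
    Submodule ℂ C(I, E) where
  carrier := {f | v → f 1 = 0}
  add_mem' hf hg h := by simp [hf h, hg h]
  zero_mem' _ := rfl
  smul_mem' c f hf h := by simp [hf h]

/-- The paths of `pathSpace`, as a Hilbert module over `C([0,1], B)` with pointwise structure. -/
def Paths (E : Type w) [NormedAddCommGroup E] [NormedSpace ℂ E] (v : Prop) : Type w :=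
  pathSpace E v

noncomputable instance (v : Prop) : NormedAddCommGroup (Paths E v) :=
  inferInstanceAs (NormedAddCommGroup (pathSpace E v))

noncomputable instance (v : Prop) : NormedSpace ℂ (Paths E v) :=
  inferInstanceAs (NormedSpace ℂ (pathSpace E v))

/-- A path as an element of `Paths E v`. -/
def Paths.mk {v : Prop} (f : C(I, E)) (h : v → f 1 = 0) : Paths E v := ⟨f, h⟩

/-- Evaluation of a path at `t`. -/
def Paths.eval (v : Prop) (t : I) : Paths E v →ₗ[ℂ] E where
  toFun f := f.1 t
  map_add' _ _ := rfl
  map_smul' _ _ := rfl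

instance [CompleteSpace E] (v : Prop) : CompleteSpace (Paths E v) := by
  have h : IsClosed (pathSpace E v : Set C(I, E)) := by
    by_cases hv : v
    · have : (pathSpace E v : Set C(I, E)) = {f | f 1 = 0} := by
        ext f; simp [pathSpace, hv]
      rw [this]
      exact isClosed_eq (continuous_eval_const (F := C(I, E)) 1) continuous_const
    · have : (pathSpace E v : Set C(I, E)) = Set.univ := by
        ext f; simp [pathSpace, hv]
      rw [this]
      exact isClosed_univ
  have := h.completeSpace_coe
  exact inferInstanceAs (CompleteSpace (pathSpace E v))

theorem continuous_hsmul : Continuous fun p : E × B => p.1 <• p.2 := by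
  let L : E →ₗ[ℂ] B →ₗ[ℂ] E := LinearMap.mk₂ ℂ (fun x b => x <• b) (fun x y b => hadd_smul x y b)
    (fun c x b => hsmul_csmul x b c) (fun x b c => hsmul_add x b c) (fun c x b => hsmul_csmul' x b c)
  have := (L.mkContinuous₂ 1 fun x b => by simpa [L] using hnorm_smul_le x b)
  exact (L.mkContinuous₂ 1 fun x b => by simpa [L] using hnorm_smul_le x b).continuous₂

theorem continuous_hinner : Continuous fun p : E × E => hinner B p.1 p.2 :=
  continuous_unop.comp CStarModule.continuous_inner

theorem hzero_smul (b : B) : (0 : E) <• b = 0 := by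
  simpa using hsmul_csmul (0 : E) b 0

instance (v : Prop) : SMul C(I, B)ᵐᵒᵖ (Paths E v) where
  smul F f := Paths.mk ⟨fun t => f.1 t <• F.unop t,
    continuous_hsmul.comp (f.1.continuous.prodMk F.unop.continuous)⟩ fun h => by
      change f.1 1 <• F.unop 1 = 0
      rw [f.2 h, hzero_smul]

theorem path_smul_apply {v : Prop} (f : Paths E v) (F : C(I, B)) (t : I) :
    (f <• F).1 t = f.1 t <• F t := rfl

/-- The pointwise inner product of two paths. -/
def pathInner {v : Prop} (f g : Paths E v) : C(I, B) :=
  ⟨fun t => hinner B (f.1 t) (g.1 t), continuous_hinner.comp (f.1.continuous.prodMk g.1.continuous)⟩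

variable [PartialOrder C(I, B)ᵐᵒᵖ] [StarOrderedRing C(I, B)ᵐᵒᵖ]

theorem pathInner_nonneg {v : Prop} (f : Paths E v) :
    0 ≤ op (pathInner (B := B) f f) := by
  let a : I → Bᵐᵒᵖ := fun t => inner Bᵐᵒᵖ (f.1 t) (f.1 t)
  have ha0 (t : I) : 0 ≤ a t := CStarModule.inner_self_nonneg
  have hac : Continuous a := CStarModule.continuous_inner.comp (f.1.continuous.prodMk f.1.continuous)
  have hsc : Continuous fun t => CFC.sqrt (a t) :=
    CFC.continuousOn_sqrt.comp_continuous hac ha0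
  let S : C(I, B)ᵐᵒᵖ := op ⟨fun t => (CFC.sqrt (a t)).unop, continuous_unop.comp hsc⟩
  have : op (pathInner (B := B) f f) = star S * S := by
    apply unop_injective
    ext t
    apply op_injective
    change a t = star (CFC.sqrt (a t)) * CFC.sqrt (a t)
    rw [(CFC.sqrt_nonneg (a t)).isSelfAdjoint.star_eq, CFC.sqrt_mul_sqrt_self (a t) (ha0 t)]
  rw [this]
  exact star_mul_self_nonneg S

instance (v : Prop) : CStarModule C(I, B)ᵐᵒᵖ (Paths E v) where
  inner f g := op (pathInner f g)
  inner_add_right {f g h} := by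
    refine unop_injective (ContinuousMap.ext fun t => hinner_add _ _ _)
  inner_self_nonneg {f} := pathInner_nonneg f
  inner_self {f} := by
    constructor
    · intro h
      refine Subtype.ext (ContinuousMap.ext fun t => ?_)
      have := DFunLike.congr_fun (congrArg unop h) t
      exact (CStarModule.inner_self (A := Bᵐᵒᵖ)).1 (unop_injective this)
    · rintro rfl
      refine unop_injective (ContinuousMap.ext fun t => ?_)
      exact congrArg unop ((CStarModule.inner_self (A := Bᵐᵒᵖ) (E := E)).2 rfl)
  inner_op_smul_right {F f g} :=
    unop_injective (ContinuousMap.ext fun t => hinner_smul _ _ _)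
  inner_smul_right_complex {z f g} :=
    unop_injective (ContinuousMap.ext fun t => hinner_csmul _ _ _)
  star_inner f g := unop_injective (ContinuousMap.ext fun t => star_hinner _ _)
  norm_eq_sqrt_norm_inner_self f := by
    have h (t : I) : ‖f.1 t‖ ^ 2 = ‖pathInner (B := B) f f t‖ := CStarModule.norm_sq_eq Bᵐᵒᵖ
    rw [norm_op]
    refine le_antisymm ?_ ?_
    · refine (ContinuousMap.norm_le _ (Real.sqrt_nonneg _)).2 fun t => Real.le_sqrt_of_sq_le ?_
      change ‖f.1 t‖ ^ 2 ≤ _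
      rw [h]
      exact (pathInner (B := B) f f).norm_coe_le_norm t
    · refine Real.sqrt_le_iff.2 ⟨norm_nonneg _, (ContinuousMap.norm_le _ (by positivity)).2 fun t => ?_⟩
      change ‖pathInner (B := B) f f t‖ ≤ ‖f.1‖ ^ 2
      rw [← h]
      gcongr
      exact f.1.norm_coe_le_norm t

theorem path_hinner {v : Prop} (f g : Paths E v) (t : I) :
    hinner C(I, B) f g t = hinner B (f.1 t) (g.1 t) := rfl



/-- The operator on paths that is `c t • k` at time `t`. -/
noncomputable def pathMap (v : Prop) (c : C(I, ℝ)) (k : E →L[ℂ] E) :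
    Paths E v →L[ℂ] Paths E v :=
  LinearMap.mkContinuous
    { toFun := fun f => Paths.mk ⟨fun t => (c t : ℂ) • k (f.1 t), by fun_prop⟩ fun h => by
        change (c 1 : ℂ) • k (f.1 1) = 0
        rw [f.2 h, map_zero, smul_zero]
      map_add' := fun f g => Subtype.ext (ContinuousMap.ext fun t => by
        change (c t : ℂ) • k (f.1 t + g.1 t) = (c t : ℂ) • k (f.1 t) + (c t : ℂ) • k (g.1 t)
        rw [map_add, smul_add])
      map_smul' := fun z f => Subtype.ext (ContinuousMap.ext fun t => by
        change (c t : ℂ) • k (z • f.1 t) = z • (c t : ℂ) • k (f.1 t)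
        rw [map_smul, smul_comm]) }
    (‖c‖ * ‖k‖) fun f => (ContinuousMap.norm_le _ (by positivity)).2 fun t => by
      change ‖(c t : ℂ) • k (f.1 t)‖ ≤ _
      rw [norm_smul, mul_assoc]
      gcongr
      · simpa using c.norm_coe_le_norm t
      · exact (k.le_opNorm _).trans (by gcongr; exact f.1.norm_coe_le_norm t)

theorem norm_pathMap_le {v : Prop} (c : C(I, ℝ)) (k : E →L[ℂ] E) :
    ‖pathMap v c k‖ ≤ ‖c‖ * ‖k‖ :=
  LinearMap.mkContinuous_norm_le _ (mul_nonneg (norm_nonneg c) (norm_nonneg k)) _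

theorem pathMap_apply {v : Prop} (c : C(I, ℝ)) (k : E →L[ℂ] E) (f : Paths E v) (t : I) :
    (pathMap v c k f).1 t = (c t : ℂ) • k (f.1 t) := rfl

theorem Paths_ext {v : Prop} {f g : Paths E v} (h : ∀ t, f.1 t = g.1 t) : f = g :=
  Subtype.ext (ContinuousMap.ext h)

theorem pathMap_mem_compactOps {v : Prop} {c : C(I, ℝ)} (hc : ∀ t, 0 ≤ c t)
    (hv : v → c 1 = 0) {k : E →L[ℂ] E} (hk : k ∈ compactOps B E) :
    pathMap v c k ∈ compactOps C(I, B) (Paths E v) := by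
  let L : (E →L[ℂ] E) →ₗ[ℂ] (Paths E v →L[ℂ] Paths E v) :=
    { toFun := pathMap v c
      map_add' := fun k l => by
        ext f : 1
        exact Paths_ext fun t => smul_add _ _ _
      map_smul' := fun z k => by
        ext f : 1
        exact Paths_ext fun t => smul_comm _ _ _ }
  have hL : Continuous L := by
    have hb (k : E →L[ℂ] E) : ‖L k‖ ≤ ‖c‖ * ‖k‖ :=
      norm_pathMap_le c k
    exact (L.mkContinuous ‖c‖ hb).continuous
  refine mem_compactOps_of_map L hL (fun x y => ?_) hk
  let q (x : E) : Paths E v := Paths.mk ⟨fun t => ((Real.sqrt (c t) : ℝ) : ℂ) • x, by fun_prop⟩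
    fun h => by
      change ((Real.sqrt (c 1) : ℝ) : ℂ) • x = 0
      simp [hv h]
  have : L (rankOne B x y) = rankOne C(I, B) (q x) (q y) := by
    ext f : 1
    refine Paths_ext fun t => ?_
    change (c t : ℂ) • (x <• hinner B y (f.1 t))
      = (((Real.sqrt (c t) : ℝ) : ℂ) • x) <•
        hinner B (((Real.sqrt (c t) : ℝ) : ℂ) • y) (f.1 t)
    have h1 : hinner B (((Real.sqrt (c t) : ℝ) : ℂ) • y) (f.1 t)
        = ((Real.sqrt (c t) : ℝ) : ℂ) • hinner B y (f.1 t) := by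
      rw [← star_hinner, hinner_csmul, star_smul, star_hinner]
      simp
    rw [h1, hsmul_csmul, hsmul_csmul', smul_smul, ← Complex.ofReal_mul, Real.mul_self_sqrt (hc t)]
  rw [this]
  exact rankOne_mem _ _

theorem isCountablyGenerated_Paths (v : Prop) (h : IsCountablyGenerated B E) :
    IsCountablyGenerated C(I, B) (Paths E v) := by
  classical
  obtain ⟨s, hs, hd⟩ := h
  let ψ : C(I, ℝ) := if v then ⟨fun t => 1 - (t : ℝ), by fun_prop⟩ else 1
  have hψ (hv : v) : ψ 1 = 0 := by simp [ψ, hv]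
  let gen (φ : C(I, ℝ)) (hφ : v → φ 1 = 0) : E →L[ℂ] Paths E v :=
    LinearMap.mkContinuous
      { toFun := fun z => Paths.mk ⟨fun t => (φ t : ℂ) • z, by fun_prop⟩ fun h => by
          change (φ 1 : ℂ) • z = 0
          simp [hφ h]
        map_add' := fun z z' => Paths_ext fun t => smul_add _ _ _
        map_smul' := fun a z => Paths_ext fun t => smul_comm _ _ _ }
      ‖φ‖ fun z => (ContinuousMap.norm_le _ (by positivity)).2 fun t => by
        change ‖(φ t : ℂ) • z‖ ≤ _
        rw [norm_smul]
        gcongr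
        simpa using φ.norm_coe_le_norm t
  refine ⟨gen ψ hψ '' s, hs.image _, ?_⟩
  set M := (Submodule.span ℂ {z : Paths E v | ∃ x ∈ gen ψ hψ '' s, ∃ b : C(I, B), z = x <• b})
  have key (φ φ' : C(I, ℝ)) (hφ : v → φ 1 = 0) (h : φ = ψ * φ') (z : E) :
      gen φ hφ z ∈ M.topologicalClosure := by
    have hcl : IsClosed (M.topologicalClosure.comap (gen φ hφ).toLinearMap : Set E) :=
      (Submodule.isClosed_topologicalClosure _).preimage (gen φ hφ).continuous
    have hle : Submodule.span ℂ {z : E | ∃ x ∈ s, ∃ b : B, z = x <• b}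
        ≤ M.topologicalClosure.comap (gen φ hφ).toLinearMap := by
      refine Submodule.span_le.2 ?_
      rintro _ ⟨x, hx, b, rfl⟩
      refine Submodule.le_topologicalClosure _ (Submodule.subset_span
        ⟨gen ψ hψ x, ⟨x, hx, rfl⟩, ⟨fun t => (φ' t : ℂ) • b, by fun_prop⟩, Paths_ext fun t => ?_⟩)
      change (φ t : ℂ) • (x <• b) = ((ψ t : ℂ) • x) <• ((φ' t : ℂ) • b)
      rw [hsmul_csmul, hsmul_csmul', smul_smul, h]
      simp
    exact hcl.closure_subset_iff.2 hle (hd z)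
  intro f
  have hlim := bernsteinApproximation_uniform f.1
  let b (n : ℕ) : Paths E v := Paths.mk (bernsteinApproximation (n + 1) f.1) fun h => by
    rw [bernsteinApproximation.apply_one (Nat.succ_ne_zero n), f.2 h]
  have hb : Filter.Tendsto b Filter.atTop (nhds f) :=
    tendsto_subtype_rng.2 (hlim.comp (Filter.tendsto_add_atTop_nat 1))
  refine isClosed_closure.mem_of_tendsto hb (Filter.Eventually.of_forall fun n => ?_)
  change b n ∈ M.topologicalClosure
  let φ (k : Fin (n + 1 + 1)) : C(I, ℝ) :=
    if v ∧ k = Fin.last (n + 1) then 0 else bernstein (n + 1) k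
  have hφ (k : Fin (n + 1 + 1)) : ∃ φ', φ k = ψ * φ' := by
    by_cases hv : v
    · by_cases hk : k = Fin.last (n + 1)
      · exact ⟨0, by simp [φ, hv, hk]⟩
      · have hk' : (k : ℕ) < n + 1 := Fin.val_lt_last hk
        refine ⟨⟨fun t => ((n + 1).choose k : ℝ) * (t : ℝ) ^ (k : ℕ) *
          (1 - (t : ℝ)) ^ (n - (k : ℕ)), by fun_prop⟩, ContinuousMap.ext fun t => ?_⟩
        have e : n + 1 - (k : ℕ) = n - k + 1 := by omega
        simp [φ, ψ, hv, hk, bernstein_apply, e, pow_succ]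
        ring
    · exact ⟨bernstein (n + 1) k, by simp [φ, ψ, hv]⟩
  choose φ' hφ' using hφ
  have hφ1 (k) (h : v) : φ k 1 = 0 := by rw [hφ']; simp [hψ h]
  have : b n = ∑ k, gen (φ k) (hφ1 k) (f.1 (bernstein.z k)) := by
    refine Paths_ext fun t => ?_
    change bernsteinApproximation (n + 1) f.1 t = _
    change _ = Paths.eval v t (∑ k, gen (φ k) (hφ1 k) (f.1 (bernstein.z k)))
    rw [bernsteinApproximation.apply, map_sum]
    refine Finset.sum_congr rfl fun k _ => ?_
    change bernstein (n + 1) k t • f.1 (bernstein.z k) = (φ k t : ℂ) • f.1 (bernstein.z k)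
    by_cases h : v ∧ k = Fin.last (n + 1)
    · have : f.1 (bernstein.z k) = 0 := by
        rw [h.2, bernstein.z_last (Nat.succ_ne_zero n), f.2 h.1]
      simp [this]
    · simp [φ, h]
  rw [this]
  exact Submodule.sum_mem _ fun k _ => key (φ k) (φ' k) (hφ1 k) (hφ' k) _

end PathModule


section ProdModule

open WithCStarModule

variable {B : Type u} [NonUnitalCStarAlgebra B] [PartialOrder Bᵐᵒᵖ] [StarOrderedRing Bᵐᵒᵖ]
variable {E : Type w} [NormedAddCommGroup E] [NormedSpace ℂ E] [SMul Bᵐᵒᵖ E] [CStarModule Bᵐᵒᵖ E]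
variable {F : Type w'} [NormedAddCommGroup F] [NormedSpace ℂ F] [SMul Bᵐᵒᵖ F] [CStarModule Bᵐᵒᵖ F]

def DirSum (B : Type u) (E : Type w) (F : Type w') : Type max w w' :=
  WithCStarModule Bᵐᵒᵖ (E × F)

noncomputable instance : NormedAddCommGroup (DirSum B E F) :=
  inferInstanceAs (NormedAddCommGroup (WithCStarModule Bᵐᵒᵖ (E × F)))

noncomputable instance : NormedSpace ℂ (DirSum B E F) :=
  inferInstanceAs (NormedSpace ℂ (WithCStarModule Bᵐᵒᵖ (E × F)))

instance : SMul Bᵐᵒᵖ (DirSum B E F) :=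
  inferInstanceAs (SMul Bᵐᵒᵖ (WithCStarModule Bᵐᵒᵖ (E × F)))

noncomputable instance : CStarModule Bᵐᵒᵖ (DirSum B E F) :=
  inferInstanceAs (CStarModule Bᵐᵒᵖ (WithCStarModule Bᵐᵒᵖ (E × F)))

instance [CompleteSpace E] [CompleteSpace F] : CompleteSpace (DirSum B E F) :=
  inferInstanceAs (CompleteSpace (WithCStarModule Bᵐᵒᵖ (E × F)))

def DirSum.mk (B : Type u) {E : Type w} {F : Type w'} (x : E) (y : F) : DirSum B E F :=
  (equiv Bᵐᵒᵖ (E × F)).symm (x, y)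

theorem DirSum.norm_mk_le (x : E) (y : F) : ‖DirSum.mk B x y‖ ≤ ‖x‖ + ‖y‖ :=
  prod_norm_le_norm_add (A := Bᵐᵒᵖ) (E := E) (F := F) (DirSum.mk B x y)

noncomputable def sumMap (B : Type u) [NonUnitalCStarAlgebra B] [PartialOrder Bᵐᵒᵖ]
    [StarOrderedRing Bᵐᵒᵖ] [SMul Bᵐᵒᵖ E] [CStarModule Bᵐᵒᵖ E] [SMul Bᵐᵒᵖ F] [CStarModule Bᵐᵒᵖ F]
    (k : E →L[ℂ] E) (l : F →L[ℂ] F) :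
    DirSum B E F →L[ℂ] DirSum B E F :=
  LinearMap.mkContinuous
    { toFun := fun z => DirSum.mk B (k z.1) (l z.2)
      map_add' := fun z z' => Prod.ext (map_add k _ _) (map_add l _ _)
      map_smul' := fun c z => Prod.ext (map_smul k _ _) (map_smul l _ _) }
    (‖k‖ + ‖l‖) fun z => by
      have h := max_le_prod_norm (A := Bᵐᵒᵖ) (E := E) (F := F) z
      refine (DirSum.norm_mk_le _ _).trans ?_
      rw [add_mul]
      refine add_le_add ((k.le_opNorm _).trans ?_) ((l.le_opNorm _).trans ?_)
      · exact mul_le_mul_of_nonneg_left ((le_max_left _ _).trans h) (norm_nonneg k)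
      · exact mul_le_mul_of_nonneg_left ((le_max_right _ _).trans h) (norm_nonneg l)

theorem norm_sumMap_le (k : E →L[ℂ] E) (l : F →L[ℂ] F) : ‖sumMap B k l‖ ≤ ‖k‖ + ‖l‖ :=
  LinearMap.mkContinuous_norm_le _ (add_nonneg (norm_nonneg k) (norm_nonneg l)) _

theorem sum_hinner (z z' : DirSum B E F) :
    hinner B z z' = hinner B z.1 z'.1 + hinner B z.2 z'.2 := rfl

theorem hzero_hinner (y : E) : hinner B (0 : E) y = 0 := by
  simp [hinner]

theorem sumMap_mem_compactOps {k : E →L[ℂ] E} {l : F →L[ℂ] F} (hk : k ∈ compactOps B E)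
    (hl : l ∈ compactOps B F) : sumMap B k l ∈ compactOps B (DirSum B E F) := by
  let L : (E →L[ℂ] E) →ₗ[ℂ] (DirSum B E F →L[ℂ] DirSum B E F) :=
    { toFun := fun k => sumMap B k 0
      map_add' := fun k k' => ContinuousLinearMap.ext fun z => Prod.ext rfl (add_zero _).symm
      map_smul' := fun c k => ContinuousLinearMap.ext fun z => Prod.ext rfl (smul_zero _).symm }
  let R : (F →L[ℂ] F) →ₗ[ℂ] (DirSum B E F →L[ℂ] DirSum B E F) :=
    { toFun := fun l => sumMap B 0 l
      map_add' := fun k k' => ContinuousLinearMap.ext fun z => Prod.ext (add_zero _).symm rfl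
      map_smul' := fun c k => ContinuousLinearMap.ext fun z => Prod.ext (smul_zero _).symm rfl }
  have hL : Continuous L := by
    have hb (k : E →L[ℂ] E) : ‖L k‖ ≤ 1 * ‖k‖ :=
      (norm_sumMap_le k (0 : F →L[ℂ] F)).trans (by rw [norm_zero, add_zero, one_mul])
    exact (L.mkContinuous 1 hb).continuous
  have hR : Continuous R := by
    have hb (l : F →L[ℂ] F) : ‖R l‖ ≤ 1 * ‖l‖ :=
      (norm_sumMap_le (0 : E →L[ℂ] E) l).trans (by rw [norm_zero, zero_add, one_mul])
    exact (R.mkContinuous 1 hb).continuous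
  have h : sumMap B k l = L k + R l :=
    ContinuousLinearMap.ext fun z => Prod.ext (add_zero _).symm (zero_add _).symm
  rw [h]
  refine add_mem (mem_compactOps_of_map L hL (fun x y => ?_) hk)
    (mem_compactOps_of_map R hR (fun x y => ?_) hl)
  · have : L (rankOne B x y) = rankOne B (E := DirSum B E F)
        (DirSum.mk B x 0) (DirSum.mk B y 0) := by
      refine ContinuousLinearMap.ext fun z => Prod.ext ?_ ?_
      · change x <• hinner B y z.1 = x <• (hinner B y z.1 + hinner B 0 z.2)
        rw [hzero_hinner, add_zero]
      · exact (hzero_smul _).symm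
    rw [this]
    exact rankOne_mem _ _
  · have : R (rankOne B x y) = rankOne B (E := DirSum B E F)
        (DirSum.mk B 0 x) (DirSum.mk B 0 y) := by
      refine ContinuousLinearMap.ext fun z => Prod.ext ?_ ?_
      · exact (hzero_smul _).symm
      · change x <• hinner B y z.2 = x <• (hinner B 0 z.1 + hinner B y z.2)
        rw [hzero_hinner, zero_add]
    rw [this]
    exact rankOne_mem _ _

theorem isCountablyGenerated_prod (hE : IsCountablyGenerated B E) (hF : IsCountablyGenerated B F) :
    IsCountablyGenerated B (DirSum B E F) := by
  obtain ⟨s, hs, hsd⟩ := hE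
  obtain ⟨t, ht, htd⟩ := hF
  let i : E →ₗ[ℂ] DirSum B E F :=
    { toFun := fun x => DirSum.mk B x 0
      map_add' := fun x y => Prod.ext rfl (add_zero _).symm
      map_smul' := fun c x => Prod.ext rfl (smul_zero _).symm }
  let j : F →ₗ[ℂ] DirSum B E F :=
    { toFun := fun x => DirSum.mk B 0 x
      map_add' := fun x y => Prod.ext (add_zero _).symm rfl
      map_smul' := fun c x => Prod.ext (smul_zero _).symm rfl }
  have hi : Continuous i := by
    have hb (x : E) : ‖i x‖ ≤ 1 * ‖x‖ := (DirSum.norm_mk_le x 0).trans (by rw [norm_zero, add_zero, one_mul])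
    exact (i.mkContinuous 1 hb).continuous
  have hj : Continuous j := by
    have hb (x : F) : ‖j x‖ ≤ 1 * ‖x‖ := (DirSum.norm_mk_le 0 x).trans (by rw [norm_zero, zero_add, one_mul])
    exact (j.mkContinuous 1 hb).continuous
  refine ⟨i '' s ∪ j '' t, (hs.image _).union (ht.image _), ?_⟩
  set M := Submodule.span ℂ {z : DirSum B E F | ∃ x ∈ i '' s ∪ j '' t, ∃ b : B, z = x <• b}
  have h1 (x : E) : i x ∈ M.topologicalClosure := by
    have hcl : IsClosed (M.topologicalClosure.comap i : Set E) :=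
      (Submodule.isClosed_topologicalClosure _).preimage hi
    refine hcl.closure_subset_iff.2 (Submodule.span_le.2 ?_) (hsd x)
    rintro _ ⟨x, hx, b, rfl⟩
    exact Submodule.le_topologicalClosure _ (Submodule.subset_span
      ⟨i x, Or.inl ⟨x, hx, rfl⟩, b, Prod.ext rfl (hzero_smul (B := B) (E := F) b).symm⟩)
  have h2 (x : F) : j x ∈ M.topologicalClosure := by
    have hcl : IsClosed (M.topologicalClosure.comap j : Set F) :=
      (Submodule.isClosed_topologicalClosure _).preimage hj
    refine hcl.closure_subset_iff.2 (Submodule.span_le.2 ?_) (htd x)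
    rintro _ ⟨x, hx, b, rfl⟩
    exact Submodule.le_topologicalClosure _ (Submodule.subset_span
      ⟨j x, Or.inr ⟨x, hx, rfl⟩, b, Prod.ext (hzero_smul (B := B) (E := E) b).symm rfl⟩)
  intro z
  have : z = i z.1 + j z.2 := Prod.ext (add_zero _).symm (zero_add _).symm
  rw [this]
  exact add_mem (h1 _) (h2 _)

end ProdModule


section PathMapLemmas

open unitInterval

variable {E : Type w} [NormedAddCommGroup E] [NormedSpace ℂ E]

theorem pathMap_mul (v : Prop) (c d : C(I, ℝ)) (k l : E →L[ℂ] E) :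
    pathMap v c k * pathMap v d l = pathMap v (c * d) (k * l) := by
  refine ContinuousLinearMap.ext fun f => Paths_ext fun t => ?_
  change (c t : ℂ) • k ((d t : ℂ) • l (f.1 t)) = ((c t * d t : ℝ) : ℂ) • k (l (f.1 t))
  rw [map_smul, smul_smul, Complex.ofReal_mul]

theorem pathMap_one (v : Prop) : pathMap v 1 (1 : E →L[ℂ] E) = 1 :=
  ContinuousLinearMap.ext fun f => Paths_ext fun t => by
    change (((1 : ℝ) : ℂ)) • f.1 t = f.1 t
    simp

theorem pathMap_one_apply (v : Prop) (k : E →L[ℂ] E) (f : Paths E v) (t : I) :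
    (pathMap v 1 k f).1 t = k (f.1 t) := by
  change (((1 : ℝ) : ℂ)) • k (f.1 t) = k (f.1 t)
  simp

end PathMapLemmas

namespace KasparovCycle

open unitInterval

variable {G : Type v} [Group G] {A : GradedGAlgebra.{w} G} {B : GradedGAlgebra.{u} G}

/-- Data for deforming the operator `T` of a cycle through `c(t) T + s(t) J`. -/
structure PathData (X : KasparovCycle A B) (p : Prop) where
  c : C(I, ℝ)
  s : C(I, ℝ)
  J : X.E →L[ℂ] X.E
  c_nonneg : ∀ t, 0 ≤ c t
  c_one : p → c 1 = 0
  sq : ∀ t, c t * c t + s t * s t = 1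
  J_sq : ∀ t x, s t ≠ 0 → J (J x) = x
  J_adj : ∀ x y, hinner B.carrier (J x) y = hinner B.carrier x (J y)
  J_gr : ∀ x, X.gr (J x) = -J (X.gr x)
  J_u : ∀ g x, X.u g (J x) = J (X.u g x)
  J_Φ : ∀ a x, J (X.Φ a x) = X.Φ (A.grading a) (J x)
  J_T : ∀ x, J (X.T x) + X.T (J x) = 0

section

variable {X : KasparovCycle A B} {p : Prop} (D : PathData X p)

/-- The operator `c T + s J` on paths. -/
noncomputable def PathData.T : Paths X.E p →L[ℂ] Paths X.E p :=
  pathMap p D.c X.T + pathMap p D.s D.J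

/-- The adjoint of `c T + s J`. -/
noncomputable def PathData.Tadj : Paths X.E p →L[ℂ] Paths X.E p :=
  pathMap p D.c X.Tadj + pathMap p D.s D.J

theorem PathData.T_apply (f : Paths X.E p) (t : I) :
    (D.T f).1 t = (D.c t : ℂ) • X.T (f.1 t) + (D.s t : ℂ) • D.J (f.1 t) := rfl

theorem PathData.sub_adj (a : A) : (D.T - D.Tadj) * pathMap p 1 (X.Φ a)
    = pathMap p D.c ((X.T - X.Tadj) * X.Φ a) := by
  refine ContinuousLinearMap.ext fun f => Paths_ext fun t => ?_
  set y := (pathMap p 1 (X.Φ a) f).1 t with hy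
  have hy' : y = X.Φ a (f.1 t) := pathMap_one_apply _ _ _ _
  change (D.c t : ℂ) • X.T y + (D.s t : ℂ) • D.J y - ((D.c t : ℂ) • X.Tadj y + (D.s t : ℂ) • D.J y)
    = (D.c t : ℂ) • (X.T (X.Φ a (f.1 t)) - X.Tadj (X.Φ a (f.1 t)))
  rw [← hy', smul_sub]
  abel

theorem PathData.sq_sub_one (a : A) : (D.T * D.T - 1) * pathMap p 1 (X.Φ a)
    = pathMap p (D.c * D.c) ((X.T * X.T - 1) * X.Φ a) := by
  refine ContinuousLinearMap.ext fun f => Paths_ext fun t => ?_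
  set y := (pathMap p 1 (X.Φ a) f).1 t with hy
  have hy' : y = X.Φ a (f.1 t) := pathMap_one_apply _ _ _ _
  change (D.c t : ℂ) • X.T ((D.c t : ℂ) • X.T y + (D.s t : ℂ) • D.J y)
    + (D.s t : ℂ) • D.J ((D.c t : ℂ) • X.T y + (D.s t : ℂ) • D.J y) - y
    = ((D.c t * D.c t : ℝ) : ℂ) • (X.T (X.T (X.Φ a (f.1 t))) - X.Φ a (f.1 t))
  rw [← hy']
  have h1 : D.J (X.T y) = -X.T (D.J y) := eq_neg_of_add_eq_zero_left (D.J_T y)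
  have h2 : (D.s t : ℂ) • (D.s t : ℂ) • D.J (D.J y) = (1 - (D.c t : ℂ) * (D.c t : ℂ)) • y := by
    have hsq : 1 - (D.c t : ℂ) * (D.c t : ℂ) = (D.s t : ℂ) * (D.s t : ℂ) := by
      have := congrArg (fun r : ℝ => (r : ℂ)) (D.sq t)
      simp only [Complex.ofReal_add, Complex.ofReal_mul, Complex.ofReal_one] at this
      rw [← this]
      ring
    rw [hsq, mul_smul]
    by_cases hs : D.s t = 0
    · simp [hs]
    · rw [D.J_sq t y hs]
  simp only [map_add, map_smul, smul_add, h1, h2, Complex.ofReal_mul]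
  module

theorem PathData.equivariance (g : G) (a : A) :
    (pathMap p 1 (X.u g) * D.T * pathMap p 1 (X.u g⁻¹) - D.T) * pathMap p 1 (X.Φ a)
      = pathMap p D.c ((X.u g * X.T * X.u g⁻¹ - X.T) * X.Φ a) := by
  refine ContinuousLinearMap.ext fun f => Paths_ext fun t => ?_
  set y := (pathMap p 1 (X.Φ a) f).1 t with hy
  have hy' : y = X.Φ a (f.1 t) := pathMap_one_apply _ _ _ _
  set z := (pathMap p 1 (X.u g⁻¹) (pathMap p 1 (X.Φ a) f)).1 t with hz
  have hz' : z = X.u g⁻¹ y := pathMap_one_apply _ _ _ _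
  change (pathMap p 1 (X.u g) (D.T (pathMap p 1 (X.u g⁻¹) (pathMap p 1 (X.Φ a) f)))).1 t
    - ((D.c t : ℂ) • X.T y + (D.s t : ℂ) • D.J y)
    = (D.c t : ℂ) • (X.u g (X.T (X.u g⁻¹ (X.Φ a (f.1 t)))) - X.T (X.Φ a (f.1 t)))
  have h1 : X.u g (D.J z) = D.J y := by
    rw [D.J_u, hz']
    change D.J ((X.u g * X.u g⁻¹) y) = _
    rw [← map_mul, mul_inv_cancel, map_one]
    rfl
  rw [pathMap_one_apply, PathData.T_apply, ← hz, ← hy', ← hz', map_add, map_smul, map_smul, h1,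
    smul_sub]
  abel

theorem PathData.commutator (a : A) :
    D.T * pathMap p 1 (X.Φ a) - pathMap p 1 (X.Φ (A.grading a)) * D.T
      = pathMap p D.c (X.T * X.Φ a - X.Φ (A.grading a) * X.T) := by
  refine ContinuousLinearMap.ext fun f => Paths_ext fun t => ?_
  change (D.T (pathMap p 1 (X.Φ a) f)).1 t - (pathMap p 1 (X.Φ (A.grading a)) (D.T f)).1 t
    = (D.c t : ℂ) • (X.T (X.Φ a (f.1 t)) - X.Φ (A.grading a) (X.T (f.1 t)))
  rw [PathData.T_apply, pathMap_one_apply, pathMap_one_apply, PathData.T_apply, map_add, map_smul,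
    map_smul, D.J_Φ, smul_sub]
  abel

end

end KasparovCycle


namespace KasparovCycle

open unitInterval

variable {G : Type v} [Group G] {A : GradedGAlgebra.{w} G} {B : GradedGAlgebra.{u} G}

theorem hinner_neg {B : Type u} [NonUnitalCStarAlgebra B] [PartialOrder Bᵐᵒᵖ] [StarOrderedRing Bᵐᵒᵖ]
    {E : Type w} [NormedAddCommGroup E] [NormedSpace ℂ E] [SMul Bᵐᵒᵖ E] [CStarModule Bᵐᵒᵖ E]
    (x y : E) : hinner B x (-y) = -hinner B x y := by
  simp [hinner]

theorem hinner_neg_left {B : Type u} [NonUnitalCStarAlgebra B] [PartialOrder Bᵐᵒᵖ]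
    [StarOrderedRing Bᵐᵒᵖ]
    {E : Type w} [NormedAddCommGroup E] [NormedSpace ℂ E] [SMul Bᵐᵒᵖ E] [CStarModule Bᵐᵒᵖ E]
    (x y : E) : hinner B (-x) y = -hinner B x y := by
  simp [hinner]

noncomputable instance (B : GradedGAlgebra.{u} G) : PartialOrder (C(I, B.carrier))ᵐᵒᵖ :=
  inferInstanceAs (PartialOrder (B.path.carrier)ᵐᵒᵖ)

instance (B : GradedGAlgebra.{u} G) : StarOrderedRing (C(I, B.carrier))ᵐᵒᵖ :=
  inferInstanceAs (StarOrderedRing (B.path.carrier)ᵐᵒᵖ)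

/-- The cycle over `C([0,1], B)` with operator `c(t) T + s(t) J` on the paths in `X.E` (those that
vanish at `1`, if `p` holds). -/
noncomputable def pathCycle (X : KasparovCycle A B) {p : Prop} (D : PathData X p) :
    KasparovCycle A B.path where
  E := Paths X.E p
  smul := inferInstanceAs (SMul C(I, B.carrier)ᵐᵒᵖ (Paths X.E p))
  cstarModule := inferInstanceAs (CStarModule C(I, B.carrier)ᵐᵒᵖ (Paths X.E p))
  countablyGenerated := isCountablyGenerated_Paths (B := B.carrier) p X.countablyGenerated
  gr := pathMap p 1 X.gr
  gr_gr f := Paths_ext fun t => by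
    rw [pathMap_one_apply, pathMap_one_apply, X.gr_gr]
  gr_inner f g := ContinuousMap.ext fun t => by
    change hinner B.carrier ((pathMap p 1 X.gr f).1 t) ((pathMap p 1 X.gr g).1 t) = _
    rw [pathMap_one_apply, pathMap_one_apply, X.gr_inner]
    rfl
  gr_smul f b := Paths_ext fun t => by
    rw [pathMap_one_apply]
    refine (X.gr_smul (f.1 t) (DFunLike.coe (F := C(I, B.carrier)) b t)).trans ?_
    rw [← pathMap_one_apply p X.gr f t]
    rfl
  u :=
    { toFun := fun g => pathMap p 1 (X.u g)
      map_one' := by rw [map_one, pathMap_one]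
      map_mul' := fun g h => by rw [pathMap_mul, map_mul, one_mul] }
  u_inner g f f' := ContinuousMap.ext fun t => by
    change hinner B.carrier ((pathMap p 1 (X.u g) f).1 t) ((pathMap p 1 (X.u g) f').1 t) = _
    rw [pathMap_one_apply, pathMap_one_apply, X.u_inner]
    rfl
  u_smul g f b := Paths_ext fun t => by
    refine (pathMap_one_apply p (X.u g) _ t).trans ?_
    refine (X.u_smul g (f.1 t) (DFunLike.coe (F := C(I, B.carrier)) b t)).trans ?_
    rw [← pathMap_one_apply p (X.u g) f t]
    rfl
  u_gr g f := Paths_ext fun t => by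
    change (pathMap p 1 (X.u g) (pathMap p 1 X.gr f)).1 t
      = (pathMap p 1 X.gr (pathMap p 1 (X.u g) f)).1 t
    simp only [pathMap_one_apply, X.u_gr]
  Φ :=
    { toFun := fun a => pathMap p 1 (X.Φ a)
      map_smul' := fun c a => ContinuousLinearMap.ext fun f => Paths_ext fun t => by
        rw [pathMap_one_apply, map_smul]
        exact congrArg (c • ·) (pathMap_one_apply p (X.Φ a) f t).symm
      map_zero' := ContinuousLinearMap.ext fun f => Paths_ext fun t => by
        rw [pathMap_one_apply, map_zero]
        rfl
      map_add' := fun a b => ContinuousLinearMap.ext fun f => Paths_ext fun t => by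
        rw [pathMap_one_apply, map_add]
        exact congrArg₂ (· + ·) (pathMap_one_apply p (X.Φ a) f t).symm
          (pathMap_one_apply p (X.Φ b) f t).symm
      map_mul' := fun a b => by rw [pathMap_mul, map_mul, one_mul] }
  Φ_adjoint a f g := ContinuousMap.ext fun t => by
    change hinner B.carrier ((pathMap p 1 (X.Φ a) f).1 t) (g.1 t)
      = hinner B.carrier (f.1 t) ((pathMap p 1 (X.Φ (star a)) g).1 t)
    rw [pathMap_one_apply, pathMap_one_apply, X.Φ_adjoint]
  Φ_gr a f := Paths_ext fun t => by
    change (pathMap p 1 X.gr (pathMap p 1 (X.Φ a) f)).1 t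
      = (pathMap p 1 (X.Φ (A.grading a)) (pathMap p 1 X.gr f)).1 t
    simp only [pathMap_one_apply, X.Φ_gr]
  Φ_u g a f := Paths_ext fun t => by
    change (pathMap p 1 (X.u g) (pathMap p 1 (X.Φ a) f)).1 t
      = (pathMap p 1 (X.Φ (A.act g a)) (pathMap p 1 (X.u g) f)).1 t
    simp only [pathMap_one_apply, X.Φ_u]
  T := D.T
  Tadj := D.Tadj
  T_adjoint f g := ContinuousMap.ext fun t => by
    change hinner B.carrier ((D.c t : ℂ) • X.T (f.1 t) + (D.s t : ℂ) • D.J (f.1 t)) (g.1 t)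
      = hinner B.carrier (f.1 t) ((D.c t : ℂ) • X.Tadj (g.1 t) + (D.s t : ℂ) • D.J (g.1 t))
    rw [hinner_add_left, hinner_csmul_left, hinner_csmul_left, hinner_add, hinner_csmul,
      hinner_csmul, X.T_adjoint, D.J_adj]
  T_gr f := Paths_ext fun t => by
    change (pathMap p 1 X.gr (D.T f)).1 t
      = -((D.c t : ℂ) • X.T ((pathMap p 1 X.gr f).1 t)
        + (D.s t : ℂ) • D.J ((pathMap p 1 X.gr f).1 t))
    rw [pathMap_one_apply, pathMap_one_apply, D.T_apply, map_add, map_smul, map_smul, X.T_gr,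
      D.J_gr, smul_neg, smul_neg, neg_add]
  compact_sub_adj a := by
    change (D.T - D.Tadj) * pathMap p 1 (X.Φ a) ∈ compactOps C(I, B.carrier) (Paths X.E p)
    rw [D.sub_adj]
    exact pathMap_mem_compactOps D.c_nonneg D.c_one (X.compact_sub_adj a)
  compact_sq a := by
    change (D.T * D.T - 1) * pathMap p 1 (X.Φ a) ∈ compactOps C(I, B.carrier) (Paths X.E p)
    rw [D.sq_sub_one]
    refine pathMap_mem_compactOps (fun t => mul_self_nonneg (D.c t)) (fun h => ?_) (X.compact_sq a)
    change D.c 1 * D.c 1 = 0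
    rw [D.c_one h, zero_mul]
  compact_equivariance g a := by
    change (pathMap p 1 (X.u g) * D.T * pathMap p 1 (X.u g⁻¹) - D.T) * pathMap p 1 (X.Φ a)
      ∈ compactOps C(I, B.carrier) (Paths X.E p)
    rw [D.equivariance]
    exact pathMap_mem_compactOps D.c_nonneg D.c_one (X.compact_equivariance g a)
  compact_commutator a := by
    change D.T * pathMap p 1 (X.Φ a) - pathMap p 1 (X.Φ (A.grading a)) * D.T
      ∈ compactOps C(I, B.carrier) (Paths X.E p)
    rw [D.commutator]
    exact pathMap_mem_compactOps D.c_nonneg D.c_one (X.compact_commutator a)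

theorem isEvaluation_pathCycle {X Y : KasparovCycle A B} {p : Prop} (D : PathData X p) (t : I)
    (ht : ∃ φ : C(I, ℝ), φ t = 1 ∧ (p → φ 1 = 0)) (e : X.E →ₗ[ℂ] Y.E)
    (he : Function.Surjective e)
    (e_inner : ∀ x y, hinner B.carrier (e x) (e y) = hinner B.carrier x y)
    (e_smul : ∀ (x : X.E) (b : B), e (x <• b) = e x <• b)
    (e_gr : ∀ x, e (X.gr x) = Y.gr (e x))
    (e_u : ∀ g x, e (X.u g x) = Y.u g (e x))
    (e_Φ : ∀ a x, e (X.Φ a x) = Y.Φ a (e x))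
    (e_T : ∀ x, e ((D.c t : ℂ) • X.T x + (D.s t : ℂ) • D.J x) = Y.T (e x)) :
    IsEvaluation t (X.pathCycle D) Y := by
  obtain ⟨φ, hφt, hφ1⟩ := ht
  refine ⟨e ∘ₗ Paths.eval p t, fun y => ?_, fun f g => e_inner _ _, fun f b => e_smul _ _,
    fun f => ?_, fun g f => ?_, fun a f => ?_, fun f => e_T _⟩
  · obtain ⟨x, rfl⟩ := he y
    refine ⟨Paths.mk ⟨fun t => (φ t : ℂ) • x, by fun_prop⟩ fun h => by simp [hφ1 h], ?_⟩
    change e ((φ t : ℂ) • x) = e x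
    simp [hφt]
  · exact (congrArg e (pathMap_one_apply p X.gr f t)).trans (e_gr _)
  · exact (congrArg e (pathMap_one_apply p (X.u g) f t)).trans (e_u _ _)
  · exact (congrArg e (pathMap_one_apply p (X.Φ a) f t)).trans (e_Φ _ _)

/-- The constant deformation. -/
noncomputable def constData (X : KasparovCycle A B) : PathData X False where
  c := 1
  s := 0
  J := 0
  c_nonneg _ := zero_le_one
  c_one h := h.elim
  sq t := by simp
  J_sq t x h := (h rfl).elim
  J_adj x y := by simp [hinner]
  J_gr x := by simp
  J_u g x := by simp
  J_Φ a x := by simp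
  J_T x := by simp

/-- Unitary equivalence of cycles. -/
def IsIso (X Y : KasparovCycle A B) : Prop :=
  ∃ e : X.E →ₗ[ℂ] Y.E, Function.Surjective e ∧
    (∀ x y, hinner B.carrier (e x) (e y) = hinner B.carrier x y) ∧
    (∀ (x : X.E) (b : B), e (x <• b) = e x <• b) ∧
    (∀ x, e (X.gr x) = Y.gr (e x)) ∧
    (∀ g x, e (X.u g x) = Y.u g (e x)) ∧
    (∀ a x, e (X.Φ a x) = Y.Φ a (e x)) ∧
    (∀ x, e (X.T x) = Y.T (e x))

theorem IsIso.homotopic {X Y : KasparovCycle A B} (h : IsIso X Y) : Homotopic X Y := by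
  obtain ⟨e, h1, h2, h3, h4, h5, h6, h7⟩ := h
  refine ⟨X.pathCycle X.constData,
    isEvaluation_pathCycle _ 0 ⟨1, rfl, False.elim⟩ LinearMap.id Function.surjective_id
      (fun _ _ => rfl) (fun _ _ => rfl) (fun _ => rfl) (fun _ _ => rfl) (fun _ _ => rfl)
      fun x => ?_,
    isEvaluation_pathCycle _ 1 ⟨1, rfl, False.elim⟩ e h1 h2 h3 h4 h5 h6 fun x => ?_⟩
  · simp [constData]
  · rw [← h7]; simp [constData]

theorem Homotopic.refl (X : KasparovCycle A B) : Homotopic X X :=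
  IsIso.homotopic ⟨LinearMap.id, Function.surjective_id,
      (fun _ _ => rfl), (fun _ _ => rfl), (fun _ => rfl), (fun _ _ => rfl), (fun _ _ => rfl),
      fun _ => rfl⟩

end KasparovCycle


namespace KasparovCycle

open unitInterval

variable {G : Type v} [Group G] {A : GradedGAlgebra.{w} G} {B : GradedGAlgebra.{u} G}

section SumMap

variable {B : Type u} [NonUnitalCStarAlgebra B] [PartialOrder Bᵐᵒᵖ] [StarOrderedRing Bᵐᵒᵖ]
variable {E : Type w} [NormedAddCommGroup E] [NormedSpace ℂ E] [SMul Bᵐᵒᵖ E] [CStarModule Bᵐᵒᵖ E]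
variable {F : Type w'} [NormedAddCommGroup F] [NormedSpace ℂ F] [SMul Bᵐᵒᵖ F] [CStarModule Bᵐᵒᵖ F]

theorem sumMap_apply (k : E →L[ℂ] E) (l : F →L[ℂ] F) (z : DirSum B E F) :
    sumMap B k l z = DirSum.mk B (k z.1) (l z.2) := rfl

theorem sumMap_mul (k k' : E →L[ℂ] E) (l l' : F →L[ℂ] F) :
    sumMap B k l * sumMap B k' l' = sumMap B (k * k') (l * l') := rfl

theorem sumMap_one : sumMap B (1 : E →L[ℂ] E) (1 : F →L[ℂ] F) = 1 := rfl

theorem sumMap_sub (k k' : E →L[ℂ] E) (l l' : F →L[ℂ] F) :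
    sumMap B k l - sumMap B k' l' = sumMap B (k - k') (l - l') := rfl

end SumMap

/-- The direct sum of two cycles. -/
noncomputable def directSum (X Y : KasparovCycle A B) : KasparovCycle A B where
  E := DirSum B.carrier X.E Y.E
  countablyGenerated := isCountablyGenerated_prod X.countablyGenerated Y.countablyGenerated
  gr := sumMap B.carrier X.gr Y.gr
  gr_gr z := Prod.ext (X.gr_gr z.1) (Y.gr_gr z.2)
  gr_inner z z' := (congrArg₂ (· + ·) (X.gr_inner z.1 z'.1) (Y.gr_inner z.2 z'.2)).trans
    (map_add B.grading _ _).symm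
  gr_smul z b := Prod.ext (X.gr_smul z.1 b) (Y.gr_smul z.2 b)
  u :=
    { toFun := fun g => sumMap B.carrier (X.u g) (Y.u g)
      map_one' := by rw [map_one, map_one, sumMap_one]
      map_mul' := fun g h => by rw [sumMap_mul, map_mul, map_mul] }
  u_inner g z z' := (congrArg₂ (· + ·) (X.u_inner g z.1 z'.1) (Y.u_inner g z.2 z'.2)).trans
    (map_add (B.act g) _ _).symm
  u_smul g z b := Prod.ext (X.u_smul g z.1 b) (Y.u_smul g z.2 b)
  u_gr g z := Prod.ext (X.u_gr g z.1) (Y.u_gr g z.2)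
  Φ :=
    { toFun := fun a => sumMap B.carrier (X.Φ a) (Y.Φ a)
      map_smul' := fun c a => by rw [map_smul, map_smul]; rfl
      map_zero' := by rw [map_zero, map_zero]; rfl
      map_add' := fun a b => by rw [map_add, map_add]; rfl
      map_mul' := fun a b => by rw [map_mul, map_mul]; rfl }
  Φ_adjoint a z z' :=
    congrArg₂ (· + ·) (X.Φ_adjoint a z.1 z'.1) (Y.Φ_adjoint a z.2 z'.2)
  Φ_gr a z := Prod.ext (X.Φ_gr a z.1) (Y.Φ_gr a z.2)
  Φ_u g a z := Prod.ext (X.Φ_u g a z.1) (Y.Φ_u g a z.2)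
  T := sumMap B.carrier X.T Y.T
  Tadj := sumMap B.carrier X.Tadj Y.Tadj
  T_adjoint z z' := congrArg₂ (· + ·) (X.T_adjoint z.1 z'.1) (Y.T_adjoint z.2 z'.2)
  T_gr z := Prod.ext (X.T_gr z.1) (Y.T_gr z.2)
  compact_sub_adj a := sumMap_mem_compactOps (X.compact_sub_adj a) (Y.compact_sub_adj a)
  compact_sq a := sumMap_mem_compactOps (X.compact_sq a) (Y.compact_sq a)
  compact_equivariance g a :=
    sumMap_mem_compactOps (X.compact_equivariance g a) (Y.compact_equivariance g a)
  compact_commutator a :=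
    sumMap_mem_compactOps (X.compact_commutator a) (Y.compact_commutator a)

theorem IsEvaluation.directSum {t : I} {Z W : KasparovCycle A B.path} {X Y : KasparovCycle A B}
    (h : IsEvaluation t Z X) (h' : IsEvaluation t W Y) :
    IsEvaluation t (Z.directSum W) (X.directSum Y) := by
  obtain ⟨e, h1, h2, h3, h4, h5, h6, h7⟩ := h
  obtain ⟨e', h1', h2', h3', h4', h5', h6', h7'⟩ := h'
  let f : (Z.directSum W).E →ₗ[ℂ] (X.directSum Y).E :=
    { toFun := fun z => DirSum.mk B.carrier (e z.1) (e' z.2)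
      map_add' := fun z z' => Prod.ext (map_add e _ _) (map_add e' _ _)
      map_smul' := fun c z => Prod.ext (map_smul e _ _) (map_smul e' _ _) }
  refine ⟨f, fun y => ?_, fun z z' => congrArg₂ (· + ·) (h2 _ _) (h2' _ _),
    fun z b => Prod.ext (h3 _ _) (h3' _ _), fun z => Prod.ext (h4 _) (h4' _),
    fun g z => Prod.ext (h5 _ _) (h5' _ _), fun a z => Prod.ext (h6 _ _) (h6' _ _),
    fun z => Prod.ext (h7 _) (h7' _)⟩
  obtain ⟨x, hx⟩ := h1 y.1
  obtain ⟨x', hx'⟩ := h1' y.2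
  exact ⟨DirSum.mk C(I, B.carrier) x x', Prod.ext hx hx'⟩

theorem Homotopic.directSum {X X' Y Y' : KasparovCycle A B} (h : Homotopic X X')
    (h' : Homotopic Y Y') : Homotopic (X.directSum Y) (X'.directSum Y') := by
  obtain ⟨Z, h0, h1⟩ := h
  obtain ⟨W, h0', h1'⟩ := h'
  exact ⟨Z.directSum W, h0.directSum h0', h1.directSum h1'⟩

theorem isIso_directSum_comm (X Y : KasparovCycle A B) :
    IsIso (X.directSum Y) (Y.directSum X) :=
  ⟨{ toFun := fun z => DirSum.mk B.carrier z.2 z.1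
     map_add' := fun _ _ => rfl
     map_smul' := fun _ _ => rfl },
    fun y => ⟨DirSum.mk B.carrier y.2 y.1, rfl⟩, fun _ _ => add_comm _ _, fun _ _ => rfl,
    fun _ => rfl, fun _ _ => rfl, fun _ _ => rfl, fun _ => rfl⟩

theorem isIso_directSum_assoc (X Y Z : KasparovCycle A B) :
    IsIso ((X.directSum Y).directSum Z) (X.directSum (Y.directSum Z)) :=
  ⟨{ toFun := fun z => DirSum.mk B.carrier z.1.1 (DirSum.mk B.carrier z.1.2 z.2)
     map_add' := fun _ _ => rfl
     map_smul' := fun _ _ => rfl },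
    fun y => ⟨DirSum.mk B.carrier (DirSum.mk B.carrier y.1 y.2.1) y.2.2, rfl⟩,
    fun _ _ => (add_assoc _ _ _).symm, fun _ _ => rfl,
    fun _ => rfl, fun _ _ => rfl, fun _ _ => rfl, fun _ => rfl⟩

instance punitSMul (B : GradedGAlgebra.{u} G) : SMul (B.carrier)ᵐᵒᵖ PUnit.{u + 1} :=
  ⟨fun _ _ => PUnit.unit⟩

noncomputable instance punitCStarModule (B : GradedGAlgebra.{u} G) :
    CStarModule (B.carrier)ᵐᵒᵖ PUnit.{u + 1} where
  inner _ _ := 0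
  inner_add_right := (add_zero 0).symm
  inner_self_nonneg := le_rfl
  inner_self := ⟨fun _ => rfl, fun _ => rfl⟩
  inner_op_smul_right := (mul_zero _).symm
  inner_smul_right_complex := (smul_zero _).symm
  star_inner _ _ := star_zero _
  norm_eq_sqrt_norm_inner_self x := by
    rw [norm_zero (E := (B.carrier)ᵐᵒᵖ), Real.sqrt_zero]
    exact norm_zero

theorem mem_compactOps_punit {B : GradedGAlgebra.{u} G}
    (k : PUnit.{u + 1} →L[ℂ] PUnit.{u + 1}) : k ∈ compactOps B.carrier PUnit.{u + 1} := by
  have : k = 0 := ContinuousLinearMap.ext fun _ => rfl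
  rw [this]
  exact zero_mem _

variable (A B) in
noncomputable def zeroCycle : KasparovCycle A B where
  E := PUnit.{u + 1}
  countablyGenerated := ⟨∅, Set.countable_empty, fun x => subset_closure (by
    rw [Subsingleton.elim x 0]; exact zero_mem _)⟩
  gr := 0
  gr_gr _ := rfl
  gr_inner _ _ := (map_zero B.grading).symm
  gr_smul _ _ := rfl
  u := 1
  u_inner g _ _ := (map_zero (B.act g)).symm
  u_smul _ _ _ := rfl
  u_gr _ _ := rfl
  Φ := 0
  Φ_adjoint _ _ _ := rfl
  Φ_gr _ _ := rfl
  Φ_u _ _ _ := rfl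
  T := 0
  Tadj := 0
  T_adjoint _ _ := rfl
  T_gr _ := rfl
  compact_sub_adj _ := mem_compactOps_punit _
  compact_sq _ := mem_compactOps_punit _
  compact_equivariance _ _ := mem_compactOps_punit _
  compact_commutator _ := mem_compactOps_punit _

theorem isIso_zero_directSum (X : KasparovCycle A B) : IsIso ((zeroCycle A B).directSum X) X :=
  ⟨{ toFun := fun z => z.2
     map_add' := fun _ _ => rfl
     map_smul' := fun _ _ => rfl },
    fun y => ⟨DirSum.mk B.carrier PUnit.unit y, rfl⟩, fun _ _ => (zero_add _).symm, fun _ _ => rfl,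
    fun _ => rfl, fun _ _ => rfl, fun _ _ => rfl, fun _ => rfl⟩

/-- The cycle `(E^op, u, Φ ∘ ε, -T)`, where `E^op` is `E` with the opposite grading and `ε` is the
grading of `A`; it represents the negative of the class of `X`. -/
noncomputable def op (X : KasparovCycle A B) : KasparovCycle A B where
  E := X.E
  countablyGenerated := X.countablyGenerated
  gr := -X.gr
  gr_gr x := by simp [X.gr_gr]
  gr_inner x y := by
    change hinner B.carrier (-X.gr x) (-X.gr y) = _
    rw [hinner_neg, hinner_neg_left, neg_neg, X.gr_inner]
  gr_smul x b := by
    refine hinner_ext (B := B.carrier) fun z => ?_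
    change hinner B.carrier z (-X.gr (x <• b)) = hinner B.carrier z ((-X.gr x) <• B.grading b)
    rw [hinner_neg, X.gr_smul, hinner_smul, hinner_smul, hinner_neg, neg_mul]
  u := X.u
  u_inner := X.u_inner
  u_smul := X.u_smul
  u_gr g x := by
    change X.u g (-X.gr x) = -X.gr (X.u g x)
    rw [map_neg, X.u_gr]
  Φ := X.Φ.comp (A.grading : A →ₙₐ[ℂ] A)
  Φ_adjoint a x y := by
    change hinner B.carrier (X.Φ (A.grading a) x) y = hinner B.carrier x (X.Φ (A.grading (star a)) y)
    rw [X.Φ_adjoint, map_star A.grading]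
  Φ_gr a x := by
    change -X.gr (X.Φ (A.grading a) x) = X.Φ (A.grading (A.grading a)) (-X.gr x)
    rw [X.Φ_gr, map_neg]
  Φ_u g a x := by
    change X.u g (X.Φ (A.grading a) x) = X.Φ (A.grading (A.act g a)) (X.u g x)
    rw [X.Φ_u, A.grading_act]
  T := -X.T
  Tadj := -X.Tadj
  T_adjoint x y := by
    change hinner B.carrier (-X.T x) y = hinner B.carrier x (-X.Tadj y)
    rw [hinner_neg, hinner_neg_left, X.T_adjoint]
  T_gr x := by
    change -X.gr (-X.T x) = -(-X.T (-X.gr x))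
    rw [map_neg, map_neg, X.T_gr]
  compact_sub_adj a := by
    convert neg_mem (X.compact_sub_adj (A.grading a)) using 1
    change (-X.T - -X.Tadj) * X.Φ (A.grading a) = _
    noncomm_ring
  compact_sq a := by
    convert X.compact_sq (A.grading a) using 1
    change (-X.T * -X.T - 1) * X.Φ (A.grading a) = _
    noncomm_ring
  compact_equivariance g a := by
    convert neg_mem (X.compact_equivariance g (A.grading a)) using 1
    change (X.u g * -X.T * X.u g⁻¹ - -X.T) * X.Φ (A.grading a) = _
    noncomm_ring
  compact_commutator a := by
    convert neg_mem (X.compact_commutator (A.grading a)) using 1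
    change -X.T * X.Φ (A.grading a) - X.Φ (A.grading (A.grading a)) * -X.T = _
    noncomm_ring

theorem IsEvaluation.op {t : I} {Z : KasparovCycle A B.path} {X : KasparovCycle A B}
    (h : IsEvaluation t Z X) : IsEvaluation t Z.op X.op := by
  obtain ⟨e, h1, h2, h3, h4, h5, h6, h7⟩ := h
  refine ⟨e, h1, h2, h3, fun x => ?_, h5, fun a x => h6 _ _, fun x => ?_⟩
  · exact (map_neg e _).trans (congrArg _ (h4 x))
  · exact (map_neg e _).trans (congrArg _ (h7 x))

theorem Homotopic.op {X Y : KasparovCycle A B} (h : Homotopic X Y) : Homotopic X.op Y.op := by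
  obtain ⟨Z, h0, h1⟩ := h
  exact ⟨Z.op, h0.op, h1.op⟩

/-- The rotation that deforms `X^op ⊕ X` to the zero cycle. -/
noncomputable def rotationData (X : KasparovCycle A B) : PathData (X.op.directSum X) True where
  c := ⟨fun t => Real.cos (Real.pi / 2 * t), by fun_prop⟩
  s := ⟨fun t => Real.sin (Real.pi / 2 * t), by fun_prop⟩
  J := LinearMap.mkContinuous
    { toFun := fun z => DirSum.mk B.carrier z.2 z.1
      map_add' := fun _ _ => rfl
      map_smul' := fun _ _ => rfl } 2 fun z => by
    have h := WithCStarModule.max_le_prod_norm (A := (B.carrier)ᵐᵒᵖ) (E := X.E) (F := X.E) z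
    refine (DirSum.norm_mk_le (B := B.carrier) (E := X.E) (F := X.E) z.2 z.1).trans ?_
    rw [two_mul]
    exact add_le_add ((le_max_right _ _).trans h) ((le_max_left _ _).trans h)
  c_nonneg t := by
    have h0 : (0 : ℝ) ≤ t := t.2.1
    have h1 : (t : ℝ) ≤ 1 := t.2.2
    exact Real.cos_nonneg_of_mem_Icc ⟨by nlinarith [Real.pi_pos], by nlinarith [Real.pi_pos]⟩
  c_one _ := by simp
  sq t := by
    have := Real.cos_sq_add_sin_sq (Real.pi / 2 * t)
    rw [sq, sq] at this
    exact this
  J_sq _ _ _ := rfl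
  J_adj _ _ := add_comm _ _
  J_gr z := Prod.ext rfl (neg_neg _).symm
  J_u _ _ := rfl
  J_Φ a z := Prod.ext (congrArg (fun b => X.Φ b z.2) (A.grading_grading a).symm) rfl
  J_T z := Prod.ext (add_neg_cancel _) (neg_add_cancel _)

theorem homotopic_op_directSum (X : KasparovCycle A B) :
    Homotopic (X.op.directSum X) (zeroCycle A B) := by
  refine ⟨pathCycle _ X.rotationData,
    isEvaluation_pathCycle _ 0 ⟨⟨fun t => 1 - (t : ℝ), by fun_prop⟩, by simp, by simp⟩
      LinearMap.id Function.surjective_id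
      (fun _ _ => rfl) (fun _ _ => rfl) (fun _ => rfl) (fun _ _ => rfl) (fun _ _ => rfl)
      fun x => ?_,
    0, fun _ => ⟨0, rfl⟩, fun f g => ?_, fun _ _ => rfl, fun _ => rfl, fun _ _ => rfl,
      fun _ _ => rfl, fun _ => rfl⟩
  · simp [rotationData]
  · have hf : f.1 1 = 0 := f.2 trivial
    change 0 = hinner B.carrier (f.1 1) (g.1 1)
    rw [hf, hzero_hinner]

end KasparovCycle

/-- The group `KK^G(A, B)`: homotopy classes of Kasparov cycles, added by direct sum (see the
`AddCommGroup` instance). -/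
def KK {G : Type v} [Group G] (A : GradedGAlgebra.{w} G) (B : GradedGAlgebra.{u} G) :
    Type (max (u + 1) v w) :=
  Quot (KasparovCycle.Homotopic (A := A) (B := B))

namespace KK

variable {G : Type v} [Group G] {A : GradedGAlgebra.{w} G} {B : GradedGAlgebra.{u} G}

/-- The class of a cycle. -/
def mk (X : KasparovCycle A B) : KK A B := Quot.mk _ X

theorem mk_eq {X Y : KasparovCycle A B} (h : X.Homotopic Y) : mk X = mk Y := Quot.sound h

noncomputable instance : Zero (KK A B) := ⟨mk (KasparovCycle.zeroCycle A B)⟩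

noncomputable instance : Add (KK A B) :=
  ⟨Quot.map₂ KasparovCycle.directSum
    (fun X _ _ h => (KasparovCycle.Homotopic.refl X).directSum h)
    (fun _ _ Y h => h.directSum (KasparovCycle.Homotopic.refl Y))⟩

noncomputable instance : Neg (KK A B) :=
  ⟨Quot.map KasparovCycle.op fun _ _ h => h.op⟩

protected theorem zero_add' (x : KK A B) : 0 + x = x := by
  induction x using Quot.ind with
  | mk X => exact mk_eq (KasparovCycle.isIso_zero_directSum X).homotopic

protected theorem add_comm' (x y : KK A B) : x + y = y + x :=
  Quot.induction_on₂ x y fun X Y => mk_eq (KasparovCycle.isIso_directSum_comm X Y).homotopic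

noncomputable instance : AddCommGroup (KK A B) where
  add_assoc x y z := Quot.induction_on₃ x y z fun X Y Z =>
    mk_eq (KasparovCycle.isIso_directSum_assoc X Y Z).homotopic
  zero_add := KK.zero_add'
  add_zero x := (KK.add_comm' x 0).trans (KK.zero_add' x)
  add_comm := KK.add_comm'
  neg_add_cancel x := by
    induction x using Quot.ind with
    | mk X => exact mk_eq (KasparovCycle.homotopic_op_directSum X)
  nsmul := nsmulRec
  zsmul := zsmulRec

end KK


namespace KasparovCycle

variable {G : Type v} [Group G] {A : GradedGAlgebra.{w} G} {B : GradedGAlgebra.{u} G}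

/-- Restriction of a cycle to a subgroup: all actions are restricted. -/
def res (K : Subgroup G) (X : KasparovCycle A B) : KasparovCycle (A.res K) (B.res K) where
  E := X.E
  smul := X.smul
  cstarModule := X.cstarModule
  countablyGenerated := X.countablyGenerated
  gr := X.gr
  gr_gr := X.gr_gr
  gr_inner := X.gr_inner
  gr_smul := X.gr_smul
  u := X.u.comp K.subtype
  u_inner k := X.u_inner k
  u_smul k := X.u_smul k
  u_gr k := X.u_gr k
  Φ := X.Φ
  Φ_adjoint := X.Φ_adjoint
  Φ_gr := X.Φ_gr
  Φ_u k := X.Φ_u k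
  T := X.T
  Tadj := X.Tadj
  T_adjoint := X.T_adjoint
  T_gr := X.T_gr
  compact_sub_adj := X.compact_sub_adj
  compact_sq := X.compact_sq
  compact_equivariance k := X.compact_equivariance k
  compact_commutator := X.compact_commutator

/-- Pulling a cycle back along an equivariant graded *-homomorphism: `Φ` is replaced by `Φ ∘ φ`. -/
def pullback {A' : GradedGAlgebra.{w'} G} (φ : GradedGAlgebra.Hom A A') (X : KasparovCycle A' B) :
    KasparovCycle A B where
  E := X.E
  countablyGenerated := X.countablyGenerated
  gr := X.gr
  gr_gr := X.gr_gr
  gr_inner := X.gr_inner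
  gr_smul := X.gr_smul
  u := X.u
  u_inner := X.u_inner
  u_smul := X.u_smul
  u_gr := X.u_gr
  Φ := X.Φ.comp (φ.toHom : A →ₙₐ[ℂ] A')
  Φ_adjoint a x y := (X.Φ_adjoint (φ.toHom a) x y).trans
    (congrArg (fun b => hinner B.carrier x (X.Φ b y)) (map_star φ.toHom a).symm)
  Φ_gr a x := (X.Φ_gr (φ.toHom a) x).trans
    (congrArg (fun b => X.Φ b (X.gr x)) (φ.map_grading a).symm)
  Φ_u g a x := (X.Φ_u g (φ.toHom a) x).trans
    (congrArg (fun b => X.Φ b (X.u g x)) (φ.map_act g a).symm)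
  T := X.T
  Tadj := X.Tadj
  T_adjoint := X.T_adjoint
  T_gr := X.T_gr
  compact_sub_adj a := X.compact_sub_adj (φ.toHom a)
  compact_sq a := X.compact_sq (φ.toHom a)
  compact_equivariance g a := X.compact_equivariance g (φ.toHom a)
  compact_commutator a := by
    change X.T * X.Φ (φ.toHom a) - X.Φ (φ.toHom (A.grading a)) * X.T ∈ compactOps B.carrier X.E
    rw [φ.map_grading]
    exact X.compact_commutator (φ.toHom a)

theorem Homotopic.res (K : Subgroup G) {X Y : KasparovCycle A B} (h : Homotopic X Y) :
    Homotopic (X.res K) (Y.res K) := by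
  obtain ⟨Z, ⟨e, h1, h2, h3, h4, h5, h6, h7⟩, ⟨f, k1, k2, k3, k4, k5, k6, k7⟩⟩ := h
  exact ⟨Z.res K, ⟨e, h1, h2, h3, h4, fun k => h5 k, h6, h7⟩,
    ⟨f, k1, k2, k3, k4, fun k => k5 k, k6, k7⟩⟩

theorem Homotopic.pullback {A' : GradedGAlgebra.{w'} G} (φ : GradedGAlgebra.Hom A A')
    {X Y : KasparovCycle A' B} (h : Homotopic X Y) :
    Homotopic (X.pullback φ) (Y.pullback φ) := by
  obtain ⟨Z, ⟨e, h1, h2, h3, h4, h5, h6, h7⟩, ⟨f, k1, k2, k3, k4, k5, k6, k7⟩⟩ := h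
  exact ⟨Z.pullback φ, ⟨e, h1, h2, h3, h4, h5, fun a => h6 _, h7⟩,
    ⟨f, k1, k2, k3, k4, k5, fun a => k6 _, k7⟩⟩

end KasparovCycle

namespace KK

variable {G : Type v} [Group G] {A : GradedGAlgebra.{w} G} {B : GradedGAlgebra.{u} G}

/-- The restriction homomorphism `KK^G(A, B) → KK^K(A, B)`. -/
noncomputable def res (K : Subgroup G) : KK A B →+ KK (A.res K) (B.res K) where
  toFun := Quot.map (KasparovCycle.res K) fun _ _ h => h.res K
  map_zero' := rfl
  map_add' x y := Quot.induction_on₂ x y fun _ _ => rfl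

/-- The homomorphism `φ^* : KK^G(A', B) → KK^G(A, B)`. -/
noncomputable def pullback {A' : GradedGAlgebra.{w'} G} (φ : GradedGAlgebra.Hom A A') :
    KK A' B →+ KK A B where
  toFun := Quot.map (KasparovCycle.pullback φ) fun _ _ h => h.pullback φ
  map_zero' := rfl
  map_add' x y := Quot.induction_on₂ x y fun _ _ => rfl

variable [TopologicalSpace G] [DiscreteTopology G]

/-- The compression map: the composition of the restriction
`KK^G(C₀(G/K), B) → KK^K(C₀(G/K), B)` with `ι^*`, for `ι : ℂ → C₀(G/K)`, `λ ↦ λ δ_{eK}`. -/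
noncomputable def comp (K : Subgroup G) (B : GradedGAlgebra.{u} G) :
    KK (GradedGAlgebra.cosets K) B →+ KK (GradedGAlgebra.complex K) (B.res K) :=
  (pullback (GradedGAlgebra.pointInclusion K)).comp (res K)

end KK

/-- `B ⊗̂ Clₙ = (⋯(B ⊗̂ Cl₁) ⊗̂ ⋯) ⊗̂ Cl₁`, with `n` factors `Cl₁`.
The group `KK A (B.cliffordPow n)` is `KKₙ^G(A, B)`, and `B.cliffordPow 0 = B`. -/
noncomputable def GradedGAlgebra.cliffordPow {G : Type v} [Group G] (B : GradedGAlgebra.{u} G) :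
    ℕ → GradedGAlgebra.{u} G
  | 0 => B
  | n + 1 => (B.cliffordPow n).clifford

theorem GradedGAlgebra.cliffordPow_res {G : Type v} [Group G] (B : GradedGAlgebra.{u} G)
    (K : Subgroup G) (n : ℕ) : (B.cliffordPow n).res K = (B.res K).cliffordPow n := by
  induction n with
  | zero => rfl
  | succ n ih => exact congrArg clifford ih


/-- `Y` is (unitarily equivalent to) the cycle induced from `X = (E, Φ, γ, T)`: its module consists
of the `ξ : G → E` with `ξ(gk) = γ_{k⁻¹}(ξ(g))` for which `∑_g β_g(⟨ξ(g), ξ(g)⟩)` converges in norm,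
with `⟨ξ, η⟩ = |K|⁻¹ ∑_g β_g(⟨ξ(g), η(g)⟩)`, `(ξ b)(g) = ξ(g) β_{g⁻¹}(b)`, pointwise grading,
`f ∈ C₀(G/K)` acting by `(f ξ)(g) = f(gK) ξ(g)`, `h ∈ G` by `(h ξ)(g) = ξ(h⁻¹ g)`, and the operator
`(T̃ ξ)(g) = T(ξ(g))`. -/
def IsInduced {G : Type v} [Group G] [TopologicalSpace G] [DiscreteTopology G]
    {K : Subgroup G} {B : GradedGAlgebra.{u} G}
    (X : KasparovCycle (GradedGAlgebra.complex K) (B.res K))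
    (Y : KasparovCycle (GradedGAlgebra.cosets K) B) : Prop :=
  ∃ ι : Y.E →ₗ[ℂ] (G → X.E), Function.Injective ι ∧
    Set.range ι = {ξ | (∀ (g : G) (k : K), ξ (g * k) = X.u k⁻¹ (ξ g)) ∧
      Summable fun g => B.act g (hinner (B.res K).carrier (ξ g) (ξ g))} ∧
    (∀ ξ η, HasSum (fun g => (Nat.card K : ℂ)⁻¹ • B.act g (hinner (B.res K).carrier (ι ξ g) (ι η g)))
      (hinner B.carrier ξ η)) ∧
    (∀ (ξ : Y.E) (b : B) (g : G), ι (ξ <• b) g = ι ξ g <• (show (B.res K).carrier from B.act g⁻¹ b)) ∧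
    (∀ ξ g, ι (Y.gr ξ) g = X.gr (ι ξ g)) ∧
    (∀ (f : C₀(G ⧸ K, ℂ)) ξ (g : G), ι (Y.Φ f ξ) g = f (QuotientGroup.mk g) • ι ξ g) ∧
    (∀ h ξ g, ι (Y.u h ξ) g = ι ξ (h⁻¹ * g)) ∧
    (∀ ξ g, ι (Y.T ξ) g = X.T (ι ξ g))

/-- The cycle is `(E, 1, γ, T)`, with `ℂ` acting by scalars and `T` invariant under the group. -/
def KasparovCycle.IsNormalized {K : Type v} [Group K] {B : GradedGAlgebra.{u} K}
    (X : KasparovCycle (GradedGAlgebra.complex K) B) : Prop :=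
  (∀ x, X.Φ (1 : ℂ) x = x) ∧ ∀ k x, X.T (X.u k x) = X.u k (X.T x)

/-!
The inverse of the compression map is induction, and both composites are identified with the
identity by one kind of homotopy.

*The homotopy.* Let `Y` be a cycle over an algebra `A` that contains pairwise orthogonal central
projections `d j` with dense span (`ProjectionFamily`; here `A` is `ℂ` or `C₀(G/K)`). Its essential
submodule consists of the `e` with `e = ∑ⱼ Φ(d j) e`. This submodule need not be complemented, so
`Y` cannot be split as a direct sum. Instead, the paths in `Y` that end in the essential submodule
form a Hilbert `B[0,1]`-module, the mapping cylinder. Suppose that `T₀` is an operator on the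
essential submodule that commutes with the algebra and the group and that differs from `T` on each
`d j` by a compact operator. With weights `c` in the span of the `d j` that increase to the unit as
`t → 1`, the operators `(1 - Φ(c)) T (1 - Φ(c)) + T₀ Φ(2c - c²)` (`interp`) join `T` to `T₀`. Near
`t = 1` they equal `T₀` on each fixed `d j`, so the compactness conditions of a cycle over `B[0,1]`
reduce to continuous paths of compact operators that are eventually constant, and these are
approximated by Bernstein polynomials (`cylinder.mem_compactOps`). The result is
`homotopic_of_essential`: `Y` is homotopic to any cycle that is unitarily equivalent to its
essential submodule with such an operator.

*Normalization.* For a cycle over `ℂ` the essential submodule is the range of the projection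
`Φ(1)`. Averaging the compressed operator over the finite group `K` makes it commute with `K`. So
every class over `ℂ` is represented by a normalized cycle (`homotopic_normalize`).

*Induction.* For a normalized cycle `X`, the square-summable `K`-equivariant functions `G → X` are
a Hilbert module. An operator that acts pointwise, multiplied by the characteristic function of a
point `gK`, is determined by its value at `g`, and it is compact if that value is. Hence the cycle
conditions for `X` give those for `X.induced` (`mul_multiplication_mem_compactOps`). The induction
of a homotopy evaluates to the induction of its ends: pointwise evaluation is onto because a
function with finite support lifts and preimages can be chosen with control of the norm
(`IsEvaluation.induced`). So induction is defined on homotopy classes (`KK.ind`).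

*The composites.* The fibre of the induced module at the base point is `X`, by evaluation at `1`
and rescaling (`homotopic_compression_induced`). Conversely, the essential submodule of a cycle `Y`
over `C₀(G/K)` is unitarily equivalent to the module induced from its fibre: the element `e`
corresponds to the function `g ↦ |K|^(-1/2) Φ(δ_{eK}) u(g⁻¹) e`. The operators agree modulo compact
operators at the base point by construction, and then at every point `gK` since `T` is equivariant
modulo compact operators (`homotopic_induced_fibre`). Finally, an induced cycle is determined up to
unitary equivalence (`IsInduced.isIso`), so the formula for the inverse holds for each of them.
-/

/-! ### Adjointable operators of Hilbert modules -/

section Adjointable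

variable {B : Type u} [NonUnitalCStarAlgebra B] [PartialOrder Bᵐᵒᵖ] [StarOrderedRing Bᵐᵒᵖ]
variable {E : Type w} [NormedAddCommGroup E] [NormedSpace ℂ E] [SMul Bᵐᵒᵖ E] [CStarModule Bᵐᵒᵖ E]

/-- `S'` is an adjoint of the operator `S` of the Hilbert `B`-module `E`. -/
def HasAdjoint (B : Type u) [NonUnitalCStarAlgebra B] [PartialOrder Bᵐᵒᵖ]
    {E : Type w} [NormedAddCommGroup E] [NormedSpace ℂ E] [SMul Bᵐᵒᵖ E] [CStarModule Bᵐᵒᵖ E]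
    (S S' : E →L[ℂ] E) : Prop :=
  ∀ x y, hinner B (S x) y = hinner B x (S' y)

theorem hinner_csmul_left' (x y : E) (c : ℂ) : hinner B (c • x) y = star c • hinner B x y := by
  rw [← star_hinner, hinner_csmul, star_smul, star_hinner]

theorem hinner_sub_left (x y z : E) : hinner B (x - y) z = hinner B x z - hinner B y z := by
  rw [← star_hinner, hinner_sub, star_sub, star_hinner, star_hinner]

theorem hinner_smul_left (x y : E) (b : B) : hinner B (x <• b) y = star b * hinner B x y := by
  rw [← star_hinner, hinner_smul, star_mul, star_hinner]

theorem norm_hinner_self (x : E) : ‖hinner B x x‖ = ‖x‖ ^ 2 := by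
  rw [hinner, norm_unop, ← CStarModule.norm_sq_eq Bᵐᵒᵖ]

namespace HasAdjoint

variable {S S' R R' : E →L[ℂ] E}

theorem symm (h : HasAdjoint B S S') : HasAdjoint B S' S := fun x y => by
  rw [← star_hinner, ← h y x, star_hinner]

theorem add (h : HasAdjoint B S S') (k : HasAdjoint B R R') :
    HasAdjoint B (S + R) (S' + R') := fun x y => by
  change hinner B (S x + R x) y = hinner B x (S' y + R' y)
  rw [hinner_add_left, hinner_add, h, k]

theorem sub (h : HasAdjoint B S S') (k : HasAdjoint B R R') :
    HasAdjoint B (S - R) (S' - R') := fun x y => by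
  change hinner B (S x - R x) y = hinner B x (S' y - R' y)
  rw [hinner_sub_left, hinner_sub, h, k]

theorem mul (h : HasAdjoint B S S') (k : HasAdjoint B R R') :
    HasAdjoint B (S * R) (R' * S') := fun x y => by
  change hinner B (S (R x)) y = hinner B x (R' (S' y))
  rw [h, k]

theorem smul (h : HasAdjoint B S S') (c : ℂ) : HasAdjoint B (c • S) (star c • S') := fun x y => by
  change hinner B (c • S x) y = hinner B x (star c • S' y)
  rw [hinner_csmul_left', hinner_csmul, h]

theorem one : HasAdjoint B (1 : E →L[ℂ] E) 1 := fun _ _ => rfl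

theorem zero : HasAdjoint B (0 : E →L[ℂ] E) 0 := fun x y => by
  simp [hinner]

theorem sum {ι : Type*} (F : Finset ι) {S S' : ι → E →L[ℂ] E}
    (h : ∀ i ∈ F, HasAdjoint B (S i) (S' i)) : HasAdjoint B (∑ i ∈ F, S i) (∑ i ∈ F, S' i) := by
  classical
  induction F using Finset.induction_on with
  | empty => exact zero
  | insert i F hi ih =>
    rw [Finset.sum_insert hi, Finset.sum_insert hi]
    exact (h i (Finset.mem_insert_self i F)).add (ih fun j hj => h j (Finset.mem_insert_of_mem hj))

theorem rankOne (x y : E) : HasAdjoint B (rankOne B x y) (rankOne B y x) := fun z z' => by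
  rw [rankOne_apply, rankOne_apply, hinner_smul_left, hinner_smul, star_hinner]

theorem unique (h : HasAdjoint B S S') (k : HasAdjoint B S R') : S' = R' :=
  ContinuousLinearMap.ext fun y => hinner_ext (B := B) fun z => by rw [← h, ← k]

theorem map_hsmul (h : HasAdjoint B S S') (x : E) (b : B) : S (x <• b) = S x <• b :=
  hinner_ext (B := B) fun z => by rw [← h.symm, hinner_smul, hinner_smul, ← h.symm]

theorem sq_norm_le (h : HasAdjoint B S S') : ‖S‖ ^ 2 ≤ ‖S' * S‖ := by
  have : ‖S‖ ≤ Real.sqrt ‖S' * S‖ := by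
    refine S.opNorm_le_bound (Real.sqrt_nonneg _) fun x => ?_
    refine abs_le_of_sq_le_sq' ?_ (by positivity) |>.2
    rw [mul_pow, Real.sq_sqrt (norm_nonneg _), ← norm_hinner_self (B := B), h]
    calc _ ≤ ‖x‖ * ‖(S' * S) x‖ := hinner_norm_le _ _
      _ ≤ ‖x‖ * (‖S' * S‖ * ‖x‖) := by gcongr; exact (S' * S).le_opNorm x
      _ = _ := by ring
  calc _ ≤ Real.sqrt ‖S' * S‖ ^ 2 := by gcongr
    _ = _ := Real.sq_sqrt (norm_nonneg _)

theorem norm_le (h : HasAdjoint B S S') : ‖S‖ ≤ ‖S'‖ := by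
  have h1 := h.sq_norm_le.trans (norm_mul_le _ _)
  rcases (norm_nonneg S).eq_or_lt with h0 | h0
  · rw [← h0]; exact norm_nonneg _
  · rw [sq] at h1
    exact le_of_mul_le_mul_right h1 h0

theorem norm_eq (h : HasAdjoint B S S') : ‖S‖ = ‖S'‖ := le_antisymm h.norm_le h.symm.norm_le

end HasAdjoint

/-- The adjointable operators of a Hilbert `B`-module. -/
def adjointable (B : Type u) [NonUnitalCStarAlgebra B] [PartialOrder Bᵐᵒᵖ] [StarOrderedRing Bᵐᵒᵖ]
    (E : Type w) [NormedAddCommGroup E] [NormedSpace ℂ E] [SMul Bᵐᵒᵖ E] [CStarModule Bᵐᵒᵖ E] :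
    Subalgebra ℂ (E →L[ℂ] E) where
  carrier := {S | ∃ S', HasAdjoint B S S'}
  mul_mem' := fun ⟨_, h⟩ ⟨_, k⟩ => ⟨_, h.mul k⟩
  add_mem' := fun ⟨_, h⟩ ⟨_, k⟩ => ⟨_, h.add k⟩
  algebraMap_mem' c := ⟨star c • 1, by
    rw [Algebra.algebraMap_eq_smul_one]; exact HasAdjoint.one.smul c⟩

theorem isClosed_adjointable [CompleteSpace E] :
    IsClosed (adjointable B E : Set (E →L[ℂ] E)) := by
  refine isClosed_of_closure_subset fun S hS => ?_
  obtain ⟨s, hs, hlim⟩ := mem_closure_iff_seq_limit.1 hS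
  choose s' hs' using hs
  have hc : CauchySeq s' := by
    refine Metric.cauchySeq_iff.2 fun ε hε => ?_
    obtain ⟨N, hN⟩ := Metric.cauchySeq_iff.1 hlim.cauchySeq ε hε
    refine ⟨N, fun m hm n hn => ?_⟩
    rw [dist_eq_norm, ← ((hs' m).sub (hs' n)).norm_eq, ← dist_eq_norm]
    exact hN m hm n hn
  obtain ⟨S', hS'⟩ := cauchySeq_tendsto_of_complete hc
  refine ⟨S', fun x y => ?_⟩
  have h1 : Filter.Tendsto (fun n => hinner B (s n x) y) Filter.atTop (nhds (hinner B (S x) y)) :=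
    ((continuous_hinner (B := B)).tendsto (S x, y)).comp
      ((((ContinuousLinearMap.apply ℂ E x).continuous.tendsto S).comp hlim).prodMk_nhds
        tendsto_const_nhds)
  have h2 : Filter.Tendsto (fun n => hinner B x (s' n y)) Filter.atTop
      (nhds (hinner B x (S' y))) :=
    ((continuous_hinner (B := B)).tendsto (x, S' y)).comp
      (tendsto_const_nhds.prodMk_nhds
        (((ContinuousLinearMap.apply ℂ E y).continuous.tendsto S').comp hS'))
  refine tendsto_nhds_unique h1 (h2.congr fun n => ((hs' n) x y).symm)

theorem hasAdjoint_choose (S : adjointable B E) : HasAdjoint B S.1 S.2.choose := S.2.choose_spec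

noncomputable instance : StarRing (adjointable B E) where
  star S := ⟨S.2.choose, S.1, (hasAdjoint_choose S).symm⟩
  star_involutive S := Subtype.ext
    ((hasAdjoint_choose (B := B) ⟨S.2.choose, S.1, (hasAdjoint_choose S).symm⟩).unique
      (hasAdjoint_choose S).symm)
  star_mul S R := Subtype.ext
    ((hasAdjoint_choose (S * R)).unique ((hasAdjoint_choose S).mul (hasAdjoint_choose R)))
  star_add S R := Subtype.ext
    ((hasAdjoint_choose (S + R)).unique ((hasAdjoint_choose S).add (hasAdjoint_choose R)))

theorem hasAdjoint_star (S : adjointable B E) : HasAdjoint B S.1 (star S).1 := hasAdjoint_choose S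

theorem star_eq_of_hasAdjoint {S S' : adjointable B E} (h : HasAdjoint B S.1 S'.1) :
    star S = S' := Subtype.ext ((hasAdjoint_star S).unique h)

/-- The adjointable operators of a Hilbert module form a C*-algebra. -/
noncomputable instance [CompleteSpace E] : CStarAlgebra (adjointable B E) where
  complete := (isClosed_adjointable (B := B) (E := E)).completeSpace_coe.complete
  norm_mul_self_le S := by
    rw [← sq]
    exact (hasAdjoint_star S).sq_norm_le
  star_smul c S := star_eq_of_hasAdjoint ((hasAdjoint_star S).smul c)

/-- `⟨Sx, Sx⟩ ≤ ‖S‖² ⟨x, x⟩` for an adjointable operator `S`, because `‖S‖² - S*S` is a square in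
the C*-algebra of adjointable operators. -/
theorem HasAdjoint.inner_self_le [CompleteSpace E] {S S' : E →L[ℂ] E} (h : HasAdjoint B S S') :
    ∀ x, inner Bᵐᵒᵖ (S x) (S x) ≤ ((‖S‖ ^ 2 : ℝ) : ℂ) • inner Bᵐᵒᵖ x x := by
  intro x
  let _ : PartialOrder (adjointable B E) := CStarAlgebra.spectralOrder _
  have : StarOrderedRing (adjointable B E) := CStarAlgebra.spectralOrderedRing _
  set s : adjointable B E := ⟨S, S', h⟩
  have hn : ‖star s * s‖ = ‖S‖ ^ 2 := by rw [CStarRing.norm_star_mul_self, ← sq]; rfl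
  have h1 : 0 ≤ algebraMap ℝ (adjointable B E) ‖star s * s‖ - star s * s :=
    sub_nonneg.2 (IsSelfAdjoint.star_mul_self s).le_algebraMap_norm_self
  obtain ⟨r, hr⟩ := CStarAlgebra.nonneg_iff_eq_star_mul_self.1 h1
  have hs : (star s).1 = S' := (hasAdjoint_star s).unique h
  have h2 : hinner B (r.1 x) (r.1 x)
      = ((‖S‖ ^ 2 : ℝ) : ℂ) • hinner B x x - hinner B (S x) (S x) := by
    rw [hasAdjoint_star r, h, ← hinner_csmul, ← hinner_sub]
    congr 1
    change (star r * r).1 x = _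
    rw [← hr, hn, ← hs, Algebra.algebraMap_eq_smul_one]
    change (‖S‖ ^ 2 : ℝ) • x - _ = _
    simp only [Complex.coe_smul]
    rfl
  rw [← sub_nonneg]
  have h3 : inner Bᵐᵒᵖ (r.1 x) (r.1 x) = _ := congrArg op h2
  rw [show ((‖S‖ ^ 2 : ℝ) : ℂ) • inner Bᵐᵒᵖ x x - inner Bᵐᵒᵖ (S x) (S x)
      = inner Bᵐᵒᵖ (r.1 x) (r.1 x)
    from h3.symm]
  exact CStarModule.inner_self_nonneg

/-- A *-representation of a C*-algebra by adjointable operators is contractive. -/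
theorem norm_representation_le [CompleteSpace E] {A : Type*} [NonUnitalCStarAlgebra A]
    (Φ : A →ₙₐ[ℂ] (E →L[ℂ] E)) (hΦ : ∀ a, HasAdjoint B (Φ a) (Φ (star a))) (a : A) :
    ‖Φ a‖ ≤ ‖a‖ := by
  let Ψ : A →⋆ₙₐ[ℂ] adjointable B E :=
    { toFun := fun a => ⟨Φ a, _, hΦ a⟩
      map_smul' := fun c a => Subtype.ext (map_smul Φ c a)
      map_zero' := Subtype.ext (map_zero Φ)
      map_add' := fun a b => Subtype.ext (map_add Φ a b)
      map_mul' := fun a b => Subtype.ext (map_mul Φ a b)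
      map_star' := fun a => (star_eq_of_hasAdjoint (hΦ a)).symm }
  exact NonUnitalStarAlgHom.norm_apply_le Ψ a

/-! ### The ideal of compact operators -/

theorem mul_mem_compactOps {S S' k : E →L[ℂ] E} (h : HasAdjoint B S S')
    (hk : k ∈ compactOps B E) : S * k ∈ compactOps B E :=
  mem_compactOps_of_map (LinearMap.mulLeft ℂ S) (continuous_const.mul continuous_id)
    (fun x y => by
      have : LinearMap.mulLeft ℂ S (rankOne B x y) = rankOne B (S x) y :=
        ContinuousLinearMap.ext fun z => h.map_hsmul _ _
      rw [this]
      exact rankOne_mem _ _) hk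

theorem mem_compactOps_mul {S S' k : E →L[ℂ] E} (h : HasAdjoint B S S')
    (hk : k ∈ compactOps B E) : k * S ∈ compactOps B E :=
  mem_compactOps_of_map (LinearMap.mulRight ℂ S) (continuous_id.mul continuous_const)
    (fun x y => by
      have : LinearMap.mulRight ℂ S (rankOne B x y) = rankOne B x (S' y) :=
        ContinuousLinearMap.ext fun z => congrArg (x <• ·) (h.symm y z).symm
      rw [this]
      exact rankOne_mem _ _) hk

theorem adjoint_mem_compactOps {k k' : E →L[ℂ] E} (h : HasAdjoint B k k')
    (hk : k ∈ compactOps B E) : k' ∈ compactOps B E := by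
  set M := Submodule.span ℂ (Set.range fun p : E × E => rankOne B p.1 p.2)
  have hM (s) (hs : s ∈ M) : ∃ s' ∈ M, HasAdjoint B s s' := by
    induction hs using Submodule.span_induction with
    | mem s hs =>
      obtain ⟨p, rfl⟩ := hs
      exact ⟨_, Submodule.subset_span ⟨(p.2, p.1), rfl⟩, HasAdjoint.rankOne _ _⟩
    | zero => exact ⟨0, zero_mem _, HasAdjoint.zero⟩
    | add s r _ _ hs hr =>
      obtain ⟨s', hs', h1⟩ := hs
      obtain ⟨r', hr', h2⟩ := hr
      exact ⟨_, add_mem hs' hr', h1.add h2⟩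
    | smul c s _ hs =>
      obtain ⟨s', hs', h1⟩ := hs
      exact ⟨_, Submodule.smul_mem _ _ hs', h1.smul c⟩
  refine Metric.mem_closure_iff.2 fun ε hε => ?_
  obtain ⟨s, hs, hd⟩ := Metric.mem_closure_iff.1 hk ε hε
  obtain ⟨s', hs', h1⟩ := hM s hs
  refine ⟨s', hs', ?_⟩
  rw [dist_eq_norm, ← (h.sub h1).norm_eq, ← dist_eq_norm]
  exact hd

end Adjointable

namespace KasparovCycle

variable {G : Type v} [Group G] {A : GradedGAlgebra.{w} G} {B : GradedGAlgebra.{u} G}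
variable (X : KasparovCycle A B)

theorem hasAdjoint_T : HasAdjoint B.carrier X.T X.Tadj := X.T_adjoint

theorem hasAdjoint_Φ (a : A) : HasAdjoint B.carrier (X.Φ a) (X.Φ (star a)) := X.Φ_adjoint a

theorem norm_Φ_le (a : A) : ‖X.Φ a‖ ≤ ‖a‖ := norm_representation_le X.Φ X.hasAdjoint_Φ a

theorem continuous_Φ : Continuous X.Φ :=
  AddMonoidHomClass.continuous_of_bound X.Φ 1 fun a => by simpa using X.norm_Φ_le a

theorem u_inv_u (g : G) (x : X.E) : X.u g⁻¹ (X.u g x) = x := by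
  have := DFunLike.congr_fun (X.u.map_mul g⁻¹ g).symm x
  rwa [inv_mul_cancel, map_one] at this

theorem u_u_inv (g : G) (x : X.E) : X.u g (X.u g⁻¹ x) = x := by
  simpa using X.u_inv_u g⁻¹ x

theorem u_mul_apply (g h : G) (x : X.E) : X.u (g * h) x = X.u g (X.u h x) :=
  DFunLike.congr_fun (X.u.map_mul g h) x

theorem u_one_apply (x : X.E) : X.u 1 x = x := DFunLike.congr_fun X.u.map_one x

end KasparovCycle

theorem GradedGAlgebra.act_inv_act {G : Type v} [Group G] (B : GradedGAlgebra.{u} G) (g : G)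
    (b : B) : B.act g⁻¹ (B.act g b) = b := by
  have := DFunLike.congr_fun (B.act.map_mul g⁻¹ g).symm b
  rwa [inv_mul_cancel, map_one] at this

theorem GradedGAlgebra.act_act_inv {G : Type v} [Group G] (B : GradedGAlgebra.{u} G) (g : G)
    (b : B) : B.act g (B.act g⁻¹ b) = b := by
  simpa using B.act_inv_act g⁻¹ b

theorem GradedGAlgebra.act_mul_apply {G : Type v} [Group G] (B : GradedGAlgebra.{u} G) (g h : G)
    (b : B) : B.act (g * h) b = B.act g (B.act h b) :=
  DFunLike.congr_fun (B.act.map_mul g h) b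

namespace KasparovCycle

variable {G : Type v} [Group G] {A : GradedGAlgebra.{w} G} {B : GradedGAlgebra.{u} G}
variable (X : KasparovCycle A B)

/-- The unitaries of the action satisfy `⟨u_g x, y⟩ = β_g(⟨x, u_g⁻¹ y⟩)`. -/
theorem hinner_u_left (g : G) (x y : X.E) :
    hinner B.carrier (X.u g x) y = B.act g (hinner B.carrier x (X.u g⁻¹ y)) := by
  rw [← X.u_inner, X.u_u_inv]

theorem hasAdjoint_conj {S S' : X.E →L[ℂ] X.E} (h : HasAdjoint B.carrier S S') (g : G) :
    HasAdjoint B.carrier (X.u g * S * X.u g⁻¹) (X.u g * S' * X.u g⁻¹) := fun x y => by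
  change hinner B.carrier (X.u g (S (X.u g⁻¹ x))) y = hinner B.carrier x (X.u g (S' (X.u g⁻¹ y)))
  have h1 : hinner B.carrier x (X.u g (S' (X.u g⁻¹ y)))
      = B.act g (hinner B.carrier (X.u g⁻¹ x) (S' (X.u g⁻¹ y))) := by
    rw [← X.u_inner, X.u_u_inv]
  rw [h1, hinner_u_left, h]

theorem conj_mem_compactOps (g : G) {k : X.E →L[ℂ] X.E} (hk : k ∈ compactOps B.carrier X.E) :
    X.u g * k * X.u g⁻¹ ∈ compactOps B.carrier X.E :=
  mem_compactOps_of_map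
    (LinearMap.mulLeft ℂ (X.u g) ∘ₗ LinearMap.mulRight ℂ (X.u g⁻¹))
    (continuous_const.mul (continuous_id.mul continuous_const)) (fun x y => by
      have : (LinearMap.mulLeft ℂ (X.u g) ∘ₗ LinearMap.mulRight ℂ (X.u g⁻¹)) (rankOne B.carrier x y)
          = rankOne B.carrier (X.u g x) (X.u g y) := ContinuousLinearMap.ext fun z => by
        change X.u g (x <• hinner B.carrier y (X.u g⁻¹ z)) = X.u g x <• hinner B.carrier (X.u g y) z
        rw [X.u_smul, hinner_u_left]
      rw [this]
      exact rankOne_mem _ _) hk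

end KasparovCycle

/-! ### Closed submodules of Hilbert modules -/

/-- A closed subspace of a Hilbert `B`-module that is stable under the right action of `B`. -/
structure HilbertSubmodule (B : Type u) [NonUnitalCStarAlgebra B] (E : Type w)
    [NormedAddCommGroup E] [NormedSpace ℂ E] [SMul Bᵐᵒᵖ E] extends Submodule ℂ E where
  hsmul_mem : ∀ x ∈ carrier, ∀ b : B, x <• b ∈ carrier
  isClosed : IsClosed carrier

namespace HilbertSubmodule

section

variable {B : Type u} [NonUnitalCStarAlgebra B] {E : Type w} [NormedAddCommGroup E]
  [NormedSpace ℂ E] [SMul Bᵐᵒᵖ E]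

/-- The elements of a closed submodule, as a Hilbert module of their own. -/
def Elem (S : HilbertSubmodule B E) : Type w := S.toSubmodule

variable (S : HilbertSubmodule B E)

noncomputable instance : NormedAddCommGroup S.Elem :=
  inferInstanceAs (NormedAddCommGroup S.toSubmodule)

noncomputable instance : NormedSpace ℂ S.Elem :=
  inferInstanceAs (NormedSpace ℂ S.toSubmodule)

instance [CompleteSpace E] : CompleteSpace S.Elem :=
  S.isClosed.completeSpace_coe

instance : SMul Bᵐᵒᵖ S.Elem where
  smul b x := ⟨b • x.1, S.hsmul_mem x.1 x.2 b.unop⟩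

/-- The inclusion. -/
noncomputable def incl : S.Elem →L[ℂ] E := S.toSubmodule.subtypeL

/-- An element of a closed submodule. -/
def elem (x : E) (hx : x ∈ S.toSubmodule) : S.Elem := ⟨x, hx⟩

variable {S}

theorem ext {x y : S.Elem} (h : S.incl x = S.incl y) : x = y := Subtype.ext h

theorem incl_mem (x : S.Elem) : S.incl x ∈ S.toSubmodule := x.2

/-- The operator into `S` defined by an operator whose values lie in `S`. -/
noncomputable def codRestrict {F : Type*} [NormedAddCommGroup F] [NormedSpace ℂ F]
    (L : F →L[ℂ] E) (h : ∀ x, L x ∈ S.toSubmodule) : F →L[ℂ] S.Elem :=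
  ContinuousLinearMap.codRestrict L S.toSubmodule h

/-- The restriction to `S` of an operator that preserves `S`. -/
noncomputable def restrictOp (L : E →L[ℂ] E) (h : ∀ x ∈ S.toSubmodule, L x ∈ S.toSubmodule) :
    S.Elem →L[ℂ] S.Elem :=
  codRestrict (L.comp S.incl) fun x => h _ x.2

end

variable {B : Type u} [NonUnitalCStarAlgebra B] [PartialOrder Bᵐᵒᵖ] [StarOrderedRing Bᵐᵒᵖ]
variable {E : Type w} [NormedAddCommGroup E] [NormedSpace ℂ E] [SMul Bᵐᵒᵖ E] [CStarModule Bᵐᵒᵖ E]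
variable {S : HilbertSubmodule B E}

noncomputable instance : CStarModule Bᵐᵒᵖ S.Elem where
  inner x y := inner Bᵐᵒᵖ (S.incl x) (S.incl y)
  inner_add_right := CStarModule.inner_add_right
  inner_self_nonneg := CStarModule.inner_self_nonneg
  inner_self := CStarModule.inner_self.trans ⟨fun h => ext h, fun h => h ▸ rfl⟩
  inner_op_smul_right := CStarModule.inner_op_smul_right
  inner_smul_right_complex := CStarModule.inner_smul_right_complex
  star_inner _ _ := CStarModule.star_inner _ _
  norm_eq_sqrt_norm_inner_self x := CStarModule.norm_eq_sqrt_norm_inner_self (A := Bᵐᵒᵖ) (S.incl x)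

theorem hinner_incl (x y : S.Elem) : hinner B (S.incl x) (S.incl y) = hinner B x y := rfl

end HilbertSubmodule

namespace KasparovCycle

variable {G : Type v} [Group G] {A : GradedGAlgebra.{w} G} {B : GradedGAlgebra.{u} G}

/-- A closed submodule of the module of a cycle that is stable under the grading operator, the
group and the representation. -/
structure InvariantSubmodule (X : KasparovCycle A B) extends HilbertSubmodule B.carrier X.E where
  gr_mem : ∀ x ∈ carrier, X.gr x ∈ carrier
  u_mem : ∀ g, ∀ x ∈ carrier, X.u g x ∈ carrier
  Φ_mem : ∀ a, ∀ x ∈ carrier, X.Φ a x ∈ carrier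

namespace InvariantSubmodule

variable {X : KasparovCycle A B} (S : InvariantSubmodule X)

/-- The grading operator on an invariant submodule. -/
noncomputable def gr : S.Elem →L[ℂ] S.Elem := HilbertSubmodule.restrictOp X.gr S.gr_mem

/-- The group action on an invariant submodule. -/
noncomputable def u : G →* (S.Elem →L[ℂ] S.Elem) where
  toFun g := HilbertSubmodule.restrictOp (X.u g) (S.u_mem g)
  map_one' := ContinuousLinearMap.ext fun _ => HilbertSubmodule.ext (X.u_one_apply _)
  map_mul' g h := ContinuousLinearMap.ext fun _ => HilbertSubmodule.ext (X.u_mul_apply g h _)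

/-- The representation on an invariant submodule. -/
noncomputable def Φ : A →ₙₐ[ℂ] (S.Elem →L[ℂ] S.Elem) where
  toFun a := HilbertSubmodule.restrictOp (X.Φ a) (S.Φ_mem a)
  map_smul' c a := ContinuousLinearMap.ext fun x => HilbertSubmodule.ext
    (DFunLike.congr_fun (map_smul X.Φ c a) (S.incl x))
  map_zero' := ContinuousLinearMap.ext fun x => HilbertSubmodule.ext
    (DFunLike.congr_fun (map_zero X.Φ) (S.incl x))
  map_add' a b := ContinuousLinearMap.ext fun x => HilbertSubmodule.ext
    (DFunLike.congr_fun (map_add X.Φ a b) (S.incl x))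
  map_mul' a b := ContinuousLinearMap.ext fun x => HilbertSubmodule.ext
    (DFunLike.congr_fun (map_mul X.Φ a b) (S.incl x))

theorem incl_gr (x : S.Elem) : S.incl (S.gr x) = X.gr (S.incl x) := rfl

theorem incl_u (g : G) (x : S.Elem) : S.incl (S.u g x) = X.u g (S.incl x) := rfl

/-- The cycle on an invariant submodule given by an operator of the submodule. -/
noncomputable def cycle (hcg : IsCountablyGenerated B.carrier S.Elem) (T Tadj : S.Elem →L[ℂ] S.Elem)
    (T_adjoint : HasAdjoint B.carrier T Tadj) (T_gr : ∀ x, S.gr (T x) = -T (S.gr x))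
    (compact_sub_adj : ∀ a, (T - Tadj) * S.Φ a ∈ compactOps B.carrier S.Elem)
    (compact_sq : ∀ a, (T * T - 1) * S.Φ a ∈ compactOps B.carrier S.Elem)
    (compact_equivariance : ∀ g a, (S.u g * T * S.u g⁻¹ - T) * S.Φ a ∈ compactOps B.carrier S.Elem)
    (compact_commutator : ∀ a, T * S.Φ a - S.Φ (A.grading a) * T ∈ compactOps B.carrier S.Elem) :
    KasparovCycle A B where
  E := S.Elem
  countablyGenerated := hcg
  gr := S.gr
  gr_gr _ := HilbertSubmodule.ext (X.gr_gr _)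
  gr_inner _ _ := X.gr_inner _ _
  gr_smul _ _ := HilbertSubmodule.ext (X.gr_smul _ _)
  u := S.u
  u_inner g _ _ := X.u_inner g _ _
  u_smul g _ _ := HilbertSubmodule.ext (X.u_smul g _ _)
  u_gr g _ := HilbertSubmodule.ext (X.u_gr g _)
  Φ := S.Φ
  Φ_adjoint a _ _ := X.Φ_adjoint a _ _
  Φ_gr a _ := HilbertSubmodule.ext (X.Φ_gr a _)
  Φ_u g a _ := HilbertSubmodule.ext (X.Φ_u g a _)
  T := T
  Tadj := Tadj
  T_adjoint := T_adjoint
  T_gr := T_gr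
  compact_sub_adj := compact_sub_adj
  compact_sq := compact_sq
  compact_equivariance := compact_equivariance
  compact_commutator := compact_commutator

end InvariantSubmodule

end KasparovCycle

/-! ### Orthogonal families of projections and the essential submodule -/

/-- A family of pairwise orthogonal central projections `d j` with dense linear span in a graded
`G`-C*-algebra, fixed by the grading and permuted by the group. -/
structure ProjectionFamily {G : Type v} [Group G] (A : GradedGAlgebra.{w} G) (J : Type w') where
  d : J → A
  perm : G → J ≃ J
  star_d : ∀ j, star (d j) = d j
  mul_self : ∀ j, d j * d j = d j
  mul_of_ne : ∀ i j, i ≠ j → d i * d j = 0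
  comm : ∀ a j, a * d j = d j * a
  grading_d : ∀ j, A.grading (d j) = d j
  act_d : ∀ g j, A.act g (d j) = d (perm g j)
  norm_sum_le : ∀ (F : Finset J) (r : J → ℝ), (∀ j, 0 ≤ r j ∧ r j ≤ 1) →
    ‖∑ j ∈ F, (r j : ℂ) • d j‖ ≤ 1
  dense : Dense (Submodule.span ℂ (Set.range d) : Set A)

namespace ProjectionFamily

variable {G : Type v} [Group G] {A : GradedGAlgebra.{w} G} {J : Type w'}

/-- A continuous linear map takes values in a closed subspace if it does so on the projections. -/
theorem mem_of_forall (P : ProjectionFamily A J) {V : Type*} [NormedAddCommGroup V]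
    [NormedSpace ℂ V] {M : Submodule ℂ V} (hM : IsClosed (M : Set V)) (L : A →ₗ[ℂ] V)
    (hL : Continuous L) (h : ∀ j, L (P.d j) ∈ M) (a : A) : L a ∈ M := by
  have hcl : IsClosed (M.comap L : Set A) := hM.preimage hL
  exact hcl.closure_subset_iff.2
    (Submodule.span_le.2 (by rintro _ ⟨j, rfl⟩; exact h j)) (P.dense a)

/-- The one-element family `{1}` of `ℂ`. -/
noncomputable def complex (G : Type v) [Group G] :
    ProjectionFamily (GradedGAlgebra.complex G) Unit where
  d _ := (1 : ℂ)
  perm _ := Equiv.refl _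
  star_d _ := star_one ℂ
  mul_self _ := mul_one (1 : ℂ)
  mul_of_ne i j h := (h (Subsingleton.elim i j)).elim
  comm a _ := mul_comm (G := ℂ) a 1
  grading_d _ := rfl
  act_d _ _ := rfl
  norm_sum_le F r hr := by
    change ‖∑ j ∈ F, (r j : ℂ) • (1 : ℂ)‖ ≤ 1
    rcases Finset.subset_singleton_iff.1 (show F ⊆ {()} from fun _ _ => by simp) with rfl | rfl
    · simp
    · simpa [abs_of_nonneg (hr ()).1] using (hr ()).2
  dense := by
    intro a
    refine subset_closure ?_
    have : a = (show ℂ from a) • (1 : ℂ) := (mul_one (M := ℂ) a).symm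
    rw [this]
    exact Submodule.smul_mem _ _ (Submodule.subset_span ⟨(), rfl⟩)

end ProjectionFamily

namespace KasparovCycle

variable {G : Type v} [Group G] {A : GradedGAlgebra.{w} G} {B : GradedGAlgebra.{u} G}
variable {J : Type w'} (Y : KasparovCycle A B) (P : ProjectionFamily A J)

theorem Φ_mul_apply (a b : A) (x : Y.E) : Y.Φ (a * b) x = Y.Φ a (Y.Φ b x) :=
  DFunLike.congr_fun (map_mul Y.Φ a b) x

theorem Φ_add_apply (a b : A) (x : Y.E) : Y.Φ (a + b) x = Y.Φ a x + Y.Φ b x :=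
  DFunLike.congr_fun (map_add Y.Φ a b) x

theorem Φ_smul_apply (c : ℂ) (a : A) (x : Y.E) : Y.Φ (c • a) x = c • Y.Φ a x :=
  DFunLike.congr_fun (map_smul Y.Φ c a) x

theorem Φ_sum_apply {ι : Type*} (F : Finset ι) (a : ι → A) (x : Y.E) :
    Y.Φ (∑ i ∈ F, a i) x = ∑ i ∈ F, Y.Φ (a i) x := by
  rw [map_sum, sum_apply]

theorem norm_sum_Φ_apply_le (F : Finset J) (x : Y.E) : ‖∑ j ∈ F, Y.Φ (P.d j) x‖ ≤ ‖x‖ := by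
  rw [← Y.Φ_sum_apply]
  refine ((Y.Φ _).le_opNorm x).trans ?_
  have h := P.norm_sum_le F (fun _ => 1) fun _ => ⟨zero_le_one, le_rfl⟩
  simp only [Complex.ofReal_one, one_smul] at h
  exact mul_le_of_le_one_left (norm_nonneg x) ((Y.norm_Φ_le _).trans h)

theorem isClosed_hasSum_Φ : IsClosed {x : Y.E | HasSum (fun j => Y.Φ (P.d j) x) x} := by
  refine isClosed_of_closure_subset fun x hx => ?_
  refine Metric.tendsto_nhds.2 fun ε hε => ?_
  obtain ⟨y, hy, hxy⟩ := Metric.mem_closure_iff.1 hx (ε / 3) (by positivity)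
  filter_upwards [Metric.tendsto_nhds.1 hy (ε / 3) (by positivity)] with F hF
  have h1 := Y.norm_sum_Φ_apply_le P F (x - y)
  simp only [map_sub, Finset.sum_sub_distrib] at h1
  rw [← dist_eq_norm, ← dist_eq_norm] at h1
  calc _ ≤ dist (∑ j ∈ F, Y.Φ (P.d j) x) (∑ j ∈ F, Y.Φ (P.d j) y)
        + dist (∑ j ∈ F, Y.Φ (P.d j) y) y + dist y x := dist_triangle4 _ _ _ _
    _ < ε / 3 + ε / 3 + ε / 3 := by
      rw [dist_comm y x]
      exact add_lt_add (add_lt_add (h1.trans_lt hxy) hF) hxy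
    _ = ε := by ring

/-- The essential submodule of a cycle over an algebra spanned by orthogonal projections: the
elements `e` with `e = ∑ⱼ Φ(dⱼ) e`. It is the closed span of the elements `Φ(a) x`, and need not be
complemented. -/
noncomputable def essential : InvariantSubmodule Y where
  carrier := {e | HasSum (fun j => Y.Φ (P.d j) e) e}
  add_mem' {x y} hx hy := by
    change HasSum (fun j => Y.Φ (P.d j) (x + y)) (x + y)
    simp only [map_add]
    exact HasSum.add hx hy
  zero_mem' := by
    change HasSum (fun j => Y.Φ (P.d j) 0) 0
    simp only [map_zero]
    exact hasSum_zero
  smul_mem' c x hx := by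
    change HasSum (fun j => Y.Φ (P.d j) (c • x)) (c • x)
    simp only [map_smul]
    exact HasSum.const_smul c hx
  hsmul_mem x hx b := by
    have h (j : J) : Y.Φ (P.d j) (x <• b) = Y.Φ (P.d j) x <• b := (Y.hasAdjoint_Φ _).map_hsmul _ _
    change HasSum (fun j => Y.Φ (P.d j) (x <• b)) (x <• b)
    simp only [h]
    exact HasSum.map hx
      (AddMonoidHom.mk' (fun y : Y.E => y <• b) fun y z => hadd_smul (B := B.carrier) y z b)
      ((continuous_hsmul (B := B.carrier)).comp (continuous_id.prodMk continuous_const))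
  isClosed := Y.isClosed_hasSum_Φ P
  gr_mem x hx := by
    have h (j : J) : Y.Φ (P.d j) (Y.gr x) = Y.gr (Y.Φ (P.d j) x) := by rw [Y.Φ_gr, P.grading_d]
    change HasSum (fun j => Y.Φ (P.d j) (Y.gr x)) (Y.gr x)
    simp only [h]
    exact Y.gr.hasSum hx
  u_mem g x hx := by
    have h (j : J) : Y.Φ (P.d (P.perm g j)) (Y.u g x) = Y.u g (Y.Φ (P.d j) x) := by
      rw [Y.Φ_u, P.act_d]
    change HasSum (fun j => Y.Φ (P.d j) (Y.u g x)) (Y.u g x)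
    rw [← (P.perm g).hasSum_iff]
    simp only [Function.comp_def, h]
    exact (Y.u g).hasSum hx
  Φ_mem a x hx := by
    have h (j : J) : Y.Φ (P.d j) (Y.Φ a x) = Y.Φ a (Y.Φ (P.d j) x) := by
      rw [← Y.Φ_mul_apply, ← P.comm, Y.Φ_mul_apply]
    change HasSum (fun j => Y.Φ (P.d j) (Y.Φ a x)) (Y.Φ a x)
    simp only [h]
    exact (Y.Φ a).hasSum hx

theorem Φ_d_mem_essential (j : J) (x : Y.E) : Y.Φ (P.d j) x ∈ (Y.essential P).toSubmodule := by
  have h := hasSum_single (f := fun i => Y.Φ (P.d i) (Y.Φ (P.d j) x)) j fun i hi => by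
    rw [← Y.Φ_mul_apply, P.mul_of_ne i j hi, map_zero]; rfl
  rw [← Y.Φ_mul_apply, P.mul_self] at h
  exact h

theorem Φ_mem_essential (a : A) (x : Y.E) : Y.Φ a x ∈ (Y.essential P).toSubmodule :=
  P.mem_of_forall (Y.essential P).isClosed
    ((ContinuousLinearMap.apply ℂ Y.E x).toLinearMap ∘ₗ (Y.Φ : A →ₗ[ℂ] (Y.E →L[ℂ] Y.E)))
    ((ContinuousLinearMap.apply ℂ Y.E x).continuous.comp Y.continuous_Φ)
    (fun j => Y.Φ_d_mem_essential P j x) a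

/-- The operator `Φ(a)`, with values in the essential submodule. -/
noncomputable def essentialΦ (a : A) : Y.E →L[ℂ] (Y.essential P).Elem :=
  HilbertSubmodule.codRestrict (Y.Φ a) (Y.Φ_mem_essential P a)

namespace InvariantSubmodule

variable {Y} (S : InvariantSubmodule Y)

theorem continuous_Φ : Continuous S.Φ := by
  refine AddMonoidHomClass.continuous_of_bound S.Φ 1 fun a => ?_
  rw [one_mul]
  exact norm_representation_le (B := B.carrier) S.Φ (fun a x y => Y.Φ_adjoint a _ _) a

/-- `InvariantSubmodule.cycle` for an algebra spanned by projections: compactness need only be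
checked on the projections. -/
noncomputable def cycleOfProjections (P : ProjectionFamily A J)
    (hcg : IsCountablyGenerated B.carrier S.Elem) (T Tadj : S.Elem →L[ℂ] S.Elem)
    (T_adjoint : HasAdjoint B.carrier T Tadj) (T_gr : ∀ x, S.gr (T x) = -T (S.gr x))
    (compact_sub_adj : ∀ j, (T - Tadj) * S.Φ (P.d j) ∈ compactOps B.carrier S.Elem)
    (compact_sq : ∀ j, (T * T - 1) * S.Φ (P.d j) ∈ compactOps B.carrier S.Elem)
    (compact_equivariance : ∀ g j,
      (S.u g * T * S.u g⁻¹ - T) * S.Φ (P.d j) ∈ compactOps B.carrier S.Elem)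
    (compact_commutator : ∀ j,
      T * S.Φ (P.d j) - S.Φ (P.d j) * T ∈ compactOps B.carrier S.Elem) :
    KasparovCycle A B :=
  S.cycle hcg T Tadj T_adjoint T_gr
    (P.mem_of_forall (Submodule.isClosed_topologicalClosure _)
      (LinearMap.mulLeft ℂ (T - Tadj) ∘ₗ (S.Φ : A →ₗ[ℂ] (S.Elem →L[ℂ] S.Elem)))
      (continuous_const.mul S.continuous_Φ) compact_sub_adj)
    (P.mem_of_forall (Submodule.isClosed_topologicalClosure _)
      (LinearMap.mulLeft ℂ (T * T - 1) ∘ₗ (S.Φ : A →ₗ[ℂ] (S.Elem →L[ℂ] S.Elem)))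
      (continuous_const.mul S.continuous_Φ) compact_sq)
    (fun g => P.mem_of_forall (Submodule.isClosed_topologicalClosure _)
      (LinearMap.mulLeft ℂ (S.u g * T * S.u g⁻¹ - T) ∘ₗ (S.Φ : A →ₗ[ℂ] (S.Elem →L[ℂ] S.Elem)))
      (continuous_const.mul S.continuous_Φ) (compact_equivariance g))
    (P.mem_of_forall (Submodule.isClosed_topologicalClosure _)
      (LinearMap.mulLeft ℂ T ∘ₗ (S.Φ : A →ₗ[ℂ] (S.Elem →L[ℂ] S.Elem))
        - LinearMap.mulRight ℂ T ∘ₗ (S.Φ : A →ₗ[ℂ] (S.Elem →L[ℂ] S.Elem))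
          ∘ₗ (A.grading : A →ₗ[ℂ] A))
      ((continuous_const.mul S.continuous_Φ).sub
        ((S.continuous_Φ.comp (GradedGAlgebra.continuous_starHom A.grading)).mul continuous_const))
      fun j => by
        change T * S.Φ (P.d j) - S.Φ (A.grading (P.d j)) * T ∈ _
        rw [P.grading_d]
        exact compact_commutator j)

end InvariantSubmodule

end KasparovCycle

/-! ### Interpolation between an operator and a diagonal operator -/

open unitInterval in
/-- A piecewise linear function on `[0,1]` that is `0` near `0` and `1` near `1`, and that moves
towards `1` as `n` grows. -/
noncomputable def ramp (n : ℕ) (t : I) : ℝ := max 0 (min 1 (2 - (n + 2) * (1 - (t : ℝ))))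

section Ramp

open unitInterval Filter

theorem ramp_mem (n : ℕ) (t : I) : 0 ≤ ramp n t ∧ ramp n t ≤ 1 :=
  ⟨le_max_left _ _, max_le zero_le_one (min_le_left _ _)⟩

theorem continuous_ramp (n : ℕ) : Continuous (ramp n) := by
  unfold ramp
  fun_prop

theorem ramp_zero (n : ℕ) : ramp n 0 = 0 := by
  have : (0 : ℝ) ≤ n := n.cast_nonneg
  refine max_eq_left ((min_le_right _ _).trans ?_)
  simp

theorem ramp_eventually (n : ℕ) : ∀ᶠ t in nhds (1 : I), ramp n t = 1 := by
  have h : Continuous fun t : I => 2 - ((n : ℝ) + 2) * (1 - (t : ℝ)) := by fun_prop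
  have h1 : (1 : ℝ) < 2 - ((n : ℝ) + 2) * (1 - ((1 : I) : ℝ)) := by simp
  filter_upwards [h.continuousAt.eventually (lt_mem_nhds h1)] with t ht
  rw [ramp, min_eq_left ht.le, max_eq_right zero_le_one]

theorem ramp_eq_zero {τ : I} (hτ : τ < 1) :
    ∃ N : ℕ, ∀ n, N ≤ n → ∀ t ≤ τ, ramp n t = 0 := by
  have hτ' : 0 < 1 - (τ : ℝ) := sub_pos.2 hτ
  obtain ⟨N, hN⟩ := exists_nat_ge (2 / (1 - (τ : ℝ)))
  refine ⟨N, fun n hn t ht => max_eq_left ((min_le_right _ _).trans ?_)⟩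
  have h1 : 2 ≤ (N : ℝ) * (1 - (τ : ℝ)) := (div_le_iff₀ hτ').1 hN
  have h2 : (N : ℝ) ≤ n := Nat.cast_le.2 hn
  have h3 : 1 - (τ : ℝ) ≤ 1 - (t : ℝ) := sub_le_sub_left (show (t : ℝ) ≤ τ from ht) 1
  have h4 : (N : ℝ) * (1 - (τ : ℝ)) ≤ (n + 2) * (1 - (t : ℝ)) := by
    apply mul_le_mul (by linarith) h3 hτ'.le (by positivity)
  linarith

end Ramp

namespace ProjectionFamily

open unitInterval Filter

variable {G : Type v} [Group G] {A : GradedGAlgebra.{w} G} {J : Type w'} [Countable J]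
  (P : ProjectionFamily A J)

/-- The element `∑ⱼ φ(rampⱼ(t)) dⱼ`, a finite sum for `t < 1` if `φ(0) = 0`. -/
noncomputable def weight (φ : ℝ → ℝ) (t : I) : A :=
  ∑ᶠ j, ((φ (ramp ((nonempty_embedding_nat J).some j) t) : ℝ) : ℂ) • P.d j

variable {φ : ℝ → ℝ}

theorem exists_weight_eq (hφ : φ 0 = 0) {τ : I} (hτ : τ < 1) : ∃ F : Finset J,
    (∀ j ∉ F, ∀ t ≤ τ, ramp ((nonempty_embedding_nat J).some j) t = 0) ∧
    ∀ t ≤ τ, P.weight φ t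
      = ∑ j ∈ F, ((φ (ramp ((nonempty_embedding_nat J).some j) t) : ℝ) : ℂ) • P.d j := by
  obtain ⟨N, hN⟩ := ramp_eq_zero hτ
  have hfin : {j : J | (nonempty_embedding_nat J).some j < N}.Finite :=
    (Set.finite_lt_nat N).preimage (nonempty_embedding_nat J).some.injective.injOn
  have h0 (j) (hj : j ∉ hfin.toFinset) (t) (ht : t ≤ τ) :
      ramp ((nonempty_embedding_nat J).some j) t = 0 :=
    hN _ (by simpa using hj) t ht
  refine ⟨hfin.toFinset, h0, fun t ht => finsum_eq_sum_of_support_subset _ fun j hj => ?_⟩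
  by_contra hj'
  refine hj ?_
  change ((φ (ramp ((nonempty_embedding_nat J).some j) t) : ℝ) : ℂ) • P.d j = 0
  rw [h0 j hj' t ht, hφ, Complex.ofReal_zero, zero_smul]

theorem norm_weight_le (hφ : φ 0 = 0) (hφ' : ∀ r, 0 ≤ r ∧ r ≤ 1 → 0 ≤ φ r ∧ φ r ≤ 1) {t : I}
    (ht : t < 1) : ‖P.weight φ t‖ ≤ 1 := by
  obtain ⟨F, -, hF⟩ := P.exists_weight_eq hφ ht
  rw [hF t le_rfl]
  exact P.norm_sum_le F _ fun j => hφ' _ (ramp_mem _ t)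

theorem continuousOn_weight (hφ : φ 0 = 0) (hc : Continuous φ) :
    ContinuousOn (P.weight φ) (Set.Iio 1) := by
  intro t ht
  obtain ⟨τ, h1, h2⟩ := exists_between (show t < 1 from ht)
  obtain ⟨F, -, hF⟩ := P.exists_weight_eq hφ h2
  have hcont : Continuous fun t => ∑ j ∈ F,
      ((φ (ramp ((nonempty_embedding_nat J).some j) t) : ℝ) : ℂ) • P.d j :=
    continuous_finsetSum _ fun j _ =>
      (Complex.continuous_ofReal.comp (hc.comp (continuous_ramp _))).smul continuous_const
  refine (hcont.continuousAt.congr ?_).continuousWithinAt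
  filter_upwards [gt_mem_nhds h1] with s hs
  exact (hF s hs.le).symm

theorem weight_zero (hφ : φ 0 = 0) : P.weight φ 0 = 0 := by
  simp [weight, ramp_zero, hφ]

theorem weight_mul (hφ : φ 0 = 0) {t : I} (ht : t < 1) (i : J) :
    P.weight φ t * P.d i
      = ((φ (ramp ((nonempty_embedding_nat J).some i) t) : ℝ) : ℂ) • P.d i := by
  obtain ⟨F, hF0, hF⟩ := P.exists_weight_eq hφ ht
  rw [hF t le_rfl, Finset.sum_mul, Finset.sum_eq_single i]
  · rw [smul_mul_assoc, P.mul_self]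
  · intro j _ hj
    rw [smul_mul_assoc, P.mul_of_ne j i hj, smul_zero]
  · intro hi
    rw [hF0 i hi t le_rfl, hφ, Complex.ofReal_zero, zero_smul, zero_mul]

theorem star_weight (hφ : φ 0 = 0) {t : I} (ht : t < 1) : star (P.weight φ t) = P.weight φ t := by
  obtain ⟨F, -, hF⟩ := P.exists_weight_eq hφ ht
  rw [hF t le_rfl, star_sum]
  refine Finset.sum_congr rfl fun j _ => ?_
  rw [star_smul, P.star_d]
  simp

theorem grading_weight (hφ : φ 0 = 0) {t : I} (ht : t < 1) :
    A.grading (P.weight φ t) = P.weight φ t := by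
  obtain ⟨F, -, hF⟩ := P.exists_weight_eq hφ ht
  rw [hF t le_rfl, map_sum]
  exact Finset.sum_congr rfl fun j _ => by rw [map_smul, P.grading_d]

end ProjectionFamily

namespace KasparovCycle

open unitInterval Filter

variable {G : Type v} [Group G] {A : GradedGAlgebra.{w} G} {B : GradedGAlgebra.{u} G}
variable {J : Type w'} {Y : KasparovCycle A B} {P : ProjectionFamily A J}

variable (Y P) in
/-- The operator `T₀ Φ(a)`, for an operator `T₀` of the essential submodule. -/
noncomputable def essentialOp (T₀ : (Y.essential P).Elem →L[ℂ] (Y.essential P).Elem) (a : A) :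
    Y.E →L[ℂ] Y.E :=
  (Y.essential P).incl.comp (T₀.comp (Y.essentialΦ P a))

variable (Y P) in
/-- `essentialOp` as a linear function of the element of the algebra. -/
noncomputable def essentialOpₗ (T₀ : (Y.essential P).Elem →L[ℂ] (Y.essential P).Elem) :
    A →ₗ[ℂ] (Y.E →L[ℂ] Y.E) where
  toFun := essentialOp Y P T₀
  map_add' a b := ContinuousLinearMap.ext fun x => by
    have : Y.essentialΦ P (a + b) x = Y.essentialΦ P a x + Y.essentialΦ P b x :=
      HilbertSubmodule.ext (Y.Φ_add_apply a b x)
    change (Y.essential P).incl (T₀ (Y.essentialΦ P (a + b) x)) = _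
    rw [this, map_add, map_add]
    rfl
  map_smul' c a := ContinuousLinearMap.ext fun x => by
    have : Y.essentialΦ P (c • a) x = c • Y.essentialΦ P a x :=
      HilbertSubmodule.ext (Y.Φ_smul_apply c a x)
    change (Y.essential P).incl (T₀ (Y.essentialΦ P (c • a) x)) = _
    rw [this, map_smul, map_smul]
    rfl

theorem norm_essentialOp_le (T₀ : (Y.essential P).Elem →L[ℂ] (Y.essential P).Elem) (a : A) :
    ‖essentialOp Y P T₀ a‖ ≤ ‖T₀‖ * ‖a‖ := by
  refine ContinuousLinearMap.opNorm_le_bound _ (by positivity) fun x => ?_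
  change ‖T₀ (Y.essentialΦ P a x)‖ ≤ _
  refine (T₀.le_opNorm _).trans ?_
  rw [mul_assoc]
  gcongr
  exact ((Y.Φ a).le_opNorm x).trans (by gcongr; exact Y.norm_Φ_le a)

theorem continuous_essentialOp (T₀ : (Y.essential P).Elem →L[ℂ] (Y.essential P).Elem) :
    Continuous (essentialOp Y P T₀) :=
  ((essentialOpₗ Y P T₀).mkContinuous ‖T₀‖ fun a => norm_essentialOp_le T₀ a).continuous

theorem essentialOp_mul (T₀ : (Y.essential P).Elem →L[ℂ] (Y.essential P).Elem) (a b : A) :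
    essentialOp Y P T₀ (a * b) = essentialOp Y P T₀ a * Y.Φ b :=
  ContinuousLinearMap.ext fun x => by
    have : Y.essentialΦ P (a * b) x = Y.essentialΦ P a (Y.Φ b x) :=
      HilbertSubmodule.ext (Y.Φ_mul_apply a b x)
    change (Y.essential P).incl (T₀ (Y.essentialΦ P (a * b) x)) = _
    rw [this]
    rfl

variable (Y P) in
/-- An odd adjointable operator of the essential submodule that commutes with the group and the
algebra, and that differs on each projection by a compact operator from the operator of the
cycle. -/
structure DiagonalOperator where
  T : (Y.essential P).Elem →L[ℂ] (Y.essential P).Elem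
  Tadj : (Y.essential P).Elem →L[ℂ] (Y.essential P).Elem
  adjoint : HasAdjoint B.carrier T Tadj
  T_gr : ∀ x, (Y.essential P).gr (T x) = -T ((Y.essential P).gr x)
  T_u : ∀ g x, (Y.essential P).u g (T x) = T ((Y.essential P).u g x)
  T_Φ : ∀ a x, T ((Y.essential P).Φ a x) = (Y.essential P).Φ a (T x)
  compact : ∀ j, essentialOp Y P T (P.d j) - Y.T * Y.Φ (P.d j) ∈ compactOps B.carrier Y.E

namespace DiagonalOperator

variable (D : DiagonalOperator Y P)

theorem Tadj_Φ (a : A) (x : (Y.essential P).Elem) :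
    D.Tadj ((Y.essential P).Φ a x) = (Y.essential P).Φ a (D.Tadj x) := by
  refine hinner_ext (B := B.carrier) fun z => ?_
  have h (a : A) (x y : (Y.essential P).Elem) : hinner B.carrier ((Y.essential P).Φ a x) y
      = hinner B.carrier x ((Y.essential P).Φ (star a) y) := Y.Φ_adjoint a _ _
  rw [← D.adjoint, ← star_star a, ← h, ← h, ← D.T_Φ, D.adjoint]

theorem hasAdjoint_essentialOp_d (j : J) :
    HasAdjoint B.carrier (essentialOp Y P D.T (P.d j)) (essentialOp Y P D.Tadj (P.d j)) := by
  -- both operators are compressed by `Φ(dⱼ)`, so that the pairing takes place in the essential part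
  have h (T₀ : (Y.essential P).Elem →L[ℂ] (Y.essential P).Elem)
      (hT : ∀ a x, T₀ ((Y.essential P).Φ a x) = (Y.essential P).Φ a (T₀ x)) (x : Y.E) :
      essentialOp Y P T₀ (P.d j) x = Y.Φ (P.d j) (essentialOp Y P T₀ (P.d j) x) := by
    have e : (Y.essential P).Φ (P.d j) (Y.essentialΦ P (P.d j) x) = Y.essentialΦ P (P.d j) x := by
      refine HilbertSubmodule.ext ?_
      change Y.Φ (P.d j) (Y.Φ (P.d j) x) = Y.Φ (P.d j) x
      rw [← Y.Φ_mul_apply, P.mul_self]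
    change (Y.essential P).incl (T₀ (Y.essentialΦ P (P.d j) x))
      = (Y.essential P).incl ((Y.essential P).Φ (P.d j) (T₀ (Y.essentialΦ P (P.d j) x)))
    rw [← hT, e]
  intro x y
  rw [h D.T D.T_Φ x, h D.Tadj D.Tadj_Φ y, Y.Φ_adjoint, P.star_d]
  have h2 := Y.Φ_adjoint (P.d j) x (essentialOp Y P D.Tadj (P.d j) y)
  rw [P.star_d] at h2
  rw [← h2]
  exact D.adjoint (Y.essentialΦ P (P.d j) x) (Y.essentialΦ P (P.d j) y)

theorem compact_adj (j : J) :
    essentialOp Y P D.Tadj (P.d j) - Y.Tadj * Y.Φ (P.d j) ∈ compactOps B.carrier Y.E := by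
  have hΦ := Y.hasAdjoint_Φ (P.d j)
  rw [P.star_d] at hΦ
  have h1 := adjoint_mem_compactOps
    ((D.hasAdjoint_essentialOp_d j).sub (Y.hasAdjoint_T.mul hΦ)) (D.compact j)
  have h2 := Y.compact_commutator (P.d j)
  rw [P.grading_d] at h2
  have h3 := adjoint_mem_compactOps ((Y.hasAdjoint_T.mul hΦ).sub (hΦ.mul Y.hasAdjoint_T)) h2
  convert add_mem h1 h3 using 1
  abel

end DiagonalOperator

variable [Countable J]

variable (Y P) in
/-- The operator `(1 - Φ(c)) T (1 - Φ(c)) + T₀ Φ(2c - c²)`, where `c = ∑ⱼ rampⱼ(t) dⱼ`. It is `T` at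
`t = 0`, and tends to `T₀` as `t → 1`. -/
noncomputable def interp (T : Y.E →L[ℂ] Y.E)
    (T₀ : (Y.essential P).Elem →L[ℂ] (Y.essential P).Elem) (t : I) : Y.E →L[ℂ] Y.E :=
  (1 - Y.Φ (P.weight id t)) * T * (1 - Y.Φ (P.weight id t))
    + essentialOp Y P T₀ (P.weight (fun r => 2 * r - r * r) t)

variable (T : Y.E →L[ℂ] Y.E) (T₀ : (Y.essential P).Elem →L[ℂ] (Y.essential P).Elem)

theorem interp_zero : interp Y P T T₀ 0 = T := by
  rw [interp, P.weight_zero rfl, P.weight_zero (by simp)]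
  have : essentialOp Y P T₀ 0 = 0 := map_zero (essentialOpₗ Y P T₀)
  rw [this, map_zero]
  simp

theorem weight_quad_mem (r : ℝ) (hr : 0 ≤ r ∧ r ≤ 1) :
    0 ≤ 2 * r - r * r ∧ 2 * r - r * r ≤ 1 :=
  ⟨by nlinarith [hr.1, hr.2], by nlinarith [sq_nonneg (1 - r)]⟩

theorem norm_one_sub_weight_le {t : I} (ht : t < 1) : ‖1 - Y.Φ (P.weight id t)‖ ≤ 2 := by
  refine (norm_sub_le _ _).trans ?_
  have h1 : ‖(1 : Y.E →L[ℂ] Y.E)‖ ≤ 1 := ContinuousLinearMap.norm_id_le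
  have h2 := (Y.norm_Φ_le _).trans (P.norm_weight_le (φ := id) rfl (fun r hr => hr) ht)
  linarith

theorem norm_interp_le {t : I} (ht : t < 1) : ‖interp Y P T T₀ t‖ ≤ 4 * ‖T‖ + ‖T₀‖ := by
  refine (norm_add_le _ _).trans (add_le_add ?_ ?_)
  · refine (norm_mul_le _ _).trans ?_
    have h := norm_one_sub_weight_le (Y := Y) (P := P) ht
    calc _ ≤ ‖1 - Y.Φ (P.weight id t)‖ * ‖T‖ * ‖1 - Y.Φ (P.weight id t)‖ := by
          gcongr; exact norm_mul_le _ _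
      _ ≤ 2 * ‖T‖ * 2 := by gcongr
      _ = _ := by ring
  · exact (norm_essentialOp_le _ _).trans (mul_le_of_le_one_right (norm_nonneg _)
      (P.norm_weight_le (by simp) weight_quad_mem ht))

theorem continuousOn_interp : ContinuousOn (interp Y P T T₀) (Set.Iio 1) := by
  have h1 : ContinuousOn (fun t => 1 - Y.Φ (P.weight id t)) (Set.Iio 1) :=
    continuousOn_const.sub (Y.continuous_Φ.comp_continuousOn
      (P.continuousOn_weight (φ := id) rfl continuous_id))
  have h2 : ContinuousOn (fun t => essentialOp Y P T₀ (P.weight (fun r => 2 * r - r * r) t))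
      (Set.Iio 1) :=
    (continuous_essentialOp T₀).comp_continuousOn
      (P.continuousOn_weight (by simp) (by fun_prop))
  exact ((h1.mul continuousOn_const).mul h1).add h2

theorem hasAdjoint_interp (D : DiagonalOperator Y P) {t : I} (ht : t < 1) :
    HasAdjoint B.carrier (interp Y P Y.T D.T t) (interp Y P Y.Tadj D.Tadj t) := by
  have h1 : HasAdjoint B.carrier (1 - Y.Φ (P.weight id t)) (1 - Y.Φ (P.weight id t)) := by
    have := Y.hasAdjoint_Φ (P.weight id t)
    rw [P.star_weight rfl ht] at this
    exact HasAdjoint.one.sub this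
  refine HasAdjoint.add ?_ ?_
  · rw [mul_assoc (1 - Y.Φ (P.weight id t)) Y.Tadj]
    exact (h1.mul Y.hasAdjoint_T).mul h1
  · obtain ⟨F, -, hF⟩ := P.exists_weight_eq (φ := fun r => 2 * r - r * r) (by simp) ht
    rw [hF t le_rfl]
    change HasAdjoint B.carrier (essentialOpₗ Y P D.T _) (essentialOpₗ Y P D.Tadj _)
    rw [map_sum, map_sum]
    refine HasAdjoint.sum F fun j _ => ?_
    rw [map_smul, map_smul]
    have := (D.hasAdjoint_essentialOp_d j).smul
      ((2 * ramp ((nonempty_embedding_nat J).some j) t - ramp ((nonempty_embedding_nat J).some j) t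
        * ramp ((nonempty_embedding_nat J).some j) t : ℝ) : ℂ)
    rwa [Complex.star_def, Complex.conj_ofReal] at this

theorem gr_interp (D : DiagonalOperator Y P) {t : I} (ht : t < 1) (x : Y.E) :
    Y.gr (interp Y P Y.T D.T t x) = -interp Y P Y.T D.T t (Y.gr x) := by
  have h1 (x : Y.E) : Y.gr ((1 - Y.Φ (P.weight id t)) x) = (1 - Y.Φ (P.weight id t)) (Y.gr x) := by
    change Y.gr (x - Y.Φ (P.weight id t) x) = Y.gr x - Y.Φ (P.weight id t) (Y.gr x)
    rw [map_sub, Y.Φ_gr, P.grading_weight rfl ht]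
  set a := P.weight (fun r => 2 * r - r * r) t with ha
  have h2 : Y.gr (essentialOp Y P D.T a x) = -essentialOp Y P D.T a (Y.gr x) := by
    have h3 : (Y.essential P).gr (Y.essentialΦ P a x) = Y.essentialΦ P a (Y.gr x) := by
      refine HilbertSubmodule.ext ?_
      change Y.gr (Y.Φ a x) = Y.Φ a (Y.gr x)
      rw [Y.Φ_gr, ha, P.grading_weight (by simp) ht]
    change (Y.essential P).incl ((Y.essential P).gr (D.T (Y.essentialΦ P a x))) = _
    rw [D.T_gr, h3, map_neg]
    rfl
  change Y.gr ((1 - Y.Φ (P.weight id t)) (Y.T ((1 - Y.Φ (P.weight id t)) x))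
    + essentialOp Y P D.T a x) = -((1 - Y.Φ (P.weight id t)) (Y.T ((1 - Y.Φ (P.weight id t))
      (Y.gr x))) + essentialOp Y P D.T a (Y.gr x))
  rw [map_add, h1, h2, Y.T_gr, h1, map_neg, neg_add]

theorem interp_mul_Φ {t : I} (ht : t < 1) (j : J) :
    interp Y P T T₀ t * Y.Φ (P.d j)
      = (1 - (ramp ((nonempty_embedding_nat J).some j) t : ℂ)) •
          ((1 - Y.Φ (P.weight id t)) * (T * Y.Φ (P.d j)))
        + ((2 * ramp ((nonempty_embedding_nat J).some j) t
          - ramp ((nonempty_embedding_nat J).some j) t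
            * ramp ((nonempty_embedding_nat J).some j) t : ℝ) : ℂ) •
          essentialOp Y P T₀ (P.d j) := by
  have h1 : Y.Φ (P.weight id t) * Y.Φ (P.d j)
      = (ramp ((nonempty_embedding_nat J).some j) t : ℂ) • Y.Φ (P.d j) := by
    rw [← map_mul, P.weight_mul rfl ht, map_smul]
    rfl
  have h2 : essentialOp Y P T₀ (P.weight (fun r => 2 * r - r * r) t) * Y.Φ (P.d j) = _ :=
    (essentialOp_mul T₀ _ _).symm.trans (congrArg _ (P.weight_mul (by simp) ht j))
  rw [interp, add_mul, h2, mul_assoc, sub_mul 1 (Y.Φ (P.weight id t)) (Y.Φ (P.d j)), h1, one_mul]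
  congr 1
  · rw [mul_sub, mul_smul_comm, mul_assoc, sub_smul, one_smul]
  · exact map_smul (essentialOpₗ Y P T₀) _ _

/-- On a fixed projection the interpolating operators are eventually equal to `T₀`. This makes the
compact operators that occur in the homotopy constant near its end. -/
theorem interp_eventually (j : J) : ∀ᶠ t in nhdsWithin (1 : I) (Set.Iio 1),
    interp Y P T T₀ t * Y.Φ (P.d j) = essentialOp Y P T₀ (P.d j) := by
  filter_upwards [nhdsWithin_le_nhds (ramp_eventually ((nonempty_embedding_nat J).some j)),
    self_mem_nhdsWithin] with t h1 ht
  rw [interp_mul_Φ T T₀ ht, h1]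
  norm_num

/-- The interpolating operators differ from `T` on each projection by a compact operator. -/
theorem interp_sub_mem_compactOps (T : Y.E →L[ℂ] Y.E)
    (T₀ : (Y.essential P).Elem →L[ℂ] (Y.essential P).Elem) (j : J)
    (hc : T * Y.Φ (P.d j) - Y.Φ (P.d j) * T ∈ compactOps B.carrier Y.E)
    (h₀ : essentialOp Y P T₀ (P.d j) - T * Y.Φ (P.d j) ∈ compactOps B.carrier Y.E)
    {t : I} (ht : t < 1) :
    (interp Y P T T₀ t - T) * Y.Φ (P.d j) ∈ compactOps B.carrier Y.E := by
  have hΦ := Y.hasAdjoint_Φ (P.d j)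
  rw [P.star_d] at hΦ
  have hp : Y.Φ (P.d j) * Y.Φ (P.d j) = Y.Φ (P.d j) := by rw [← map_mul, P.mul_self]
  have hcp : Y.Φ (P.weight id t) * Y.Φ (P.d j)
      = (ramp ((nonempty_embedding_nat J).some j) t : ℂ) • Y.Φ (P.d j) := by
    rw [← map_mul, P.weight_mul rfl ht, map_smul]
    rfl
  have hb := (HasAdjoint.one (B := B.carrier)).sub (Y.hasAdjoint_Φ (P.weight id t))
  rw [sub_mul, interp_mul_Φ T T₀ ht]
  generalize ramp ((nonempty_embedding_nat J).some j) t = r at *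
  generalize Y.Φ (P.weight id t) = c at *
  generalize Y.Φ (P.d j) = p at *
  generalize essentialOp Y P T₀ (P.d j) = R at *
  -- `κ = (T p - p T) p` is the part of `T p` off the diagonal; the factor `1 - c` acts on the rest,
  -- `p T p`, by the scalar `1 - r`.
  have hκ : (T * p - p * T) * p ∈ compactOps B.carrier Y.E := mem_compactOps_mul hΦ hc
  have key : (1 - (r : ℂ)) • ((1 - c) * (T * p)) + ((2 * r - r * r : ℝ) : ℂ) • R - T * p
      = (1 - (r : ℂ)) • ((1 - c) * ((T * p - p * T) * p))
        - ((1 - (r : ℂ)) * (1 - r)) • ((T * p - p * T) * p)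
        + ((2 * r - r * r : ℝ) : ℂ) • (R - T * p) := by
    have e1 : (T * p - p * T) * p = T * p - p * (T * p) := by
      rw [sub_mul, mul_assoc, hp, mul_assoc]
    have e2 : (1 - c) * (p * (T * p)) = (1 - (r : ℂ)) • (p * (T * p)) := by
      rw [← mul_assoc, sub_mul, one_mul, hcp, sub_mul, smul_mul_assoc, sub_smul, one_smul]
    rw [e1, mul_sub, e2]
    push_cast
    module
  rw [key]
  exact add_mem (sub_mem (Submodule.smul_mem _ _ (mul_mem_compactOps hb hκ))
    (Submodule.smul_mem _ _ hκ)) (Submodule.smul_mem _ _ h₀)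

end KasparovCycle

/-! ### Compact perturbations of the operator of a cycle -/

namespace KasparovCycle

open unitInterval Filter

variable {G : Type v} [Group G] {A : GradedGAlgebra.{w} G} {B : GradedGAlgebra.{u} G}
variable {J : Type w'} {Y : KasparovCycle A B} {P : ProjectionFamily A J}

theorem hasAdjoint_Φ_d (Y : KasparovCycle A B) (P : ProjectionFamily A J) (j : J) :
    HasAdjoint B.carrier (Y.Φ (P.d j)) (Y.Φ (P.d j)) := by
  have := Y.hasAdjoint_Φ (P.d j)
  rwa [P.star_d] at this

theorem commutator_mem_compactOps (Y : KasparovCycle A B) (P : ProjectionFamily A J) (j : J) :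
    Y.T * Y.Φ (P.d j) - Y.Φ (P.d j) * Y.T ∈ compactOps B.carrier Y.E := by
  have := Y.compact_commutator (P.d j)
  rwa [P.grading_d] at this

/-- If `R` differs from `T` on each projection by a compact operator, and `R'` from `T*`, then
`R - R'` is compact on each projection. With `R'` the adjoint of `R`, the lemmas below show that `R`
satisfies the other conditions on the operator of a cycle as well. -/
theorem perturbed_sub_adj {R R' : Y.E →L[ℂ] Y.E}
    (h : ∀ j, (R - Y.T) * Y.Φ (P.d j) ∈ compactOps B.carrier Y.E)
    (h' : ∀ j, (R' - Y.Tadj) * Y.Φ (P.d j) ∈ compactOps B.carrier Y.E)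
    (j : J) : (R - R') * Y.Φ (P.d j) ∈ compactOps B.carrier Y.E := by
  convert add_mem (sub_mem (h j) (h' j)) (Y.compact_sub_adj (P.d j)) using 1
  noncomm_ring

/-- `Φ(d) R` and `Φ(d) T` differ by a compact operator: pass to adjoints. -/
theorem perturbed_left {R R' : Y.E →L[ℂ] Y.E}
    (hR : HasAdjoint B.carrier R R')
    (h' : ∀ j, (R' - Y.Tadj) * Y.Φ (P.d j) ∈ compactOps B.carrier Y.E)
    (j : J) : Y.Φ (P.d j) * (R - Y.T) ∈ compactOps B.carrier Y.E :=
  adjoint_mem_compactOps ((hR.symm.sub Y.hasAdjoint_T.symm).mul (Y.hasAdjoint_Φ_d P j)) (h' j)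

theorem perturbed_commutator {R R' : Y.E →L[ℂ] Y.E}
    (hR : HasAdjoint B.carrier R R')
    (h : ∀ j, (R - Y.T) * Y.Φ (P.d j) ∈ compactOps B.carrier Y.E)
    (h' : ∀ j, (R' - Y.Tadj) * Y.Φ (P.d j) ∈ compactOps B.carrier Y.E)
    (j : J) :
    R * Y.Φ (P.d j) - Y.Φ (P.d j) * R ∈ compactOps B.carrier Y.E := by
  convert add_mem (sub_mem (h j) (perturbed_left hR h' j)) (Y.commutator_mem_compactOps P j) using 1
  noncomm_ring

theorem perturbed_sq {R R' : Y.E →L[ℂ] Y.E}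
    (hR : HasAdjoint B.carrier R R')
    (h : ∀ j, (R - Y.T) * Y.Φ (P.d j) ∈ compactOps B.carrier Y.E)
    (j : J) : (R * R - 1) * Y.Φ (P.d j) ∈ compactOps B.carrier Y.E := by
  have h1 := mul_mem_compactOps hR (h j)
  have hc := Y.commutator_mem_compactOps P j
  have h2 := mul_mem_compactOps (hR.sub Y.hasAdjoint_T) hc
  have h3 := mem_compactOps_mul Y.hasAdjoint_T (h j)
  convert add_mem (add_mem (add_mem h1 h2) h3) (Y.compact_sq (P.d j)) using 1
  noncomm_ring

theorem perturbed_equivariance {R : Y.E →L[ℂ] Y.E}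
    (h : ∀ j, (R - Y.T) * Y.Φ (P.d j) ∈ compactOps B.carrier Y.E)
    (g : G) (j : J) :
    (Y.u g * R * Y.u g⁻¹ - R) * Y.Φ (P.d j) ∈ compactOps B.carrier Y.E := by
  have e : Y.u g⁻¹ * Y.Φ (P.d j) = Y.Φ (P.d (P.perm g⁻¹ j)) * Y.u g⁻¹ :=
    ContinuousLinearMap.ext fun x => by
      change Y.u g⁻¹ (Y.Φ (P.d j) x) = Y.Φ (P.d (P.perm g⁻¹ j)) (Y.u g⁻¹ x)
      rw [Y.Φ_u, P.act_d]
  have h1 := Y.conj_mem_compactOps g (h (P.perm g⁻¹ j))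
  have e2 : Y.u g * ((R - Y.T) * Y.Φ (P.d (P.perm g⁻¹ j))) * Y.u g⁻¹
      = Y.u g * (R - Y.T) * Y.u g⁻¹ * Y.Φ (P.d j) := by
    simp only [mul_assoc]
    rw [e]
  rw [e2] at h1
  convert add_mem (sub_mem h1 (h j)) (Y.compact_equivariance g (P.d j)) using 1
  noncomm_ring

/-! ### The mapping cylinder of the essential submodule -/

variable (Y P) in
/-- The paths in the module of a cycle that end in the essential submodule. -/
noncomputable def cylinder : InvariantSubmodule (Y.pathCycle Y.constData) where
  carrier := {f : Paths Y.E False | f.1 1 ∈ (Y.essential P).toSubmodule}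
  add_mem' hf hg := (Y.essential P).add_mem hf hg
  zero_mem' := (Y.essential P).zero_mem
  smul_mem' c _ hf := (Y.essential P).smul_mem c hf
  hsmul_mem _ hf b := (Y.essential P).hsmul_mem _ hf (B.evalAt 1 b)
  isClosed := (Y.essential P).isClosed.preimage
    ((continuous_eval_const (F := C(I, Y.E)) 1).comp continuous_subtype_val)
  gr_mem f hf := by
    have : (pathMap False 1 Y.gr f).1 1 = _ := pathMap_one_apply False Y.gr f 1
    exact (congrArg (· ∈ (Y.essential P).toSubmodule) this).mpr ((Y.essential P).gr_mem _ hf)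
  u_mem g f hf := by
    have : (pathMap False 1 (Y.u g) f).1 1 = _ := pathMap_one_apply False (Y.u g) f 1
    exact (congrArg (· ∈ (Y.essential P).toSubmodule) this).mpr ((Y.essential P).u_mem g _ hf)
  Φ_mem a f hf := by
    have : (pathMap False 1 (Y.Φ a) f).1 1 = _ := pathMap_one_apply False (Y.Φ a) f 1
    exact (congrArg (· ∈ (Y.essential P).toSubmodule) this).mpr ((Y.essential P).Φ_mem a _ hf)

namespace cylinder

/-- A path, as a continuous map. -/
def path (f : (Y.cylinder P).Elem) : C(I, Y.E) := (show Paths Y.E False from f.1).1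

theorem path_one_mem (f : (Y.cylinder P).Elem) : path f 1 ∈ (Y.essential P).toSubmodule := f.2

/-- A continuous map that ends in the essential submodule, as an element of the cylinder. -/
def ofPath (f : C(I, Y.E)) (h : f 1 ∈ (Y.essential P).toSubmodule) : (Y.cylinder P).Elem :=
  ⟨Paths.mk f False.elim, h⟩

theorem ext {f g : (Y.cylinder P).Elem} (h : ∀ t, path f t = path g t) : f = g :=
  Subtype.ext (Paths_ext h)

theorem path_add (f g : (Y.cylinder P).Elem) (t : I) : path (f + g) t = path f t + path g t := rfl

theorem path_smul (c : ℂ) (f : (Y.cylinder P).Elem) (t : I) : path (c • f) t = c • path f t := rfl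

theorem path_neg (f : (Y.cylinder P).Elem) (t : I) : path (-f) t = -path f t := rfl

theorem norm_path_apply_le (f : (Y.cylinder P).Elem) (t : I) : ‖path f t‖ ≤ ‖f‖ :=
  (path f).norm_coe_le_norm t

theorem path_gr (f : (Y.cylinder P).Elem) (t : I) :
    path ((Y.cylinder P).gr f) t = Y.gr (path f t) := pathMap_one_apply False Y.gr _ t

theorem path_u (g : G) (f : (Y.cylinder P).Elem) (t : I) :
    path ((Y.cylinder P).u g f) t = Y.u g (path f t) := pathMap_one_apply False (Y.u g) _ t

theorem path_Φ (a : A) (f : (Y.cylinder P).Elem) (t : I) :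
    path ((Y.cylinder P).Φ a f) t = Y.Φ a (path f t) := pathMap_one_apply False (Y.Φ a) _ t

/-- The endpoint of a path. -/
noncomputable def endpoint (f : (Y.cylinder P).Elem) : (Y.essential P).Elem :=
  (Y.essential P).elem (path f 1) (path_one_mem f)

theorem norm_le_of_path {f : (Y.cylinder P).Elem} {C : ℝ} (hC : 0 ≤ C) (h : ∀ t, ‖path f t‖ ≤ C) :
    ‖f‖ ≤ C := (ContinuousMap.norm_le _ hC).2 h

/-- An operator of the cylinder defined pointwise. -/
noncomputable def ofPointwise (L : (Y.cylinder P).Elem →ₗ[ℂ] (I → Y.E))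
    (hc : ∀ f, Continuous (L f)) (h1 : ∀ f, L f 1 ∈ (Y.essential P).toSubmodule) (C : ℝ)
    (hC0 : 0 ≤ C) (hC : ∀ f t, ‖L f t‖ ≤ C * ‖f‖) : (Y.cylinder P).Elem →L[ℂ] (Y.cylinder P).Elem :=
  LinearMap.mkContinuous
    { toFun := fun f => ofPath ⟨L f, hc f⟩ (h1 f)
      map_add' := fun f g => ext fun t => congrFun (map_add L f g) t
      map_smul' := fun c f => ext fun t => congrFun (map_smul L c f) t } C fun f =>
    norm_le_of_path (mul_nonneg hC0 (norm_nonneg f)) (hC f)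

/-- The operator of the cylinder that multiplies by a path of operators. -/
noncomputable def mulOp (k : C(I, Y.E →L[ℂ] Y.E))
    (hk : ∀ x ∈ (Y.essential P).toSubmodule, k 1 x ∈ (Y.essential P).toSubmodule) :
    (Y.cylinder P).Elem →L[ℂ] (Y.cylinder P).Elem :=
  ofPointwise
    { toFun := fun f t => k t (path f t)
      map_add' := fun _ _ => funext fun t => map_add (k t) _ _
      map_smul' := fun _ _ => funext fun t => map_smul (k t) _ _ }
    (fun f => k.continuous.clm_apply (path f).continuous) (fun f => hk _ (path_one_mem f))
    ‖k‖ (norm_nonneg k) fun f t => (k t).le_of_opNorm_le_of_le (k.norm_coe_le_norm t)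
      (norm_path_apply_le f t)

theorem path_mulOp (k : C(I, Y.E →L[ℂ] Y.E))
    (hk : ∀ x ∈ (Y.essential P).toSubmodule, k 1 x ∈ (Y.essential P).toSubmodule)
    (f : (Y.cylinder P).Elem) (t : I) : path (mulOp k hk f) t = k t (path f t) := rfl

theorem norm_mulOp_le (k : C(I, Y.E →L[ℂ] Y.E))
    (hk : ∀ x ∈ (Y.essential P).toSubmodule, k 1 x ∈ (Y.essential P).toSubmodule) :
    ‖mulOp k hk‖ ≤ ‖k‖ :=
  ContinuousLinearMap.opNorm_le_bound _ (norm_nonneg k) fun f =>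
    norm_le_of_path (by positivity) fun t =>
      (k t).le_of_opNorm_le_of_le (k.norm_coe_le_norm t) (norm_path_apply_le f t)

/-- Multiplication by `c(t) V κ V*` is compact on the cylinder if `κ` is compact and `c V` maps into
the cylinder. -/
theorem mulOp_conj_mem_compactOps (c : C(I, ℝ)) (hc : ∀ t, 0 ≤ c t) {V V' : Y.E →L[ℂ] Y.E}
    (hV : HasAdjoint B.carrier V V')
    (h1 : c 1 = 0 ∨ ∀ x, V x ∈ (Y.essential P).toSubmodule)
    {κ : Y.E →L[ℂ] Y.E} (hκ : κ ∈ compactOps B.carrier Y.E)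
    {k : C(I, Y.E →L[ℂ] Y.E)} (hk : ∀ t, k t = (c t : ℂ) • (V * κ * V'))
    (hk1 : ∀ x ∈ (Y.essential P).toSubmodule, k 1 x ∈ (Y.essential P).toSubmodule) :
    mulOp k hk1 ∈ compactOps B.path.carrier (Y.cylinder P).Elem := by
  have hmem (κ : Y.E →L[ℂ] Y.E) (x : Y.E) :
      ((c 1 : ℂ) • (V * κ * V')) x ∈ (Y.essential P).toSubmodule := by
    rcases h1 with h1 | h1
    · rw [h1, Complex.ofReal_zero, zero_smul]
      exact zero_mem _
    · exact Submodule.smul_mem _ _ (h1 _)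
  let K (κ : Y.E →L[ℂ] Y.E) : C(I, Y.E →L[ℂ] Y.E) :=
    ⟨fun t => (c t : ℂ) • (V * κ * V'), by fun_prop⟩
  let L : (Y.E →L[ℂ] Y.E) →ₗ[ℂ] ((Y.cylinder P).Elem →L[ℂ] (Y.cylinder P).Elem) :=
    { toFun := fun κ => mulOp (K κ) fun x _ => hmem κ x
      map_add' := fun κ κ' => ContinuousLinearMap.ext fun f => ext fun t => by
        change (c t : ℂ) • V ((κ + κ') (V' (path f t)))
          = (c t : ℂ) • V (κ (V' (path f t))) + (c t : ℂ) • V (κ' (V' (path f t)))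
        rw [← smul_add, ← map_add]
        rfl
      map_smul' := fun z κ => ContinuousLinearMap.ext fun f => ext fun t => by
        change (c t : ℂ) • V (z • κ (V' (path f t))) = z • (c t : ℂ) • V (κ (V' (path f t)))
        rw [map_smul, smul_comm] }
  have hL : Continuous L := by
    refine (L.mkContinuous (‖c‖ * (‖V‖ * ‖V'‖)) fun κ => ?_).continuous
    refine (norm_mulOp_le (K κ) fun x _ => hmem κ x).trans
      ((ContinuousMap.norm_le _ (by positivity)).2 fun t => ?_)
    change ‖(c t : ℂ) • (V * κ * V')‖ ≤ _
    rw [norm_smul]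
    calc _ ≤ ‖c‖ * (‖V‖ * ‖κ‖ * ‖V'‖) := by
          gcongr
          · simpa using c.norm_coe_le_norm t
          · exact (norm_mul_le _ _).trans (by gcongr; exact norm_mul_le _ _)
      _ = _ := by ring
  have hLk : mulOp k hk1 = L κ := ContinuousLinearMap.ext fun f => ext fun t => by
    rw [path_mulOp, hk]
    rfl
  rw [hLk]
  refine mem_compactOps_of_map (B := B.carrier) L hL (fun x y => ?_) hκ
  let q (x : Y.E) : (Y.cylinder P).Elem :=
    ofPath ⟨fun t => ((Real.sqrt (c t) : ℝ) : ℂ) • V x, by fun_prop⟩ (by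
      change ((Real.sqrt (c 1) : ℝ) : ℂ) • V x ∈ _
      rcases h1 with h1 | h1
      · rw [h1, Real.sqrt_zero, Complex.ofReal_zero, zero_smul]
        exact zero_mem _
      · exact Submodule.smul_mem _ _ (h1 x))
  have : L (rankOne B.carrier x y) = rankOne B.path.carrier (q x) (q y) := by
    refine ContinuousLinearMap.ext fun f => ext fun t => ?_
    change (c t : ℂ) • V (x <• hinner B.carrier y (V' (path f t)))
      = (((Real.sqrt (c t) : ℝ) : ℂ) • V x) <•
        hinner B.carrier (((Real.sqrt (c t) : ℝ) : ℂ) • V y) (path f t)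
    rw [hinner_csmul_left, hsmul_csmul, hsmul_csmul', smul_smul, ← Complex.ofReal_mul,
      Real.mul_self_sqrt (hc t), hV.map_hsmul, hV]
  rw [this]
  exact rankOne_mem _ _

instance neBot_nhdsLT_one : (nhdsWithin (1 : I) (Set.Iio 1)).NeBot :=
  nhdsLT_neBot_of_exists_lt ⟨0, zero_lt_one⟩

/-- An operator of the cylinder that multiplies by compact operators `k t`, constant for `t` near
`1` and there compressed by a projection `Φ(dⱼ)`, is compact. -/
theorem mem_compactOps {L : (Y.cylinder P).Elem →L[ℂ] (Y.cylinder P).Elem}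
    {k : I → Y.E →L[ℂ] Y.E} (hk : ContinuousOn k (Set.Iio 1))
    (hkK : ∀ t < 1, k t ∈ compactOps B.carrier Y.E)
    (hL : ∀ f, ∀ t < 1, path (L f) t = k t (path f t)) {κ : Y.E →L[ℂ] Y.E}
    (hev : ∀ᶠ t in nhdsWithin (1 : I) (Set.Iio 1), k t = κ) (j : J)
    (hκ : Y.Φ (P.d j) * κ * Y.Φ (P.d j) = κ) :
    L ∈ compactOps B.path.carrier (Y.cylinder P).Elem := by
  classical
  have hκK : κ ∈ compactOps B.carrier Y.E := by
    obtain ⟨t, h1, h2⟩ := (hev.and self_mem_nhdsWithin).exists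
    exact h1 ▸ hkK t h2
  have hκS (x : Y.E) : κ x ∈ (Y.essential P).toSubmodule := by
    rw [← hκ]
    exact Y.Φ_d_mem_essential P j _
  let k' : I → Y.E →L[ℂ] Y.E := fun t => if t < 1 then k t else κ
  have hk'1 : k' 1 = κ := if_neg (lt_irrefl _)
  have hk' : Continuous k' := by
    refine continuous_iff_continuousAt.2 fun t => ?_
    rcases (show t ≤ 1 from t.2.2).lt_or_eq with ht | rfl
    · refine (hk.continuousAt (Iio_mem_nhds ht)).congr ?_
      filter_upwards [gt_mem_nhds ht] with s hs
      exact (if_pos hs).symm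
    · refine (continuousAt_const (y := κ)).congr ?_
      filter_upwards [eventually_nhdsWithin_iff.1 hev] with s hs
      by_cases h : s < 1
      · exact ((if_pos h).trans (hs h)).symm
      · exact (if_neg h).symm
  have hk'K (t : I) : k' t ∈ compactOps B.carrier Y.E := by
    by_cases h : t < 1
    · exact (congrArg (· ∈ compactOps B.carrier Y.E) (if_pos h)).mpr (hkK t h)
    · exact (congrArg (· ∈ compactOps B.carrier Y.E) (if_neg h)).mpr hκK
  let kc : C(I, Y.E →L[ℂ] Y.E) := ⟨k', hk'⟩
  have hkc1 (x : Y.E) : kc 1 x ∈ (Y.essential P).toSubmodule := by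
    change k' 1 x ∈ _
    rw [hk'1]
    exact hκS x
  have hLk : L = mulOp kc fun x _ => hkc1 x := by
    refine ContinuousLinearMap.ext fun f => ext fun t => ?_
    have h (t : I) (ht : t < 1) : path (L f) t = k' t (path f t) :=
      (hL f t ht).trans (congrArg (fun k : Y.E →L[ℂ] Y.E => k (path f t))
        (show k t = k' t from (if_pos ht).symm))
    rcases (show t ≤ 1 from t.2.2).lt_or_eq with ht | rfl
    · exact h t ht
    · refine tendsto_nhds_unique (l := nhdsWithin (1 : I) (Set.Iio 1))
        (((path (L f)).continuous.tendsto 1).mono_left nhdsWithin_le_nhds) ?_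
      refine (((hk'.clm_apply (path f).continuous).tendsto 1).mono_left
        nhdsWithin_le_nhds).congr' ?_
      filter_upwards [self_mem_nhdsWithin] with t ht
      exact (h t ht).symm
  -- approximate the path of compact operators by its Bernstein polynomials; all terms but the last
  -- vanish at `1`, and the last one is a multiple of `κ`
  have happ (n : ℕ) : bernsteinApproximation (n + 1) kc 1 = κ :=
    (bernsteinApproximation.apply_one (Nat.succ_ne_zero n) kc).trans hk'1
  let b (n : ℕ) : (Y.cylinder P).Elem →L[ℂ] (Y.cylinder P).Elem :=
    mulOp (bernsteinApproximation (n + 1) kc) fun x _ => (happ n).symm ▸ hκS x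
  have hb : Tendsto b atTop (nhds L) := by
    have h0 := (bernsteinApproximation_uniform kc).comp (tendsto_add_atTop_nat 1)
    refine tendsto_iff_norm_sub_tendsto_zero.2 (squeeze_zero (fun _ => norm_nonneg _) (fun n => ?_)
      ((tendsto_iff_norm_sub_tendsto_zero (E := C(I, Y.E →L[ℂ] Y.E))
        (f := fun n => bernsteinApproximation (n + 1) kc) (b := kc)).1 h0))
    have : b n - L = mulOp (bernsteinApproximation (n + 1) kc - kc) fun x _ => by
        change (bernsteinApproximation (n + 1) kc 1 - kc 1) x ∈ _
        rw [happ n]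
        change (κ - k' 1) x ∈ _
        rw [hk'1, sub_self]
        exact zero_mem _ := by
      rw [hLk]
      exact ContinuousLinearMap.ext fun f => ext fun t => rfl
    rw [this]
    exact norm_mulOp_le _ _
  refine (Submodule.isClosed_topologicalClosure _).mem_of_tendsto hb
    (Eventually.of_forall fun n => ?_)
  let kt (i : Fin (n + 1 + 1)) : C(I, Y.E →L[ℂ] Y.E) :=
    ⟨fun t => (bernstein (n + 1) i t : ℂ) • kc (bernstein.z i), by fun_prop⟩
  have hb1 (i : Fin (n + 1 + 1)) (hi : i ≠ Fin.last (n + 1)) : bernstein (n + 1) i 1 = 0 := by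
    have hi' : (i : ℕ) < n + 1 := Fin.val_lt_last hi
    have e : n + 1 - (i : ℕ) ≠ 0 := by omega
    simp [bernstein_apply, e]
  have hlast : kc (bernstein.z (Fin.last (n + 1))) = κ := by
    rw [bernstein.z_last (Nat.succ_ne_zero n)]
    exact hk'1
  have hktm (i : Fin (n + 1 + 1)) (x : Y.E) : kt i 1 x ∈ (Y.essential P).toSubmodule := by
    change (bernstein (n + 1) i 1 : ℂ) • kc (bernstein.z i) x ∈ _
    by_cases hi : i = Fin.last (n + 1)
    · rw [hi, hlast]
      exact Submodule.smul_mem _ _ (hκS x)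
    · rw [hb1 i hi, Complex.ofReal_zero, zero_smul]
      exact zero_mem _
  have hsum : b n = ∑ i, mulOp (kt i) fun x _ => hktm i x := by
    refine ContinuousLinearMap.ext fun f => ext fun t => ?_
    let ev : (Y.cylinder P).Elem →ₗ[ℂ] Y.E :=
      { toFun := fun f => path f t, map_add' := fun _ _ => rfl, map_smul' := fun _ _ => rfl }
    change bernsteinApproximation (n + 1) kc t (path f t) = ev _
    rw [sum_apply, map_sum, bernsteinApproximation.apply, sum_apply]
    exact Finset.sum_congr rfl fun i _ => by
      change bernstein (n + 1) i t • kc (bernstein.z i) (path f t)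
        = (bernstein (n + 1) i t : ℂ) • kc (bernstein.z i) (path f t)
      simp
  rw [hsum]
  refine Submodule.sum_mem _ fun i _ => ?_
  by_cases hi : i = Fin.last (n + 1)
  · refine mulOp_conj_mem_compactOps (bernstein (n + 1) i) (fun t => bernstein_nonneg)
      (Y.hasAdjoint_Φ_d P j) (Or.inr (Y.Φ_d_mem_essential P j)) hκK (fun t => ?_) _
    change (bernstein (n + 1) i t : ℂ) • kc (bernstein.z i) = _
    rw [hκ, hi, hlast]
  · exact mulOp_conj_mem_compactOps (bernstein (n + 1) i) (fun t => bernstein_nonneg)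
      HasAdjoint.one (Or.inl (hb1 i hi)) (hk'K (bernstein.z i)) (fun t => by
        rw [one_mul, mul_one]; rfl) _

end cylinder

end KasparovCycle

/-! ### The homotopy on the mapping cylinder -/

namespace KasparovCycle

open unitInterval Filter

variable {G : Type v} [Group G] {A : GradedGAlgebra.{w} G} {B : GradedGAlgebra.{u} G}
variable {J : Type w'} {Y : KasparovCycle A B} {P : ProjectionFamily A J}

section

variable [Countable J]

open cylinder

/-- The interpolating operators converge strongly to `T₀` on the essential submodule: they are
uniformly bounded, and eventually equal to `T₀` on finite sums of elements of the ranges of the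
projections. -/
theorem tendsto_interp (T : Y.E →L[ℂ] Y.E)
    (T₀ : (Y.essential P).Elem →L[ℂ] (Y.essential P).Elem) (e : (Y.essential P).Elem) :
    Tendsto (fun t => interp Y P T T₀ t ((Y.essential P).incl e)) (nhdsWithin (1 : I) (Set.Iio 1))
      (nhds ((Y.essential P).incl (T₀ e))) := by
  refine Metric.tendsto_nhds.2 fun ε hε => ?_
  set C := 4 * ‖T‖ + ‖T₀‖ + 1
  have hC : 0 < C := by positivity
  have hs : HasSum (fun j => Y.Φ (P.d j) ((Y.essential P).incl e)) ((Y.essential P).incl e) := e.2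
  obtain ⟨F, hF⟩ := (Metric.tendsto_nhds.1 hs (ε / (2 * C)) (by positivity)).exists
  set e' : (Y.essential P).Elem := ∑ j ∈ F, Y.essentialΦ P (P.d j) ((Y.essential P).incl e)
  have he' : (Y.essential P).incl e' = ∑ j ∈ F, Y.Φ (P.d j) ((Y.essential P).incl e) := by
    rw [map_sum]
    rfl
  rw [← he', dist_eq_norm] at hF
  filter_upwards [(Filter.eventually_all_finset F).2 fun j _ => interp_eventually T T₀ j,
    self_mem_nhdsWithin] with t h1 ht
  have h2 : interp Y P T T₀ t ((Y.essential P).incl e') = (Y.essential P).incl (T₀ e') := by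
    rw [he', map_sum, map_sum, map_sum]
    exact Finset.sum_congr rfl fun j hj =>
      DFunLike.congr_fun (h1 j hj) ((Y.essential P).incl e)
  have h3 : ‖interp Y P T T₀ t ((Y.essential P).incl e - (Y.essential P).incl e')‖
      ≤ (4 * ‖T‖ + ‖T₀‖) * ‖(Y.essential P).incl e' - (Y.essential P).incl e‖ := by
    rw [norm_sub_rev ((Y.essential P).incl e') _]
    exact (interp Y P T T₀ t).le_of_opNorm_le (norm_interp_le T T₀ ht) _
  have h4 : ‖(Y.essential P).incl (T₀ (e' - e))‖
      ≤ ‖T₀‖ * ‖(Y.essential P).incl e' - (Y.essential P).incl e‖ := T₀.le_opNorm (e' - e)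
  have h5 : interp Y P T T₀ t ((Y.essential P).incl e) - (Y.essential P).incl (T₀ e)
      = interp Y P T T₀ t ((Y.essential P).incl e - (Y.essential P).incl e')
        + (Y.essential P).incl (T₀ (e' - e)) := by
    rw [map_sub, h2, map_sub, map_sub]
    abel
  rw [dist_eq_norm, h5]
  set δ := ‖(Y.essential P).incl e' - (Y.essential P).incl e‖
  have hδ : 0 ≤ δ := norm_nonneg _
  calc _ ≤ (4 * ‖T‖ + ‖T₀‖) * δ + ‖T₀‖ * δ := (norm_add_le _ _).trans (add_le_add h3 h4)
    _ ≤ 2 * C * δ := by nlinarith [norm_nonneg T, norm_nonneg T₀]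
    _ < 2 * C * (ε / (2 * C)) := by gcongr
    _ = ε := by field_simp

variable (P) in
open Classical in
/-- The operator of the cylinder given by the interpolating operators for `t < 1` and by `T₀` at
`t = 1`. -/
noncomputable def interpOp (T : Y.E →L[ℂ] Y.E)
    (T₀ : (Y.essential P).Elem →L[ℂ] (Y.essential P).Elem) :
    (Y.cylinder P).Elem →L[ℂ] (Y.cylinder P).Elem :=
  ofPointwise
    { toFun := fun f t => if t < 1 then interp Y P T T₀ t (path f t)
        else (Y.essential P).incl (T₀ (endpoint f))
      map_add' := fun f g => funext fun t => by
        by_cases h : t < 1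
        · simp only [Pi.add_apply, if_pos h]
          rw [path_add, map_add]
        · simp only [Pi.add_apply, if_neg h]
          rw [← map_add, ← map_add]
          rfl
      map_smul' := fun c f => funext fun t => by
        by_cases h : t < 1
        · simp only [Pi.smul_apply, if_pos h]
          rw [path_smul, map_smul]
          rfl
        · simp only [Pi.smul_apply, if_neg h]
          rw [RingHom.id_apply, ← map_smul, ← map_smul]
          rfl }
    (fun f => by
      refine continuous_iff_continuousAt.2 fun t => ?_
      rcases (show t ≤ 1 from t.2.2).lt_or_eq with ht | rfl
      · refine (((continuousOn_interp T T₀).continuousAt (Iio_mem_nhds ht)).clm_apply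
          (path f).continuous.continuousAt).congr ?_
        filter_upwards [gt_mem_nhds ht] with s hs
        exact (if_pos hs).symm
      · have h1 : Tendsto (fun t => interp Y P T T₀ t (path f t))
            (nhdsWithin (1 : I) (Set.Iio 1))
            (nhds ((Y.essential P).incl (T₀ (endpoint f)))) := by
          have h2 := tendsto_interp T T₀ (endpoint f)
          have h3 : Tendsto (fun t => interp Y P T T₀ t (path f t - path f 1))
              (nhdsWithin (1 : I) (Set.Iio 1)) (nhds 0) := by
            have h4 : Tendsto (fun t => (4 * ‖T‖ + ‖T₀‖) * ‖path f t - path f 1‖)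
                (nhdsWithin (1 : I) (Set.Iio 1)) (nhds 0) := by
              have h5 : Continuous fun t => (4 * ‖T‖ + ‖T₀‖) * ‖path f t - path f 1‖ := by fun_prop
              have h6 := (h5.tendsto 1).mono_left (nhdsWithin_le_nhds (s := Set.Iio 1))
              rwa [sub_self, norm_zero, mul_zero] at h6
            refine squeeze_zero_norm' ?_ h4
            filter_upwards [self_mem_nhdsWithin] with t ht
            exact (interp Y P T T₀ t).le_of_opNorm_le (norm_interp_le T T₀ ht) _
          have h7 := h3.add h2
          rw [zero_add] at h7
          refine h7.congr fun t => ?_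
          rw [map_sub]
          exact sub_add_cancel _ _
        suffices h : Tendsto (fun t : I => if t < 1 then interp Y P T T₀ t (path f t)
            else (Y.essential P).incl (T₀ (endpoint f))) (nhds 1)
            (nhds ((Y.essential P).incl (T₀ (endpoint f)))) from
          (congrArg (fun z => Tendsto _ (nhds (1 : I)) (nhds z)) (if_neg (lt_irrefl (1 : I)))).mpr h
        refine Metric.tendsto_nhds.2 fun ε hε => ?_
        filter_upwards [eventually_nhdsWithin_iff.1 (Metric.tendsto_nhds.1 h1 ε hε)] with s hs
        by_cases h : s < 1
        · rw [if_pos h]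
          exact hs h
        · rw [if_neg h, dist_self]
          exact hε)
    (fun f => by
      change (if (1 : I) < 1 then _ else (Y.essential P).incl (T₀ (endpoint f)))
        ∈ (Y.essential P).toSubmodule
      rw [if_neg (lt_irrefl _)]
      exact HilbertSubmodule.incl_mem _)
    (4 * ‖T‖ + ‖T₀‖) (by positivity) fun f t => by
      change ‖if t < 1 then _ else (Y.essential P).incl (T₀ (endpoint f))‖ ≤ _
      split_ifs with h
      · exact (interp Y P T T₀ t).le_of_opNorm_le_of_le (norm_interp_le T T₀ h)
          (norm_path_apply_le f t)
      · refine (T₀.le_opNorm (endpoint f)).trans ?_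
        refine mul_le_mul ?_ (norm_path_apply_le f 1) (norm_nonneg _) (by positivity)
        linarith [norm_nonneg T]

theorem path_interpOp (T : Y.E →L[ℂ] Y.E)
    (T₀ : (Y.essential P).Elem →L[ℂ] (Y.essential P).Elem) (f : (Y.cylinder P).Elem) {t : I}
    (ht : t < 1) : path (interpOp P T T₀ f) t = interp Y P T T₀ t (path f t) := if_pos ht

theorem endpoint_interpOp (T : Y.E →L[ℂ] Y.E)
    (T₀ : (Y.essential P).Elem →L[ℂ] (Y.essential P).Elem) (f : (Y.cylinder P).Elem) :
    endpoint (interpOp P T T₀ f) = T₀ (endpoint f) :=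
  HilbertSubmodule.ext (if_neg (lt_irrefl _))

/-- Two elements of the cylinder are equal if they have the same values for `t < 1` and the same
endpoint. -/
theorem cylinder.ext_of_lt {f g : (Y.cylinder P).Elem} (h : ∀ t < 1, path f t = path g t)
    (h1 : endpoint f = endpoint g) : f = g :=
  ext fun t => by
    rcases (show t ≤ 1 from t.2.2).lt_or_eq with ht | rfl
    · exact h t ht
    · exact congrArg (Y.essential P).incl h1

end

/-- A closed subspace of `F` contains the image of a Hilbert module `E` if it contains the images of
the products of generators of `E` with scalars. -/
theorem mem_topologicalClosure_of_generators {B : Type u} [NonUnitalCStarAlgebra B]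
    {E : Type w} [NormedAddCommGroup E] [NormedSpace ℂ E] [SMul Bᵐᵒᵖ E]
    {F : Type w'} [NormedAddCommGroup F] [NormedSpace ℂ F] (i : E →L[ℂ] F) {s : Set E}
    (hd : Dense (Submodule.span ℂ {z : E | ∃ x ∈ s, ∃ b : B, z = x <• b} : Set E))
    {M : Submodule ℂ F} (h : ∀ x ∈ s, ∀ b : B, i (x <• b) ∈ M.topologicalClosure) (x : E) :
    i x ∈ M.topologicalClosure := by
  have hcl : IsClosed (M.topologicalClosure.comap i.toLinearMap : Set E) :=
    (Submodule.isClosed_topologicalClosure _).preimage i.continuous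
  refine hcl.closure_subset_iff.2 (Submodule.span_le.2 ?_) (hd x)
  rintro _ ⟨x, hx, b, rfl⟩
  exact h x hx b

open cylinder in
/-- A path is the sum of a path that ends at `0` and the constant path at its endpoint. -/
theorem isCountablyGenerated_cylinder
    (h : IsCountablyGenerated B.carrier (Y.essential P).Elem) :
    IsCountablyGenerated B.path.carrier (Y.cylinder P).Elem := by
  obtain ⟨s, hs, hsd⟩ := isCountablyGenerated_Paths (B := B.carrier) True Y.countablyGenerated
  obtain ⟨s', hs', hsd'⟩ := h
  let i : Paths Y.E True →L[ℂ] (Y.cylinder P).Elem := LinearMap.mkContinuous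
    { toFun := fun f => ofPath f.1 (by rw [f.2 trivial]; exact zero_mem _)
      map_add' := fun _ _ => rfl
      map_smul' := fun _ _ => rfl } 1 fun f => by
        rw [one_mul]
        exact le_rfl
  let i' : (Y.essential P).Elem →L[ℂ] (Y.cylinder P).Elem := LinearMap.mkContinuous
    { toFun := fun e => ofPath (ContinuousMap.const I ((Y.essential P).incl e))
        (HilbertSubmodule.incl_mem e)
      map_add' := fun _ _ => rfl
      map_smul' := fun _ _ => rfl } 1 fun e => by
        rw [one_mul]
        exact norm_le_of_path (norm_nonneg e) fun t => le_rfl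
  refine ⟨i '' s ∪ i' '' s', (hs.image _).union (hs'.image _), fun f => ?_⟩
  set M := Submodule.span ℂ
    {z : (Y.cylinder P).Elem | ∃ x ∈ i '' s ∪ i' '' s', ∃ b : B.path, z = x <• b}
  have h1 : ∀ x, i x ∈ M.topologicalClosure :=
    mem_topologicalClosure_of_generators i hsd fun x hx b =>
      Submodule.le_topologicalClosure _ (Submodule.subset_span ⟨i x, Or.inl ⟨x, hx, rfl⟩, b, rfl⟩)
  have h2 : ∀ x, i' x ∈ M.topologicalClosure :=
    mem_topologicalClosure_of_generators i' hsd' fun x hx b =>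
      Submodule.le_topologicalClosure _ (Submodule.subset_span
        ⟨i' x, Or.inr ⟨x, hx, rfl⟩, ContinuousMap.const I b, rfl⟩)
  have hf : f = i (Paths.mk (path f - ContinuousMap.const I (path f 1)) fun _ => sub_self _)
      + i' (endpoint f) := ext fun t => (sub_add_cancel (path f t) (path f 1)).symm
  rw [hf]
  exact add_mem (h1 _) (h2 _)

namespace DiagonalOperator

variable (D : DiagonalOperator Y P)

theorem essentialOp_d_eq (j : J) :
    Y.Φ (P.d j) * essentialOp Y P D.T (P.d j) = essentialOp Y P D.T (P.d j) :=
  ContinuousLinearMap.ext fun x => by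
    have e : (Y.essential P).Φ (P.d j) (Y.essentialΦ P (P.d j) x) = Y.essentialΦ P (P.d j) x := by
      refine HilbertSubmodule.ext ?_
      change Y.Φ (P.d j) (Y.Φ (P.d j) x) = Y.Φ (P.d j) x
      rw [← Y.Φ_mul_apply, P.mul_self]
    change (Y.essential P).incl ((Y.essential P).Φ (P.d j) (D.T (Y.essentialΦ P (P.d j) x)))
      = (Y.essential P).incl (D.T (Y.essentialΦ P (P.d j) x))
    rw [← D.T_Φ, e]

theorem essentialOp_d_mul (T₀ : (Y.essential P).Elem →L[ℂ] (Y.essential P).Elem) (j : J) :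
    essentialOp Y P T₀ (P.d j) * Y.Φ (P.d j) = essentialOp Y P T₀ (P.d j) := by
  rw [← essentialOp_mul, P.mul_self]

theorem essentialOp_adj_d_eq (j : J) :
    Y.Φ (P.d j) * essentialOp Y P D.Tadj (P.d j) = essentialOp Y P D.Tadj (P.d j) := by
  have h := D.hasAdjoint_essentialOp_d j
  have h2 := h.mul (Y.hasAdjoint_Φ_d P j)
  rw [essentialOp_d_mul] at h2
  exact h2.unique h

variable [Countable J]

open cylinder

theorem hasAdjoint_interpOp :
    HasAdjoint B.path.carrier (interpOp P Y.T D.T) (interpOp P Y.Tadj D.Tadj) := fun f g => by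
  refine ContinuousMap.ext fun t => ?_
  change hinner B.carrier (path (interpOp P Y.T D.T f) t) (path g t)
    = hinner B.carrier (path f t) (path (interpOp P Y.Tadj D.Tadj g) t)
  rcases (show t ≤ 1 from t.2.2).lt_or_eq with ht | rfl
  · rw [path_interpOp _ _ _ ht, path_interpOp _ _ _ ht]
    exact hasAdjoint_interp D ht _ _
  · have h := D.adjoint (endpoint f) (endpoint g)
    rw [← endpoint_interpOp Y.T, ← endpoint_interpOp Y.Tadj] at h
    exact h

/-- The adjoint form of `interp_eventually`. -/
theorem interp_commutator_eventually (j : J) : ∀ᶠ t in nhdsWithin (1 : I) (Set.Iio 1),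
    Y.Φ (P.d j) * interp Y P Y.T D.T t = essentialOp Y P D.T (P.d j) := by
  filter_upwards [interp_eventually (P := P) Y.Tadj D.Tadj j, self_mem_nhdsWithin] with t h1 ht
  have h2 := (Y.hasAdjoint_Φ_d P j).mul (hasAdjoint_interp D ht)
  rw [h1] at h2
  exact h2.symm.unique (D.hasAdjoint_essentialOp_d j).symm

theorem conj_essentialOp (g : G) (j : J) :
    Y.u g * essentialOp Y P D.T (P.d (P.perm g⁻¹ j)) * Y.u g⁻¹ = essentialOp Y P D.T (P.d j) :=
  ContinuousLinearMap.ext fun x => by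
    change (Y.essential P).incl ((Y.essential P).u g (D.T (Y.essentialΦ P _ (Y.u g⁻¹ x)))) = _
    rw [D.T_u]
    have : (Y.essential P).u g (Y.essentialΦ P (P.d (P.perm g⁻¹ j)) (Y.u g⁻¹ x))
        = Y.essentialΦ P (P.d j) x := by
      refine HilbertSubmodule.ext ?_
      change Y.u g (Y.Φ _ (Y.u g⁻¹ x)) = Y.Φ _ x
      rw [Y.Φ_u, Y.u_u_inv, ← P.act_d, A.act_act_inv]
    rw [this]
    rfl

/-- The homotopy from a cycle to the cycle on its essential submodule with a diagonal operator. -/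
noncomputable def homotopy (hcg : IsCountablyGenerated B.carrier (Y.essential P).Elem) :
    KasparovCycle A B.path :=
  have hd {t : I} (ht : t < 1) (j : J) :
      (interp Y P Y.T D.T t - Y.T) * Y.Φ (P.d j) ∈ compactOps B.carrier Y.E :=
    interp_sub_mem_compactOps _ _ j (Y.commutator_mem_compactOps P j) (D.compact j) ht
  have hd' {t : I} (ht : t < 1) (j : J) :
      (interp Y P Y.Tadj D.Tadj t - Y.Tadj) * Y.Φ (P.d j) ∈ compactOps B.carrier Y.E := by
    refine interp_sub_mem_compactOps _ _ j ?_ (D.compact_adj j) ht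
    have h := adjoint_mem_compactOps ((Y.hasAdjoint_T.mul (Y.hasAdjoint_Φ_d P j)).sub
      ((Y.hasAdjoint_Φ_d P j).mul Y.hasAdjoint_T)) (Y.commutator_mem_compactOps P j)
    rw [← neg_sub]
    exact neg_mem h
  have hR := continuousOn_interp (P := P) Y.T D.T
  have hR' := continuousOn_interp (P := P) Y.Tadj D.Tadj
  (Y.cylinder P).cycleOfProjections P (isCountablyGenerated_cylinder hcg)
    (interpOp P Y.T D.T) (interpOp P Y.Tadj D.Tadj) D.hasAdjoint_interpOp
    (fun f => ext_of_lt
      (fun t ht => by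
        rw [path_gr, path_interpOp _ _ _ ht, path_neg, path_interpOp _ _ _ ht, path_gr]
        exact gr_interp D ht _)
      (by
        have h1 (f : (Y.cylinder P).Elem) :
            endpoint ((Y.cylinder P).gr f) = (Y.essential P).gr (endpoint f) :=
          HilbertSubmodule.ext (path_gr f 1)
        have h2 (f : (Y.cylinder P).Elem) : endpoint (-f) = -endpoint f := rfl
        rw [h1, h2, endpoint_interpOp, endpoint_interpOp, h1]
        exact D.T_gr _))
    (fun j => mem_compactOps
      (k := fun t => (interp Y P Y.T D.T t - interp Y P Y.Tadj D.Tadj t) * Y.Φ (P.d j))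
      ((hR.sub hR').mul continuousOn_const)
      (fun t ht => perturbed_sub_adj (hd ht) (hd' ht) j)
      (fun f t ht =>
        (congrArg₂ (· - ·) (path_interpOp _ _ _ ht) (path_interpOp _ _ _ ht)).trans
          (congrArg (fun x => interp Y P Y.T D.T t x - interp Y P Y.Tadj D.Tadj t x)
            (path_Φ (P.d j) f t)))
      (κ := essentialOp Y P D.T (P.d j) - essentialOp Y P D.Tadj (P.d j))
      (by
        filter_upwards [interp_eventually (P := P) Y.T D.T j,
          interp_eventually (P := P) Y.Tadj D.Tadj j] with t h1 h2
        rw [sub_mul, h1, h2])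
      j (by
        rw [mul_sub, D.essentialOp_d_eq, D.essentialOp_adj_d_eq, sub_mul, essentialOp_d_mul,
          essentialOp_d_mul]))
    (fun j => mem_compactOps
      (k := fun t => (interp Y P Y.T D.T t * interp Y P Y.T D.T t - 1) * Y.Φ (P.d j))
      (((hR.mul hR).sub continuousOn_const).mul continuousOn_const)
      (fun t ht => perturbed_sq (hasAdjoint_interp D ht) (hd ht) j)
      (fun f t ht =>
        (congrArg (· - path ((Y.cylinder P).Φ (P.d j) f) t) ((path_interpOp _ _ _ ht).trans
          (congrArg (interp Y P Y.T D.T t) (path_interpOp _ _ _ ht)))).trans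
          (congrArg (fun x => interp Y P Y.T D.T t (interp Y P Y.T D.T t x) - x)
            (path_Φ (P.d j) f t)))
      (κ := essentialOp Y P D.T (P.d j) * essentialOp Y P D.T (P.d j) - Y.Φ (P.d j))
      (by
        filter_upwards [interp_eventually (P := P) Y.T D.T j] with t h1
        rw [sub_mul, mul_assoc, h1, one_mul, ← D.essentialOp_d_eq, ← mul_assoc, h1,
          D.essentialOp_d_eq])
      j (by
        have hp : Y.Φ (P.d j) * Y.Φ (P.d j) = Y.Φ (P.d j) := by rw [← map_mul, P.mul_self]
        rw [mul_sub, sub_mul, ← mul_assoc, D.essentialOp_d_eq, mul_assoc, essentialOp_d_mul,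
          hp, hp]))
    (fun g j => mem_compactOps
      (k := fun t => (Y.u g * interp Y P Y.T D.T t * Y.u g⁻¹ - interp Y P Y.T D.T t) * Y.Φ (P.d j))
      ((((continuousOn_const.mul hR).mul continuousOn_const).sub hR).mul continuousOn_const)
      (fun t ht => perturbed_equivariance (hd ht) g j)
      (fun f t ht => by
        have e (x : (Y.cylinder P).Elem) :
            path ((Y.cylinder P).u g (interpOp P Y.T D.T ((Y.cylinder P).u g⁻¹ x))) t
              = Y.u g (interp Y P Y.T D.T t (Y.u g⁻¹ (path x t))) := by
          rw [path_u, path_interpOp _ _ _ ht, path_u]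
        exact (congrArg₂ (· - ·) (e _) (path_interpOp _ _ _ ht)).trans
          (congrArg (fun x => Y.u g (interp Y P Y.T D.T t (Y.u g⁻¹ x)) - interp Y P Y.T D.T t x)
            (path_Φ (P.d j) f t)))
      (κ := 0)
      (by
        filter_upwards [interp_eventually (P := P) Y.T D.T j,
          interp_eventually (P := P) Y.T D.T (P.perm g⁻¹ j)] with t h1 h2
        have e : Y.u g⁻¹ * Y.Φ (P.d j) = Y.Φ (P.d (P.perm g⁻¹ j)) * Y.u g⁻¹ :=
          ContinuousLinearMap.ext fun x => by
            change Y.u g⁻¹ (Y.Φ (P.d j) x) = Y.Φ (P.d (P.perm g⁻¹ j)) (Y.u g⁻¹ x)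
            rw [Y.Φ_u, P.act_d]
        rw [sub_mul, h1, mul_assoc, e, mul_assoc, ← mul_assoc (interp Y P Y.T D.T t), h2,
          ← mul_assoc, D.conj_essentialOp, sub_self])
      j (by rw [mul_zero, zero_mul]))
    (fun j => mem_compactOps
      (k := fun t => interp Y P Y.T D.T t * Y.Φ (P.d j) - Y.Φ (P.d j) * interp Y P Y.T D.T t)
      ((hR.mul continuousOn_const).sub (continuousOn_const.mul hR))
      (fun t ht => perturbed_commutator (hasAdjoint_interp D ht) (hd ht) (hd' ht) j)
      (fun f t ht =>
        congrArg₂ (· - ·)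
          ((path_interpOp _ _ _ ht).trans (congrArg (interp Y P Y.T D.T t) (path_Φ (P.d j) f t)))
          ((path_Φ (P.d j) _ t).trans (congrArg (Y.Φ (P.d j)) (path_interpOp _ _ _ ht))))
      (κ := 0)
      (by
        filter_upwards [interp_eventually (P := P) Y.T D.T j,
          D.interp_commutator_eventually j] with t h1 h2
        rw [h1, h2, sub_self])
      j (by rw [mul_zero, zero_mul]))

end DiagonalOperator

end KasparovCycle

/-! ### Unitary equivalences and homotopies to the essential submodule -/

section Unitary

variable {B : Type u} [NonUnitalCStarAlgebra B] [PartialOrder Bᵐᵒᵖ] [StarOrderedRing Bᵐᵒᵖ]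
variable {E : Type w} [NormedAddCommGroup E] [NormedSpace ℂ E] [SMul Bᵐᵒᵖ E] [CStarModule Bᵐᵒᵖ E]
variable {F : Type w'} [NormedAddCommGroup F] [NormedSpace ℂ F] [SMul Bᵐᵒᵖ F] [CStarModule Bᵐᵒᵖ F]

variable (B) in
/-- A linear map that preserves the inner products of Hilbert `B`-modules is an isometry. -/
noncomputable def isometryOfInner (q : E →ₗ[ℂ] F)
    (h : ∀ x y, hinner B (q x) (q y) = hinner B x y) : E →ₗᵢ[ℂ] F where
  toLinearMap := q
  norm_map' x := by
    have := congrArg norm (h x x)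
    rw [norm_hinner_self, norm_hinner_self] at this
    exact (sq_eq_sq₀ (norm_nonneg _) (norm_nonneg _)).1 this

variable (B) in
/-- A surjective linear map that preserves the inner products of Hilbert `B`-modules is unitary. -/
noncomputable def unitaryOfInner (q : E →ₗ[ℂ] F) (hs : Function.Surjective q)
    (h : ∀ x y, hinner B (q x) (q y) = hinner B x y) : E ≃ₗᵢ[ℂ] F :=
  LinearIsometryEquiv.ofSurjective (isometryOfInner B q h) hs

theorem map_hsmul_of_inner (q : E →ₗ[ℂ] F) (hs : Function.Surjective q)
    (h : ∀ x y, hinner B (q x) (q y) = hinner B x y) (x : E) (b : B) : q (x <• b) = q x <• b := by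
  refine hinner_ext (B := B) fun z => ?_
  obtain ⟨z, rfl⟩ := hs z
  rw [h, hinner_smul, hinner_smul, h]

theorem IsCountablyGenerated.of_surjective (hE : IsCountablyGenerated B E) (q : E →L[ℂ] F)
    (hs : Function.Surjective q) (hq : ∀ (x : E) (b : B), q (x <• b) = q x <• b) :
    IsCountablyGenerated B F := by
  obtain ⟨s, hs', hd⟩ := hE
  refine ⟨q '' s, hs'.image _, fun y => ?_⟩
  obtain ⟨x, rfl⟩ := hs y
  exact KasparovCycle.mem_topologicalClosure_of_generators q hd
    (M := Submodule.span ℂ {z : F | ∃ y ∈ q '' s, ∃ b : B, z = y <• b})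
    (fun x hx b => Submodule.le_topologicalClosure _
      (Submodule.subset_span ⟨q x, ⟨x, hx, rfl⟩, b, hq x b⟩)) x

end Unitary

namespace KasparovCycle

open unitInterval Filter cylinder

variable {G : Type v} [Group G] {A : GradedGAlgebra.{w} G} {B : GradedGAlgebra.{u} G}
variable {J : Type w'} [Countable J] {Y Y' : KasparovCycle A B} {P : ProjectionFamily A J}

theorem DiagonalOperator.isEvaluation_zero (D : DiagonalOperator Y P)
    (hcg : IsCountablyGenerated B.carrier (Y.essential P).Elem) :
    IsEvaluation 0 (D.homotopy hcg) Y := by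
  refine ⟨{ toFun := fun f => path (Y := Y) (P := P) f 0
            map_add' := fun _ _ => rfl
            map_smul' := fun _ _ => rfl }, fun x => ?_, fun _ _ => rfl, fun _ _ => rfl,
    fun f => path_gr f 0, fun g f => path_u g f 0, fun a f => path_Φ a f 0, fun f => ?_⟩
  · refine ⟨ofPath (P := P) ⟨fun t => ((1 - (t : ℝ) : ℝ) : ℂ) • x, by fun_prop⟩ ?_, ?_⟩
    · change ((1 - ((1 : I) : ℝ) : ℝ) : ℂ) • x ∈ _
      rw [show ((1 - ((1 : I) : ℝ) : ℝ) : ℂ) = 0 by simp, zero_smul]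
      exact zero_mem _
    · change ((1 - ((0 : I) : ℝ) : ℝ) : ℂ) • x = x
      simp
  · exact (path_interpOp Y.T D.T f (zero_lt_one : (0 : I) < 1)).trans
      (congrArg (fun S : Y.E →L[ℂ] Y.E => S (path (Y := Y) (P := P) f 0)) (interp_zero Y.T D.T))

theorem DiagonalOperator.isEvaluation_one (D : DiagonalOperator Y P)
    (hcg : IsCountablyGenerated B.carrier (Y.essential P).Elem)
    (q : (Y.essential P).Elem →ₗ[ℂ] Y'.E) (hs : Function.Surjective q)
    (hin : ∀ x y, hinner B.carrier (q x) (q y) = hinner B.carrier x y)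
    (hgr : ∀ x, q ((Y.essential P).gr x) = Y'.gr (q x))
    (hu : ∀ g x, q ((Y.essential P).u g x) = Y'.u g (q x))
    (hΦ : ∀ a x, q ((Y.essential P).Φ a x) = Y'.Φ a (q x))
    (hT : ∀ x, q (D.T x) = Y'.T (q x)) :
    IsEvaluation 1 (D.homotopy hcg) Y' := by
  refine ⟨{ toFun := fun f => q (endpoint (Y := Y) (P := P) f)
            map_add' := fun f g => map_add q (endpoint (Y := Y) (P := P) f) (endpoint g)
            map_smul' := fun c f => map_smul q c (endpoint (Y := Y) (P := P) f) },
    fun y => ?_, fun f g => hin _ _,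
    fun f b => map_hsmul_of_inner q hs hin (endpoint (Y := Y) (P := P) f) (B.evalAt 1 b),
    fun f => ?_, fun g f => ?_, fun a f => ?_, fun f => ?_⟩
  · obtain ⟨e, rfl⟩ := hs y
    exact ⟨ofPath (ContinuousMap.const I ((Y.essential P).incl e))
      (HilbertSubmodule.incl_mem e), rfl⟩
  · exact (congrArg q (HilbertSubmodule.ext (path_gr f 1))).trans (hgr (endpoint f))
  · exact (congrArg q (HilbertSubmodule.ext (path_u g f 1))).trans (hu g (endpoint f))
  · exact (congrArg q (HilbertSubmodule.ext (path_Φ a f 1))).trans (hΦ a (endpoint f))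
  · exact (congrArg q (endpoint_interpOp Y.T D.T f)).trans (hT (endpoint f))

/-- A cycle is homotopic to any cycle that lives on its essential submodule, provided that the
operator of the latter commutes with the group and the algebra and that the two operators differ by
compact operators on each projection. -/
theorem homotopic_of_essential (q : (Y.essential P).Elem →ₗ[ℂ] Y'.E) (hs : Function.Surjective q)
    (hin : ∀ x y, hinner B.carrier (q x) (q y) = hinner B.carrier x y)
    (hgr : ∀ x, q ((Y.essential P).gr x) = Y'.gr (q x))
    (hu : ∀ g x, q ((Y.essential P).u g x) = Y'.u g (q x))
    (hΦ : ∀ a x, q ((Y.essential P).Φ a x) = Y'.Φ a (q x))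
    (hTu : ∀ g x, Y'.T (Y'.u g x) = Y'.u g (Y'.T x))
    (hTΦ : ∀ a x, Y'.T (Y'.Φ a x) = Y'.Φ a (Y'.T x))
    (hc : ∀ j, ∃ R : Y.E →L[ℂ] Y.E, R - Y.T * Y.Φ (P.d j) ∈ compactOps B.carrier Y.E ∧
      ∀ x, ∃ h : R x ∈ (Y.essential P).toSubmodule,
        q ((Y.essential P).elem (R x) h) = Y'.T (q (Y.essentialΦ P (P.d j) x))) :
    Homotopic Y Y' := by
  let Q := unitaryOfInner B.carrier q hs hin
  have hQ (x) : Q x = q x := rfl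
  let conj (S : Y'.E →L[ℂ] Y'.E) : (Y.essential P).Elem →L[ℂ] (Y.essential P).Elem :=
    (Q.symm.toContinuousLinearEquiv : Y'.E →L[ℂ] (Y.essential P).Elem).comp
      (S.comp (Q.toContinuousLinearEquiv : (Y.essential P).Elem →L[ℂ] Y'.E))
  have hconj (S x) : q (conj S x) = S (q x) := Q.apply_symm_apply _
  have hinj : Function.Injective q := Q.injective
  have hcg : IsCountablyGenerated B.carrier (Y.essential P).Elem :=
    Y'.countablyGenerated.of_surjective
      (Q.symm.toContinuousLinearEquiv : Y'.E →L[ℂ] (Y.essential P).Elem) Q.symm.surjective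
      fun x b => hinj <| by
        rw [map_hsmul_of_inner q hs hin]
        exact (Q.apply_symm_apply _).trans (congrArg (· <• b) (Q.apply_symm_apply x).symm)
  let D : DiagonalOperator Y P :=
    { T := conj Y'.T
      Tadj := conj Y'.Tadj
      adjoint := fun x y => by rw [← hin, ← hin, hconj, hconj, Y'.T_adjoint]
      T_gr := fun x => hinj <| by rw [hgr, map_neg, hconj, hconj, hgr, Y'.T_gr]
      T_u := fun g x => hinj <| by rw [hu, hconj, hconj, hu, hTu]
      T_Φ := fun a x => hinj <| by rw [hΦ, hconj, hconj, hΦ, hTΦ]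
      compact := fun j => by
        obtain ⟨R, hR, h⟩ := hc j
        have : essentialOp Y P (conj Y'.T) (P.d j) = R := ContinuousLinearMap.ext fun x => by
          obtain ⟨h1, h2⟩ := h x
          rw [← hconj] at h2
          exact congrArg (Y.essential P).incl (hinj h2).symm
        rwa [this] }
  exact ⟨D.homotopy hcg, D.isEvaluation_zero hcg,
    D.isEvaluation_one hcg q hs hin hgr hu hΦ fun x => hconj Y'.T x⟩

end KasparovCycle

/-! ### Normalization of cycles over the complex numbers -/

namespace KasparovCycle

variable {K : Type v} [Group K] {B : GradedGAlgebra.{u} K}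
variable (X : KasparovCycle (GradedGAlgebra.complex K) B)

/-- The projection `Φ(1)` of a cycle over `ℂ`. -/
noncomputable def unitProj : X.E →L[ℂ] X.E := X.Φ (1 : ℂ)

theorem unitProj_mul_self : X.unitProj * X.unitProj = X.unitProj :=
  (map_mul X.Φ (1 : ℂ) (1 : ℂ)).symm.trans (congrArg X.Φ (mul_one (1 : ℂ)))

theorem unitProj_unitProj (x : X.E) : X.unitProj (X.unitProj x) = X.unitProj x :=
  DFunLike.congr_fun X.unitProj_mul_self x

theorem hasAdjoint_unitProj : HasAdjoint B.carrier X.unitProj X.unitProj :=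
  X.hasAdjoint_Φ_d (ProjectionFamily.complex K) ()

theorem gr_unitProj (x : X.E) : X.gr (X.unitProj x) = X.unitProj (X.gr x) := X.Φ_gr (1 : ℂ) x

theorem u_unitProj (k : K) (x : X.E) : X.u k (X.unitProj x) = X.unitProj (X.u k x) :=
  X.Φ_u k (1 : ℂ) x

/-- The essential submodule of a cycle over `ℂ`, that is, the range of `Φ(1)`. -/
noncomputable abbrev unital : InvariantSubmodule X := X.essential (ProjectionFamily.complex K)

theorem mem_unital {x : X.E} : x ∈ X.unital.toSubmodule ↔ X.unitProj x = x := by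
  have h : HasSum (fun _ : Unit => X.unitProj x) (X.unitProj x) := hasSum_unique _
  exact ⟨fun hx => h.unique hx, fun hx => by
    change HasSum (fun _ : Unit => X.unitProj x) x
    rwa [hx] at h ⊢⟩

variable {X} in
theorem unitProj_incl (x : X.unital.Elem) : X.unitProj (X.unital.incl x) = X.unital.incl x :=
  X.mem_unital.1 x.2

/-- The projection `Φ(1)`, with values in its range. -/
noncomputable def toUnital : X.E →L[ℂ] X.unital.Elem :=
  X.essentialΦ (ProjectionFamily.complex K) (1 : ℂ)

theorem toUnital_incl (x : X.unital.Elem) : X.toUnital (X.unital.incl x) = x :=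
  HilbertSubmodule.ext (unitProj_incl x)

theorem hinner_toUnital (x : X.E) (y : X.unital.Elem) :
    hinner B.carrier (X.toUnital x) y = hinner B.carrier x (X.unital.incl y) := by
  rw [← HilbertSubmodule.hinner_incl]
  change hinner B.carrier (X.unitProj x) (X.unital.incl y) = _
  rw [X.hasAdjoint_unitProj, unitProj_incl]

/-- The compression of an operator to the range of `Φ(1)`. -/
noncomputable def compress (S : X.E →L[ℂ] X.E) : X.unital.Elem →L[ℂ] X.unital.Elem :=
  X.toUnital.comp (S.comp X.unital.incl)

theorem compress_apply (S : X.E →L[ℂ] X.E) (x : X.unital.Elem) :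
    X.compress S x = X.toUnital (S (X.unital.incl x)) := rfl

theorem hasAdjoint_compress {S S' : X.E →L[ℂ] X.E} (h : HasAdjoint B.carrier S S') :
    HasAdjoint B.carrier (X.compress S) (X.compress S') := fun x y => by
  rw [compress_apply, compress_apply, hinner_toUnital, h, ← star_hinner, ← hinner_toUnital,
    star_hinner]

theorem compress_mem_compactOps {k : X.E →L[ℂ] X.E} (hk : k ∈ compactOps B.carrier X.E) :
    X.compress k ∈ compactOps B.carrier X.unital.Elem := by
  let L : (X.E →L[ℂ] X.E) →ₗ[ℂ] (X.unital.Elem →L[ℂ] X.unital.Elem) :=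
    { toFun := X.compress
      map_add' := fun k l => ContinuousLinearMap.ext fun x => map_add X.toUnital _ _
      map_smul' := fun c k => ContinuousLinearMap.ext fun x => map_smul X.toUnital c _ }
  have hL : Continuous L :=
    (L.mkContinuous (‖X.toUnital‖ * ‖X.unital.incl‖) fun k => by
      refine (ContinuousLinearMap.opNorm_comp_le _ _).trans ?_
      rw [mul_assoc, mul_comm ‖X.unital.incl‖]
      gcongr
      exact ContinuousLinearMap.opNorm_comp_le _ _).continuous
  refine mem_compactOps_of_map (B := B.carrier) L hL (fun x y => ?_) hk
  have : L (rankOne B.carrier x y) = rankOne B.carrier (X.toUnital x) (X.toUnital y) :=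
    ContinuousLinearMap.ext fun z => HilbertSubmodule.ext <| by
      change X.unitProj (x <• hinner B.carrier y (X.unital.incl z))
        = X.unitProj x <• hinner B.carrier (X.toUnital y) z
      rw [X.hasAdjoint_unitProj.map_hsmul, hinner_toUnital]
  rw [this]
  exact rankOne_mem _ _

section average

variable [Finite K]

/-- The average of an operator over the finite group. -/
noncomputable def average (S : X.E →L[ℂ] X.E) : X.E →L[ℂ] X.E :=
  letI := Fintype.ofFinite K
  (Nat.card K : ℂ)⁻¹ • ∑ k : K, X.u k * S * X.u k⁻¹

theorem average_eq [Fintype K] (S : X.E →L[ℂ] X.E) :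
    X.average S = (Nat.card K : ℂ)⁻¹ • ∑ k : K, X.u k * S * X.u k⁻¹ := by
  rw [average]
  congr!

theorem average_apply [Fintype K] (S : X.E →L[ℂ] X.E) (x : X.E) :
    X.average S x = (Nat.card K : ℂ)⁻¹ • ∑ k : K, X.u k (S (X.u k⁻¹ x)) := by
  rw [average_eq, smul_apply, sum_apply]
  rfl

theorem hasAdjoint_average {S S' : X.E →L[ℂ] X.E} (h : HasAdjoint B.carrier S S') :
    HasAdjoint B.carrier (X.average S) (X.average S') := by
  have := Fintype.ofFinite K
  rw [average_eq, average_eq]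
  convert (HasAdjoint.sum Finset.univ fun k _ => X.hasAdjoint_conj h k).smul (Nat.card K : ℂ)⁻¹
  simp

theorem u_average (S : X.E →L[ℂ] X.E) (k : K) (x : X.E) :
    X.u k (X.average S x) = X.average S (X.u k x) := by
  have := Fintype.ofFinite K
  rw [average_apply, average_apply, map_smul, map_sum]
  congr 1
  refine Fintype.sum_equiv (Equiv.mulLeft k) _ _ fun l => ?_
  rw [Equiv.coe_mulLeft, mul_inv_rev, X.u_mul_apply, X.u_mul_apply, X.u_inv_u]

theorem average_sub_mul_mem {S p : X.E →L[ℂ] X.E}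
    (h : ∀ k, (X.u k * S * X.u k⁻¹ - S) * p ∈ compactOps B.carrier X.E) :
    (X.average S - S) * p ∈ compactOps B.carrier X.E := by
  have := Fintype.ofFinite K
  have hc : (Nat.card K : ℂ) ≠ 0 := Nat.cast_ne_zero.2 Nat.card_pos.ne'
  have : (X.average S - S) * p
      = (Nat.card K : ℂ)⁻¹ • ∑ k : K, (X.u k * S * X.u k⁻¹ - S) * p := by
    rw [← Finset.sum_mul, Finset.sum_sub_distrib, Finset.sum_const, Finset.card_univ,
      ← Nat.card_eq_fintype_card, average_eq, ← smul_mul_assoc, smul_sub,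
      ← Nat.cast_smul_eq_nsmul ℂ, smul_smul, inv_mul_cancel₀ hc, one_smul]
  rw [this]
  exact Submodule.smul_mem _ _ (Submodule.sum_mem _ fun k _ => h k)

theorem conj_sub_Tadj_mem (k : K) :
    (X.u k * X.Tadj * X.u k⁻¹ - X.Tadj) * X.unitProj ∈ compactOps B.carrier X.E := by
  have h0 : (X.T - X.Tadj) * X.unitProj ∈ compactOps B.carrier X.E := X.compact_sub_adj (1 : ℂ)
  have h1 : (X.u k * X.T * X.u k⁻¹ - X.T) * X.unitProj ∈ compactOps B.carrier X.E :=
    X.compact_equivariance k (1 : ℂ)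
  have h2 := X.conj_mem_compactOps k h0
  have e : X.unitProj * X.u k⁻¹ = X.u k⁻¹ * X.unitProj :=
    ContinuousLinearMap.ext fun x => (X.u_unitProj _ _).symm
  rw [mul_assoc, mul_assoc, e, ← mul_assoc, ← mul_assoc] at h2
  convert add_mem (sub_mem h1 h2) h0 using 1
  noncomm_ring

theorem average_T_sub_mem : (X.average X.T - X.T) * X.unitProj ∈ compactOps B.carrier X.E :=
  X.average_sub_mul_mem fun k => X.compact_equivariance k (1 : ℂ)

theorem average_Tadj_sub_mem :
    (X.average X.Tadj - X.Tadj) * X.unitProj ∈ compactOps B.carrier X.E :=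
  X.average_sub_mul_mem X.conj_sub_Tadj_mem

theorem average_commutator_mem :
    X.average X.T * X.unitProj - X.unitProj * X.average X.T ∈ compactOps B.carrier X.E :=
  perturbed_commutator (P := ProjectionFamily.complex K) (X.hasAdjoint_average X.hasAdjoint_T)
    (fun _ => X.average_T_sub_mem) (fun _ => X.average_Tadj_sub_mem) ()

theorem gr_average_T (x : X.E) : X.gr (X.average X.T x) = -X.average X.T (X.gr x) := by
  have := Fintype.ofFinite K
  rw [average_apply, average_apply, map_smul, map_sum, ← smul_neg, ← Finset.sum_neg_distrib]
  congr 1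
  refine Finset.sum_congr rfl fun k _ => ?_
  rw [← X.u_gr, X.T_gr, map_neg, X.u_gr]

/-- The normalization of a cycle over `ℂ`: the module is replaced by the range of `Φ(1)`, and the
operator by the compression of its average. -/
noncomputable def normalize : KasparovCycle (GradedGAlgebra.complex K) B :=
  X.unital.cycleOfProjections (ProjectionFamily.complex K)
    (X.countablyGenerated.of_surjective X.toUnital (fun x => ⟨_, X.toUnital_incl x⟩)
      fun x b => HilbertSubmodule.ext (X.hasAdjoint_unitProj.map_hsmul x b))
    (X.compress (X.average X.T)) (X.compress (X.average X.Tadj))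
    (X.hasAdjoint_compress (X.hasAdjoint_average X.hasAdjoint_T))
    (fun x => HilbertSubmodule.ext <| by
      change X.gr (X.unitProj (X.average X.T (X.unital.incl x)))
        = -X.unitProj (X.average X.T (X.gr (X.unital.incl x)))
      rw [gr_unitProj, gr_average_T, map_neg])
    (fun j => by
      have h : (X.average X.T - X.average X.Tadj) * X.unitProj ∈ compactOps B.carrier X.E :=
        perturbed_sub_adj (P := ProjectionFamily.complex K)
        (fun _ => X.average_T_sub_mem) (fun _ => X.average_Tadj_sub_mem) ()
      convert X.compress_mem_compactOps h using 1
      refine ContinuousLinearMap.ext fun x => HilbertSubmodule.ext ?_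
      change X.unitProj (X.average X.T (X.unitProj (X.unital.incl x)))
        - X.unitProj (X.average X.Tadj (X.unitProj (X.unital.incl x)))
        = X.unitProj (X.average X.T (X.unitProj (X.unital.incl x))
          - X.average X.Tadj (X.unitProj (X.unital.incl x)))
      rw [map_sub])
    (fun j => by
      have h : (X.average X.T * X.average X.T - 1) * X.unitProj ∈ compactOps B.carrier X.E :=
        perturbed_sq (P := ProjectionFamily.complex K)
          (X.hasAdjoint_average X.hasAdjoint_T) (fun _ => X.average_T_sub_mem) ()
      have h2 := mul_mem_compactOps (X.hasAdjoint_average X.hasAdjoint_T) X.average_commutator_mem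
      convert X.compress_mem_compactOps (sub_mem h h2) using 1
      refine ContinuousLinearMap.ext fun x => HilbertSubmodule.ext ?_
      change X.unitProj (X.average X.T (X.unitProj (X.average X.T (X.unitProj (X.unital.incl x)))))
        - X.unitProj (X.unital.incl x)
        = X.unitProj (X.average X.T (X.average X.T (X.unitProj (X.unital.incl x)))
          - X.unitProj (X.unital.incl x) -
          X.average X.T (X.average X.T (X.unitProj (X.unital.incl x))
            - X.unitProj (X.average X.T (X.unital.incl x))))
      simp only [map_sub, unitProj_incl]
      abel)
    (fun k j => by
      convert zero_mem (compactOps B.carrier X.unital.Elem) using 1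
      refine ContinuousLinearMap.ext fun x => HilbertSubmodule.ext ?_
      change X.u k (X.unitProj (X.average X.T (X.u k⁻¹ (X.unitProj (X.unital.incl x)))))
        - X.unitProj (X.average X.T (X.unitProj (X.unital.incl x))) = 0
      rw [u_unitProj, u_average, X.u_u_inv, sub_self])
    (fun j => by
      convert zero_mem (compactOps B.carrier X.unital.Elem) using 1
      refine ContinuousLinearMap.ext fun x => HilbertSubmodule.ext ?_
      change X.unitProj (X.average X.T (X.unitProj (X.unital.incl x)))
        - X.unitProj (X.unitProj (X.average X.T (X.unital.incl x))) = 0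
      rw [unitProj_incl, unitProj_unitProj, sub_self])

theorem isNormalized_normalize : X.normalize.IsNormalized := by
  refine ⟨fun x => HilbertSubmodule.ext (unitProj_incl x), fun k x => HilbertSubmodule.ext ?_⟩
  change X.unitProj (X.average X.T (X.u k (X.unital.incl x)))
    = X.u k (X.unitProj (X.average X.T (X.unital.incl x)))
  rw [u_unitProj, u_average]

theorem homotopic_normalize : X.Homotopic X.normalize := by
  refine homotopic_of_essential (P := ProjectionFamily.complex K) (Y' := X.normalize) LinearMap.id
    Function.surjective_id (fun _ _ => rfl) (fun _ => rfl) (fun _ _ => rfl) (fun _ _ => rfl)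
    X.isNormalized_normalize.2 (fun a x => ?_) fun j => ?_
  · have h (x : X.normalize.E) : X.normalize.Φ a x = (show ℂ from a) • x := by
      have e : a = (show ℂ from a) • (1 : ℂ) := (mul_one (M := ℂ) a).symm
      have := X.normalize.Φ_smul_apply (show ℂ from a) (1 : ℂ) x
      rw [X.isNormalized_normalize.1] at this
      exact (congrArg (fun a => X.normalize.Φ a x) e).trans this
    rw [h, h, map_smul]
  · refine ⟨X.unitProj * X.average X.T * X.unitProj, ?_, fun x => ⟨?_, HilbertSubmodule.ext rfl⟩⟩
    · have h1 := mul_mem_compactOps X.hasAdjoint_unitProj X.average_T_sub_mem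
      have h2 : X.T * X.unitProj - X.unitProj * X.T ∈ compactOps B.carrier X.E :=
        X.commutator_mem_compactOps (ProjectionFamily.complex K) ()
      convert sub_mem h1 (mem_compactOps_mul X.hasAdjoint_unitProj h2) using 1
      change _ - X.T * X.unitProj = _
      rw [sub_mul (X.T * X.unitProj), mul_assoc X.T, X.unitProj_mul_self]
      noncomm_ring
    · exact X.mem_unital.2 (X.unitProj_unitProj _)

variable {X} in
theorem IsEvaluation.normalize {t : unitInterval}
    {Z : KasparovCycle (GradedGAlgebra.complex K) B.path} (h : IsEvaluation t Z X) :
    IsEvaluation t Z.normalize X.normalize := by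
  have := Fintype.ofFinite K
  obtain ⟨π, h1, h2, h3, h4, h5, h6, h7⟩ := h
  have hp (z) : π (Z.unitProj z) = X.unitProj (π z) := h6 (1 : ℂ) z
  have hav (z) : π (Z.average Z.T z) = X.average X.T (π z) := by
    rw [average_apply, average_apply, map_smul, map_sum]
    simp only [h5, h7]
  have hmem (z : Z.unital.Elem) : π (Z.unital.incl z) ∈ X.unital.toSubmodule :=
    X.mem_unital.2 (by rw [← hp, unitProj_incl])
  refine ⟨{ toFun := fun z => X.unital.elem (π (Z.unital.incl z)) (hmem z)
            map_add' := fun z w => HilbertSubmodule.ext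
              (map_add π (Z.unital.incl z) (Z.unital.incl w))
            map_smul' := fun c z => HilbertSubmodule.ext (map_smul π c (Z.unital.incl z)) },
    fun x => ?_, fun _ _ => h2 _ _, fun _ _ => HilbertSubmodule.ext (h3 _ _),
    fun _ => HilbertSubmodule.ext (h4 _), fun _ _ => HilbertSubmodule.ext (h5 _ _),
    fun _ _ => HilbertSubmodule.ext (h6 _ _), fun z => HilbertSubmodule.ext ?_⟩
  · obtain ⟨z, hz⟩ := h1 (X.unital.incl x)
    refine ⟨Z.toUnital z, HilbertSubmodule.ext ?_⟩
    change π (Z.unitProj z) = X.unital.incl x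
    rw [hp, hz]
    exact unitProj_incl (X := X) x
  · change π (Z.unitProj (Z.average Z.T (Z.unital.incl z)))
      = X.unitProj (X.average X.T (π (Z.unital.incl z)))
    rw [hp, hav]

variable {X} in
theorem Homotopic.normalize {Y : KasparovCycle (GradedGAlgebra.complex K) B}
    (h : Homotopic X Y) : ∃ Z : KasparovCycle (GradedGAlgebra.complex K) B.path,
      Z.IsNormalized ∧ IsEvaluation 0 Z X.normalize ∧ IsEvaluation 1 Z Y.normalize := by
  obtain ⟨Z, h0, h1⟩ := h
  exact ⟨Z.normalize, Z.isNormalized_normalize, h0.normalize, h1.normalize⟩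

end average

end KasparovCycle

/-! ### Square-summable families in Hilbert modules -/

section HilbertSum

open WithCStarModule

variable (A : Type u) [NonUnitalCStarAlgebra A] [PartialOrder A] [StarOrderedRing A]
variable {ι : Type w'} {E : ι → Type w} [∀ i, NormedAddCommGroup (E i)] [∀ i, NormedSpace ℂ (E i)]
  [∀ i, SMul A (E i)] [∀ i, CStarModule A (E i)]

/-- The norm of the restriction of a family to a finite set. -/
noncomputable def finNorm (F : Finset ι) (x : ∀ i, E i) : ℝ :=
  ‖(equiv A (∀ i : F, E i)).symm fun i => x i‖

theorem finNorm_sq (F : Finset ι) (x : ∀ i, E i) :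
    finNorm A F x ^ 2 = ‖∑ i ∈ F, inner A (x i) (x i)‖ := by
  rw [finNorm, pi_norm_sq, ← Finset.sum_coe_sort F]
  rfl

theorem finNorm_nonneg (F : Finset ι) (x : ∀ i, E i) : 0 ≤ finNorm A F x := norm_nonneg _

theorem finNorm_add_le (F : Finset ι) (x y : ∀ i, E i) :
    finNorm A F (x + y) ≤ finNorm A F x + finNorm A F y :=
  norm_add_le ((equiv A (∀ i : F, E i)).symm fun i => x i)
    ((equiv A (∀ i : F, E i)).symm fun i => y i)

theorem finNorm_neg (F : Finset ι) (x : ∀ i, E i) : finNorm A F (-x) = finNorm A F x :=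
  norm_neg ((equiv A (∀ i : F, E i)).symm fun i => x i)

theorem abs_finNorm_sub_le (F : Finset ι) (x y z : ∀ i, E i) :
    |finNorm A F (z - x) - finNorm A F (z - y)| ≤ finNorm A F (x - y) := by
  have h1 := finNorm_add_le A F (z - x) (x - y)
  have h2 := finNorm_add_le A F (z - y) (-(x - y))
  rw [finNorm_neg] at h2
  rw [show z - x + (x - y) = z - y by abel] at h1
  rw [show z - y + -(x - y) = z - x by abel] at h2
  exact abs_le.2 ⟨by linarith, by linarith⟩

theorem norm_sum_inner_le (F : Finset ι) (x y : ∀ i, E i) :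
    ‖∑ i ∈ F, inner A (x i) (y i)‖ ≤ finNorm A F x * finNorm A F y := by
  rw [← Finset.sum_coe_sort F]
  exact CStarModule.norm_inner_le (A := A) (E := WithCStarModule A (∀ i : F, E i))
    (x := (equiv A (∀ i : F, E i)).symm fun i => x i)
    (y := (equiv A (∀ i : F, E i)).symm fun i => y i)

theorem finNorm_le_sum (F : Finset ι) (x : ∀ i, E i) : finNorm A F x ≤ ∑ i ∈ F, ‖x i‖ := by
  rw [← Finset.sum_coe_sort F]
  exact pi_norm_le_sum_norm (A := A) ((equiv A (∀ i : F, E i)).symm fun i => x i)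

theorem summable_inner_self_iff {x : ∀ i, E i} : Summable (fun i => inner A (x i) (x i)) ↔
    ∀ ε > 0, ∃ s : Finset ι, ∀ t, Disjoint t s → finNorm A t x < ε := by
  rw [summable_iff_vanishing_norm]
  constructor
  · intro h ε hε
    obtain ⟨s, hs⟩ := h (ε ^ 2) (by positivity)
    exact ⟨s, fun t ht => lt_of_pow_lt_pow_left₀ 2 hε.le ((finNorm_sq A t x).trans_lt (hs t ht))⟩
  · intro h ε hε
    obtain ⟨s, hs⟩ := h (Real.sqrt ε) (Real.sqrt_pos.2 hε)
    refine ⟨s, fun t ht => ?_⟩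
    rw [← finNorm_sq, ← Real.sq_sqrt hε.le]
    exact pow_lt_pow_left₀ (hs t ht) (finNorm_nonneg A t x) two_ne_zero

variable {A} in
theorem summable_inner {x y : ∀ i, E i} (hx : Summable fun i => inner A (x i) (x i))
    (hy : Summable fun i => inner A (y i) (y i)) : Summable fun i => inner A (x i) (y i) := by
  classical
  rw [summable_iff_vanishing_norm]
  intro ε hε
  obtain ⟨s, hs⟩ := (summable_inner_self_iff A).1 hx (Real.sqrt ε) (Real.sqrt_pos.2 hε)
  obtain ⟨s', hs'⟩ := (summable_inner_self_iff A).1 hy (Real.sqrt ε) (Real.sqrt_pos.2 hε)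
  refine ⟨s ∪ s', fun t ht => (norm_sum_inner_le A t x y).trans_lt ?_⟩
  rw [Finset.disjoint_union_right] at ht
  calc _ < Real.sqrt ε * Real.sqrt ε :=
        mul_lt_mul'' (hs t ht.1) (hs' t ht.2) (finNorm_nonneg A t x) (finNorm_nonneg A t y)
    _ = ε := Real.mul_self_sqrt hε.le

variable (E) in
/-- The families `x` for which `∑ᵢ ⟨xᵢ, xᵢ⟩` converges in norm. -/
def hilbertSum : Submodule ℂ (∀ i, E i) where
  carrier := {x | Summable fun i => inner A (x i) (x i)}
  add_mem' {x y} hx hy := by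
    change Summable fun i => inner A (x i + y i) (x i + y i)
    simp only [CStarModule.inner_add_left, CStarModule.inner_add_right]
    exact (hx.add (summable_inner hy hx)).add ((summable_inner hx hy).add hy)
  zero_mem' := by
    change Summable fun i => inner A (0 : E i) (0 : E i)
    simp only [CStarModule.inner_zero_left]
    exact summable_zero
  smul_mem' c x hx := by
    change Summable fun i => inner A (c • x i) (c • x i)
    simp only [CStarModule.inner_smul_left_complex, CStarModule.inner_smul_right_complex]
    exact (hx.const_smul _).const_smul _

variable (E) in
/-- The direct sum of a family of Hilbert modules, with inner product `∑ᵢ ⟨xᵢ, yᵢ⟩`. -/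
def HilbertSum : Type (max w w') := hilbertSum A E

namespace HilbertSum

noncomputable instance : AddCommGroup (HilbertSum A E) :=
  inferInstanceAs (AddCommGroup (hilbertSum A E))

noncomputable instance : Module ℂ (HilbertSum A E) :=
  inferInstanceAs (Module ℂ (hilbertSum A E))

variable {A}

/-- A component of an element of a direct sum. -/
def coord (x : HilbertSum A E) (i : ι) : E i := x.1 i

/-- The element of a direct sum with given components. -/
def mk (x : ∀ i, E i) (hx : Summable fun i => inner A (x i) (x i)) : HilbertSum A E := ⟨x, hx⟩

theorem ext {x y : HilbertSum A E} (h : ∀ i, x.coord i = y.coord i) : x = y :=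
  Subtype.ext (funext h)

theorem summable_self (x : HilbertSum A E) :
    Summable fun i => inner A (x.coord i) (x.coord i) := x.2

theorem coord_add (x y : HilbertSum A E) (i : ι) : (x + y).coord i = x.coord i + y.coord i := rfl

theorem coord_csmul (c : ℂ) (x : HilbertSum A E) (i : ι) : (c • x).coord i = c • x.coord i := rfl

noncomputable instance : SMul A (HilbertSum A E) where
  smul a x := mk (fun i => a • x.coord i) <| by
    simp only [CStarModule.inner_op_smul_left, CStarModule.inner_op_smul_right]
    exact (x.summable_self.mul_right (star a)).mul_left a

theorem coord_smul (a : A) (x : HilbertSum A E) (i : ι) : (a • x).coord i = a • x.coord i := rfl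

noncomputable instance : Inner A (HilbertSum A E) where
  inner x y := ∑' i, inner A (x.coord i) (y.coord i)

theorem hasSum_inner (x y : HilbertSum A E) :
    HasSum (fun i => inner A (x.coord i) (y.coord i)) (inner A x y) :=
  (summable_inner x.summable_self y.summable_self).hasSum

noncomputable instance : Norm (HilbertSum A E) where
  norm x := Real.sqrt ‖inner A x x‖

theorem inner_coord_le (x : HilbertSum A E) (i : ι) :
    inner A (x.coord i) (x.coord i) ≤ inner A x x :=
  le_hasSum (x.hasSum_inner x) i fun _ _ => CStarModule.inner_self_nonneg

noncomputable instance : CStarModule A (HilbertSum A E) where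
  inner_add_right {x y z} := by
    refine (x.hasSum_inner (y + z)).unique ?_
    simp only [coord_add, CStarModule.inner_add_right]
    exact (x.hasSum_inner y).add (x.hasSum_inner z)
  inner_self_nonneg {x} := (x.hasSum_inner x).nonneg fun _ => CStarModule.inner_self_nonneg
  inner_self {x} := by
    refine ⟨fun h => ext fun i => ?_, ?_⟩
    · refine (CStarModule.inner_self (A := A)).1 (le_antisymm ?_ CStarModule.inner_self_nonneg)
      exact (x.inner_coord_le i).trans h.le
    · rintro rfl
      refine (hasSum_inner (0 : HilbertSum A E) 0).unique ?_
      exact (hasSum_zero (α := A) (β := ι)).congr_fun fun i => CStarModule.inner_zero_left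
  inner_op_smul_right {a x y} := by
    refine (x.hasSum_inner (a • y)).unique ?_
    simp only [coord_smul, CStarModule.inner_op_smul_right]
    exact (x.hasSum_inner y).mul_left a
  inner_smul_right_complex {z x y} := by
    refine (x.hasSum_inner (z • y)).unique ?_
    simp only [coord_csmul, CStarModule.inner_smul_right_complex]
    exact (x.hasSum_inner y).const_smul z
  star_inner x y := by
    refine HasSum.unique ?_ (y.hasSum_inner x)
    exact (x.hasSum_inner y).star.congr_fun fun i => (CStarModule.star_inner _ _).symm
  norm_eq_sqrt_norm_inner_self _ := rfl

noncomputable instance : NormedAddCommGroup (HilbertSum A E) :=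
  NormedAddCommGroup.ofCore (CStarModule.normedSpaceCore A)

noncomputable instance : NormedSpace ℂ (HilbertSum A E) :=
  NormedSpace.ofCore (CStarModule.normedSpaceCore A)

theorem norm_sq (x : HilbertSum A E) : ‖x‖ ^ 2 = ‖inner A x x‖ := CStarModule.norm_sq_eq A

theorem finNorm_le_norm (x : HilbertSum A E) (F : Finset ι) : finNorm A F x.coord ≤ ‖x‖ := by
  refine (sq_le_sq₀ (finNorm_nonneg A F _) (norm_nonneg x)).1 ?_
  rw [norm_sq, finNorm_sq]
  exact CStarAlgebra.norm_le_norm_of_nonneg_of_le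
    (Finset.sum_nonneg fun _ _ => CStarModule.inner_self_nonneg)
    (sum_le_hasSum F (fun _ _ => CStarModule.inner_self_nonneg) (x.hasSum_inner x))

theorem norm_le_of_finNorm_le {x : HilbertSum A E} {C : ℝ} (hC : 0 ≤ C)
    (h : ∀ F, finNorm A F x.coord ≤ C) : ‖x‖ ≤ C := by
  refine (sq_le_sq₀ (norm_nonneg x) hC).1 ?_
  rw [norm_sq]
  refine le_of_tendsto ((x.hasSum_inner x).norm) (Filter.Eventually.of_forall fun F => ?_)
  rw [← finNorm_sq]
  exact pow_le_pow_left₀ (finNorm_nonneg A F _) (h F) 2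

theorem norm_coord_le (x : HilbertSum A E) (i : ι) : ‖x.coord i‖ ≤ ‖x‖ := by
  refine (sq_le_sq₀ (norm_nonneg _) (norm_nonneg x)).1 ?_
  rw [norm_sq, CStarModule.norm_sq_eq A]
  exact CStarAlgebra.norm_le_norm_of_nonneg_of_le CStarModule.inner_self_nonneg (x.inner_coord_le i)

/-- A component, as a continuous linear map. -/
noncomputable def coordL (i : ι) : HilbertSum A E →L[ℂ] E i :=
  LinearMap.mkContinuous
    { toFun := fun x => x.coord i, map_add' := fun _ _ => rfl, map_smul' := fun _ _ => rfl } 1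
    fun x => by rw [one_mul]; exact x.norm_coord_le i

/-- Cutting an element off outside a large finite set of indices makes it small. -/
theorem exists_norm_le (x : HilbertSum A E) {ε : ℝ} (hε : 0 < ε) : ∃ s : Finset ι,
    ∀ y : HilbertSum A E, (∀ i, y.coord i = x.coord i ∨ y.coord i = 0) →
      (∀ i ∈ s, y.coord i = 0) → ‖y‖ ≤ ε := by
  classical
  obtain ⟨s, hs⟩ := (summable_inner_self_iff A).1 x.summable_self ε hε
  refine ⟨s, fun y h1 h2 => norm_le_of_finNorm_le hε.le fun F => ?_⟩
  refine le_trans ?_ (hs (F.filter fun i => y.coord i ≠ 0) ?_).le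
  · refine (sq_le_sq₀ (finNorm_nonneg A _ _) (finNorm_nonneg A _ _)).1 (le_of_eq ?_)
    rw [finNorm_sq, finNorm_sq, Finset.sum_filter]
    congr 1
    refine Finset.sum_congr rfl fun i _ => ?_
    by_cases h : y.coord i = 0
    · rw [if_neg (not_not.2 h), h, CStarModule.inner_zero_left]
    · rw [if_pos h, (h1 i).resolve_right h]
  · refine Finset.disjoint_left.2 fun i hi his => ?_
    exact (Finset.mem_filter.1 hi).2 (h2 i his)

instance [∀ i, CompleteSpace (E i)] : CompleteSpace (HilbertSum A E) := by
  classical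
  refine Metric.complete_of_cauchySeq_tendsto fun x hx => ?_
  have hc (i : ι) : CauchySeq fun n => (x n).coord i :=
    hx.map (coordL (A := A) (E := E) i).uniformContinuous
  choose y hy using fun i => cauchySeq_tendsto_of_complete (hc i)
  -- the finite partial norms of `xₙ - y` are uniformly small
  have key (ε : ℝ) (hε : 0 < ε) : ∃ N, ∀ n ≥ N, ∀ F, finNorm A F ((x n).coord - y) ≤ ε := by
    obtain ⟨N, hN⟩ := Metric.cauchySeq_iff.1 hx ε hε
    refine ⟨N, fun n hn F => ?_⟩
    have h0 : Filter.Tendsto (fun m => finNorm A F ((x n).coord - (x m).coord)) Filter.atTop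
        (nhds (finNorm A F ((x n).coord - y))) := by
      have h1 : Filter.Tendsto (fun m => finNorm A F ((x m).coord - y)) Filter.atTop (nhds 0) := by
        refine squeeze_zero (fun m => finNorm_nonneg A F _) (fun m => finNorm_le_sum A F _) ?_
        rw [← Finset.sum_const_zero (s := F) (ι := ι)]
        exact tendsto_finsetSum _ fun i _ => tendsto_iff_norm_sub_tendsto_zero.1 (hy i)
      refine tendsto_iff_norm_sub_tendsto_zero.2 (squeeze_zero (fun _ => norm_nonneg _)
        (fun m => ?_) h1)
      exact abs_finNorm_sub_le A F (x m).coord y (x n).coord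
    refine le_of_tendsto h0 ?_
    filter_upwards [Filter.eventually_ge_atTop N] with m hm
    refine ((x n - x m).finNorm_le_norm F).trans ?_
    rw [← dist_eq_norm]
    exact (hN n hn m hm).le
  have hmem : Summable fun i => inner A (y i) (y i) := by
    refine (summable_inner_self_iff A).2 fun ε hε => ?_
    obtain ⟨N, hN⟩ := key (ε / 2) (by positivity)
    obtain ⟨s, hs⟩ := (summable_inner_self_iff A).1 (x N).summable_self (ε / 2) (by positivity)
    refine ⟨s, fun t ht => ?_⟩
    have h1 := abs_finNorm_sub_le A t (x N).coord y 0
    rw [zero_sub, zero_sub, finNorm_neg, finNorm_neg] at h1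
    have h2 := (abs_le.1 h1).1
    have h3 := hN N le_rfl t
    have h4 := hs t ht
    linarith
  refine ⟨mk y hmem, Metric.tendsto_atTop.2 fun ε hε => ?_⟩
  obtain ⟨N, hN⟩ := key (ε / 2) (by positivity)
  refine ⟨N, fun n hn => ?_⟩
  rw [dist_eq_norm]
  exact (norm_le_of_finNorm_le (x := x n - mk y hmem) (by positivity)
    (hN n hn)).trans_lt (by linarith)

end HilbertSum

end HilbertSum

/-! ### The point projections of `C₀(G/K)` -/

namespace ProjectionFamily

variable {G : Type v} [Group G] [TopologicalSpace G] [DiscreteTopology G] (K : Subgroup G)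

theorem norm_le_of_apply_le {f : C₀(G ⧸ K, ℂ)} {C : ℝ} (hC : 0 ≤ C) (h : ∀ x, ‖f x‖ ≤ C) :
    ‖f‖ ≤ C := by
  rw [← ZeroAtInftyContinuousMap.norm_toBCF_eq_norm]
  exact (BoundedContinuousFunction.norm_le hC).2 h

theorem norm_apply_le (f : C₀(G ⧸ K, ℂ)) (x : G ⧸ K) : ‖f x‖ ≤ ‖f‖ := by
  rw [← ZeroAtInftyContinuousMap.norm_toBCF_eq_norm]
  exact f.toBCF.norm_coe_le_norm x

open GradedGAlgebra Classical in
theorem sum_smul_delta_apply (F : Finset (G ⧸ K)) (r : G ⧸ K → ℂ) (y : G ⧸ K) :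
    (∑ x ∈ F, r x • delta K x) y = if y ∈ F then r y else 0 := by
  let ev : C₀(G ⧸ K, ℂ) →+ ℂ :=
    { toFun := fun f => f y, map_zero' := rfl, map_add' := fun _ _ => rfl }
  change ev _ = _
  rw [map_sum]
  change ∑ x ∈ F, r x * delta K x y = _
  simp [delta_apply]

open GradedGAlgebra in
theorem dense_span_delta :
    Dense (Submodule.span ℂ (Set.range (delta K)) : Set C₀(G ⧸ K, ℂ)) := fun f => by
  classical
  have : DiscreteTopology (G ⧸ K) := QuotientGroup.discreteTopology (isOpen_discrete _)
  refine Metric.mem_closure_iff.2 fun ε hε => ?_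
  have h0 := zero_at_infty f
  rw [Filter.cocompact_eq_cofinite] at h0
  have h1 : {x | ¬ dist (f x) 0 < ε / 2}.Finite :=
    Filter.eventually_cofinite.1 (Metric.tendsto_nhds.1 h0 (ε / 2) (by positivity))
  refine ⟨∑ x ∈ h1.toFinset, f x • delta K x, Submodule.sum_mem _ fun x _ =>
    Submodule.smul_mem _ _ (Submodule.subset_span ⟨x, rfl⟩), ?_⟩
  rw [dist_eq_norm]
  refine (norm_le_of_apply_le K (by positivity) fun y => ?_).trans_lt (half_lt_self hε)
  change ‖f y - (∑ x ∈ h1.toFinset, f x • delta K x) y‖ ≤ ε / 2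
  rw [sum_smul_delta_apply]
  split_ifs with h
  · rw [sub_self, norm_zero]
    positivity
  · rw [Set.Finite.mem_toFinset, Set.mem_ofPred_eq, not_not, dist_zero_right] at h
    rw [sub_zero]
    exact h.le

open GradedGAlgebra in
/-- The family of the characteristic functions of the points of `G/K`. -/
noncomputable def cosets : ProjectionFamily (GradedGAlgebra.cosets K) (G ⧸ K) where
  d := delta K
  perm g := MulAction.toPerm g
  star_d x := ZeroAtInftyContinuousMap.ext fun y => by
    change star (delta K x y) = delta K x y
    rw [delta_apply]
    split_ifs <;> simp
  mul_self x := ZeroAtInftyContinuousMap.ext fun y => by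
    change delta K x y * delta K x y = delta K x y
    rw [delta_apply]
    split_ifs <;> simp
  mul_of_ne x x' h := ZeroAtInftyContinuousMap.ext fun y => by
    change delta K x y * delta K x' y = 0
    rw [delta_apply, delta_apply]
    split_ifs with h1 h2
    · exact (h (h1.symm.trans h2)).elim
    all_goals simp
  comm a x := ZeroAtInftyContinuousMap.ext fun y => mul_comm (G := ℂ) _ _
  grading_d _ := rfl
  act_d g x := ZeroAtInftyContinuousMap.ext fun y => by
    change delta K x (g⁻¹ • y) = delta K (g • x) y
    classical
    rw [delta_apply, delta_apply]
    exact if_congr inv_smul_eq_iff rfl rfl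
  norm_sum_le F r hr := by
    refine norm_le_of_apply_le K zero_le_one fun y => ?_
    change ‖(∑ x ∈ F, (r x : ℂ) • delta K x) y‖ ≤ 1
    rw [sum_smul_delta_apply]
    split_ifs
    · simpa [abs_of_nonneg (hr y).1] using (hr y).2
    · simp
  dense := dense_span_delta K

end ProjectionFamily

/-! ### Twisting a Hilbert module by the action -/

section Twist

variable {G : Type v} [Group G] (B : GradedGAlgebra.{u} G)

theorem op_map_nonneg {B : Type u} {B' : Type w} [NonUnitalCStarAlgebra B]
    [NonUnitalCStarAlgebra B'] [PartialOrder Bᵐᵒᵖ] [StarOrderedRing Bᵐᵒᵖ]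
    [PartialOrder B'ᵐᵒᵖ] [StarOrderedRing B'ᵐᵒᵖ]
    (φ : B →⋆ₙₐ[ℂ] B') {b : B} (hb : 0 ≤ op b) : 0 ≤ op (φ b) := by
  obtain ⟨c, hc⟩ := CStarAlgebra.nonneg_iff_eq_star_mul_self.1 hb
  have h : op (φ b) = star (op (φ c.unop)) * op (φ c.unop) := by
    have : b = c.unop * star c.unop := congrArg unop hc
    rw [this, map_mul, map_star]
    rfl
  rw [h]
  exact star_mul_self_nonneg _

theorem op_map_le {B : Type u} {B' : Type w} [NonUnitalCStarAlgebra B] [NonUnitalCStarAlgebra B']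
    [PartialOrder Bᵐᵒᵖ] [StarOrderedRing Bᵐᵒᵖ] [PartialOrder B'ᵐᵒᵖ] [StarOrderedRing B'ᵐᵒᵖ]
    (φ : B →⋆ₙₐ[ℂ] B') {b c : B} (h : op b ≤ op c) : op (φ b) ≤ op (φ c) := by
  have := op_map_nonneg φ (b := c - b) (sub_nonneg.2 h)
  rw [map_sub] at this
  exact sub_nonneg.1 this

theorem GradedGAlgebra.norm_act (g : G) (b : B) : ‖B.act g b‖ = ‖b‖ := by
  refine le_antisymm (NonUnitalStarAlgHom.norm_apply_le _ _) ?_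
  conv_lhs => rw [← B.act_inv_act g b]
  exact NonUnitalStarAlgHom.norm_apply_le _ _

variable (E : Type w) [NormedAddCommGroup E] [NormedSpace ℂ E] [SMul (B.carrier)ᵐᵒᵖ E]
  [CStarModule (B.carrier)ᵐᵒᵖ E]

/-- The Hilbert `B`-module `E` twisted by the automorphism `β_g`: the inner product is
`β_g(⟨x, y⟩)` and the action is `x · b = x β_{g⁻¹}(b)`. -/
def Twist (_B : GradedGAlgebra.{u} G) (E : Type w) (_g : G) : Type w := E

namespace Twist

variable (g : G)

noncomputable instance : NormedAddCommGroup (Twist B E g) := inferInstanceAs (NormedAddCommGroup E)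

noncomputable instance : NormedSpace ℂ (Twist B E g) := inferInstanceAs (NormedSpace ℂ E)

instance [CompleteSpace E] : CompleteSpace (Twist B E g) := inferInstanceAs (CompleteSpace E)

noncomputable instance : SMul (B.carrier)ᵐᵒᵖ (Twist B E g) where
  smul b x := (show E from x) <• B.act g⁻¹ b.unop

noncomputable instance : CStarModule (B.carrier)ᵐᵒᵖ (Twist B E g) where
  inner x y := op (B.act g (hinner B.carrier (show E from x) (show E from y)))
  inner_add_right := congrArg op ((congrArg (B.act g) (hinner_add _ _ _)).trans (map_add _ _ _))
  inner_self_nonneg := op_map_nonneg (B.act g) CStarModule.inner_self_nonneg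
  inner_self {x} := by
    rw [op_eq_zero_iff, ← norm_eq_zero, B.norm_act, norm_hinner_self, sq_eq_zero_iff, norm_eq_zero]
    rfl
  inner_op_smul_right {b x y} := by
    refine congrArg op ((congrArg (B.act g) (hinner_smul _ _ _)).trans ?_)
    rw [map_mul, B.act_act_inv]
    rfl
  inner_smul_right_complex :=
    congrArg op ((congrArg (B.act g) (hinner_csmul _ _ _)).trans (map_smul _ _ _))
  star_inner x y := by
    rw [← op_star, ← map_star, star_hinner]
  norm_eq_sqrt_norm_inner_self x := by
    rw [norm_op, B.norm_act, norm_hinner_self, Real.sqrt_sq (norm_nonneg _)]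
    rfl

end Twist

end Twist

/-! ### Square-summable equivariant functions -/

/-- A copy of a countable type in a given universe. -/
def Copy (G : Type v) [Countable G] : Type u := @Shrink.{u} G (Countable.toSmall G)

/-- The bijection of a countable type with its copy. -/
noncomputable def copyEquiv (G : Type v) [Countable G] : G ≃ Copy.{u} G :=
  @equivShrink.{u} G (Countable.toSmall G)

namespace KasparovCycle

variable {G : Type v} [Group G] {K : Subgroup G} {A : GradedGAlgebra.{w} K}
  {B : GradedGAlgebra.{u} G}

/-- The module of a cycle over `B.res K` is also a module over `B`, which has the same underlying
algebra. The instance is needed since the two algebras are not reducibly equal. -/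
instance resSMul (X : KasparovCycle A (B.res K)) : SMul (B.carrier)ᵐᵒᵖ X.E := X.smul

noncomputable instance resCStarModule (X : KasparovCycle A (B.res K)) :
    CStarModule (B.carrier)ᵐᵒᵖ X.E := X.cstarModule

variable [Countable G] (X : KasparovCycle A (B.res K))

/-- The square-summable functions `G → X.E`, with inner product `∑_g β_g(⟨ξ(g), η(g)⟩)`. The group
is replaced by a copy of it in the universe of `X.E`. -/
abbrev SquareSummable : Type u :=
  HilbertSum (B.carrier)ᵐᵒᵖ fun i : Copy.{u} G => Twist B X.E ((copyEquiv G).symm i)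

variable {X} in
/-- The value of a square-summable function at a point of the group. -/
noncomputable def SquareSummable.val (ξ : X.SquareSummable) (g : G) : X.E :=
  ξ.coord (copyEquiv G g)

variable {X} in
theorem SquareSummable.continuous_val (g : G) :
    Continuous fun ξ : X.SquareSummable => (ξ.val g : X.E) :=
  (HilbertSum.coordL (A := (B.carrier)ᵐᵒᵖ)
    (E := fun i : Copy.{u} G => Twist B X.E ((copyEquiv G).symm i)) (copyEquiv G g)).continuous

variable {X} in
theorem SquareSummable.val_hsmul (ξ : X.SquareSummable) (b : B) (g : G) :
    (ξ <• b).val g = ξ.val g <• B.act g⁻¹ b := by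
  change ξ.val g <• B.act ((copyEquiv G).symm (copyEquiv G g))⁻¹ b = _
  rw [Equiv.symm_apply_apply]

/-- The module induced from `X`: the square-summable functions `ξ` on the group with
`ξ(gk) = u_{k⁻¹} ξ(g)`, with inner product `∑_g β_g(⟨ξ(g), η(g)⟩)`. -/
noncomputable def inducedSubmodule : HilbertSubmodule B.carrier X.SquareSummable where
  carrier := {ξ | ∀ (g : G) (k : K), ξ.val (g * k) = X.u k⁻¹ (ξ.val g)}
  add_mem' {ξ η} h1 h2 g k := by
    change ξ.val (g * k) + η.val (g * k) = X.u k⁻¹ (ξ.val g + η.val g)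
    rw [h1, h2, map_add]
  zero_mem' g k := (map_zero (X.u k⁻¹)).symm
  smul_mem' c ξ h g k := by
    change c • ξ.val (g * k) = X.u k⁻¹ (c • ξ.val g)
    rw [h, map_smul]
  hsmul_mem ξ h b g k := by
    rw [SquareSummable.val_hsmul, SquareSummable.val_hsmul, h, mul_inv_rev, B.act_mul_apply]
    exact (X.u_smul k⁻¹ (ξ.val g) (B.act g⁻¹ b)).symm
  isClosed := by
    have h : IsClosed (⋂ (g : G) (k : K),
        {ξ : X.SquareSummable | ξ.val (g * k) = X.u k⁻¹ (ξ.val g)}) :=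
      isClosed_iInter fun g => isClosed_iInter fun k => isClosed_eq
        (SquareSummable.continuous_val _)
        ((X.u k⁻¹).continuous.comp (SquareSummable.continuous_val _))
    convert h using 1
    ext ξ
    simp only [Set.mem_iInter]
    rfl

/-- The elements of the induced module. -/
abbrev Induced : Type u := X.inducedSubmodule.Elem

namespace Induced

variable {X}

/-- The value of an element of the induced module at a point of the group. -/
noncomputable def val (ξ : X.Induced) (g : G) : X.E := (X.inducedSubmodule.incl ξ).val g

theorem val_mul (ξ : X.Induced) (g : G) (k : K) : ξ.val (g * k) = X.u k⁻¹ (ξ.val g) := ξ.2 g k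

theorem ext {ξ η : X.Induced} (h : ∀ g, ξ.val g = η.val g) : ξ = η :=
  HilbertSubmodule.ext (HilbertSum.ext fun i => by
    obtain ⟨g, rfl⟩ := (copyEquiv G).surjective i
    exact h g)

theorem val_add (ξ η : X.Induced) (g : G) : (ξ + η).val g = ξ.val g + η.val g := rfl

theorem val_sub (ξ η : X.Induced) (g : G) : (ξ - η).val g = ξ.val g - η.val g := rfl

theorem val_neg (ξ : X.Induced) (g : G) : (-ξ).val g = -ξ.val g := rfl

theorem val_csmul (c : ℂ) (ξ : X.Induced) (g : G) : (c • ξ).val g = c • ξ.val g := rfl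

theorem val_hsmul (ξ : X.Induced) (b : B) (g : G) : (ξ <• b).val g = ξ.val g <• B.act g⁻¹ b :=
  SquareSummable.val_hsmul _ b g

variable (X) in
/-- The value at a point of the group, as a continuous linear map. -/
noncomputable def valL (g : G) : X.Induced →L[ℂ] X.E where
  toFun ξ := ξ.val g
  map_add' _ _ := rfl
  map_smul' _ _ := rfl
  cont := (SquareSummable.continuous_val g).comp X.inducedSubmodule.incl.continuous

theorem hasSum_hinner (ξ η : X.Induced) :
    HasSum (fun g => B.act g (hinner B.carrier (ξ.val g) (η.val g))) (hinner B.carrier ξ η) := by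
  have h := (HilbertSum.hasSum_inner (X.inducedSubmodule.incl ξ) (X.inducedSubmodule.incl η)).map
    (opAddEquiv.symm : (B.carrier)ᵐᵒᵖ ≃+ B.carrier) continuous_unop
  rw [← (copyEquiv G).hasSum_iff] at h
  refine h.congr_fun fun g => ?_
  change B.act g (hinner B.carrier (ξ.val g) (η.val g))
    = B.act ((copyEquiv G).symm (copyEquiv G g)) (hinner B.carrier (ξ.val g) (η.val g))
  rw [Equiv.symm_apply_apply]

/-- The element of the induced module given by a function on the group. -/
noncomputable def mk (f : G → X.E) (hf : ∀ (g : G) (k : K), f (g * k) = X.u k⁻¹ (f g))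
    (hs : Summable fun g => B.act g (hinner B.carrier (f g) (f g))) : X.Induced :=
  X.inducedSubmodule.elem
    (HilbertSum.mk (fun i => f ((copyEquiv G).symm i)) <| by
      have h : Summable fun i : Copy.{u} G => B.act ((copyEquiv G).symm i)
          (hinner B.carrier (f ((copyEquiv G).symm i)) (f ((copyEquiv G).symm i))) :=
        ((copyEquiv G).symm.summable_iff
          (f := fun g => B.act g (hinner B.carrier (f g) (f g)))).2 hs
      exact h.map (opAddEquiv : B.carrier ≃+ (B.carrier)ᵐᵒᵖ) continuous_op)
    fun g k => by
      change f ((copyEquiv G).symm (copyEquiv G (g * k)))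
        = X.u k⁻¹ (f ((copyEquiv G).symm (copyEquiv G g)))
      rw [Equiv.symm_apply_apply, Equiv.symm_apply_apply, hf]

theorem val_mk (f : G → X.E) (hf : ∀ (g : G) (k : K), f (g * k) = X.u k⁻¹ (f g))
    (hs : Summable fun g => B.act g (hinner B.carrier (f g) (f g))) (g : G) :
    (mk f hf hs).val g = f g := by
  change f ((copyEquiv G).symm (copyEquiv G g)) = f g
  rw [Equiv.symm_apply_apply]

/-- Cutting an element off outside a large finite set makes it small. -/
theorem exists_norm_le (ξ : X.Induced) {ε : ℝ} (hε : 0 < ε) : ∃ s : Finset G,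
    ∀ η : X.Induced, (∀ g, η.val g = ξ.val g ∨ η.val g = 0) → (∀ g ∈ s, η.val g = 0) → ‖η‖ ≤ ε := by
  classical
  obtain ⟨s, hs⟩ := (X.inducedSubmodule.incl ξ).exists_norm_le hε
  refine ⟨s.image (copyEquiv G).symm, fun η h1 h2 => hs (X.inducedSubmodule.incl η) (fun i => ?_)
    fun i hi => ?_⟩
  · obtain ⟨g, rfl⟩ := (copyEquiv G).surjective i
    exact h1 g
  · obtain ⟨g, rfl⟩ := (copyEquiv G).surjective i
    exact h2 g (Finset.mem_image.2 ⟨_, hi, Equiv.symm_apply_apply _ _⟩)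

section map

variable {A' : GradedGAlgebra.{w} K} {B' : GradedGAlgebra.{u} G} {X' : KasparovCycle A' (B'.res K)}

/-- The operator `ξ ↦ (g ↦ L_g (ξ(σ g)))` between induced modules, for linear maps `L_g` that are
uniformly bounded for the inner products. -/
noncomputable def map (σ : G ≃ G) (L : G → X.E →ₗ[ℂ] X'.E) (C : ℝ) (hC0 : 0 ≤ C)
    (hL : ∀ (ξ : X.Induced) (g : G) (k : K),
      L (g * k) (ξ.val (σ (g * k))) = X'.u k⁻¹ (L g (ξ.val (σ g))))
    (hC : ∀ (ξ : X.Induced) (F : Finset G),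
      ‖∑ g ∈ F, B'.act g (hinner B'.carrier (L g (ξ.val (σ g))) (L g (ξ.val (σ g))))‖
        ≤ C ^ 2 * ‖∑ g ∈ F, B.act (σ g) (hinner B.carrier (ξ.val (σ g)) (ξ.val (σ g)))‖) :
    X.Induced →L[ℂ] X'.Induced :=
  have hs (ξ : X.Induced) :
      HasSum (fun g => B.act (σ g) (hinner B.carrier (ξ.val (σ g)) (ξ.val (σ g))))
        (hinner B.carrier ξ ξ) := (σ.hasSum_iff
          (f := fun g => B.act g (hinner B.carrier (ξ.val g) (ξ.val g)))).2 (hasSum_hinner ξ ξ)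
  have hs' (ξ : X.Induced) : Summable fun g =>
      B'.act g (hinner B'.carrier (L g (ξ.val (σ g))) (L g (ξ.val (σ g)))) := by
    refine summable_iff_vanishing_norm.2 fun ε hε => ?_
    obtain ⟨s, h⟩ := summable_iff_vanishing_norm.1 (hs ξ).summable (ε / (C ^ 2 + 1)) (by positivity)
    refine ⟨s, fun t ht => (hC ξ t).trans_lt ?_⟩
    calc _ ≤ (C ^ 2 + 1) *
          ‖∑ g ∈ t, B.act (σ g) (hinner B.carrier (ξ.val (σ g)) (ξ.val (σ g)))‖ := by
          gcongr; linarith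
      _ < (C ^ 2 + 1) * (ε / (C ^ 2 + 1)) := by gcongr; exact h t ht
      _ = ε := by field_simp
  LinearMap.mkContinuous
    { toFun := fun ξ => mk (fun g => L g (ξ.val (σ g))) (hL ξ) (hs' ξ)
      map_add' := fun ξ η => ext fun g => by
        rw [val_add, val_mk, val_mk, val_mk, val_add, _root_.map_add]
      map_smul' := fun c ξ => ext fun g => by
        rw [RingHom.id_apply, val_csmul, val_mk, val_mk, val_csmul, _root_.map_smul] }
    C fun ξ => by
      refine (sq_le_sq₀ (norm_nonneg _) (by positivity)).1 ?_
      rw [mul_pow, ← norm_hinner_self (B := B'.carrier), ← norm_hinner_self (B := B.carrier)]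
      have h1 := hasSum_hinner (mk (fun g => L g (ξ.val (σ g))) (hL ξ) (hs' ξ))
        (mk (fun g => L g (ξ.val (σ g))) (hL ξ) (hs' ξ))
      simp only [val_mk] at h1
      exact le_of_tendsto_of_tendsto' h1.norm ((hs ξ).norm.const_mul (C ^ 2)) (hC ξ)

theorem val_map (σ : G ≃ G) (L : G → X.E →ₗ[ℂ] X'.E) (C : ℝ) (hC0 : 0 ≤ C)
    (hL : ∀ (ξ : X.Induced) (g : G) (k : K),
      L (g * k) (ξ.val (σ (g * k))) = X'.u k⁻¹ (L g (ξ.val (σ g))))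
    (hC : ∀ (ξ : X.Induced) (F : Finset G),
      ‖∑ g ∈ F, B'.act g (hinner B'.carrier (L g (ξ.val (σ g))) (L g (ξ.val (σ g))))‖
        ≤ C ^ 2 * ‖∑ g ∈ F, B.act (σ g) (hinner B.carrier (ξ.val (σ g)) (ξ.val (σ g)))‖)
    (ξ : X.Induced) (g : G) : (map σ L C hC0 hL hC ξ).val g = L g (ξ.val (σ g)) :=
  val_mk _ _ _ g

end map

end Induced

end KasparovCycle

/-! ### Induced functions supported on one coset -/

namespace KasparovCycle

namespace Induced

variable {G : Type v} [Group G] [Countable G] {K : Subgroup G} {A : GradedGAlgebra.{w} K}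
variable {B : GradedGAlgebra.{u} G} {X : KasparovCycle A (B.res K)}

theorem hinner_u (k : K) (x y : X.E) : hinner B.carrier (X.u k x) (X.u k y)
    = B.act (k : G) (hinner B.carrier x y) := X.u_inner k x y

section single

variable [Finite K]

open Classical in
variable (X) in
theorem support_single_subset (g : G) (x : X.E) :
    (Function.support fun g' => B.act g' (hinner B.carrier
      (if h : g'⁻¹ * g ∈ K then X.u ⟨g'⁻¹ * g, h⟩ x else 0)
      (if h : g'⁻¹ * g ∈ K then X.u ⟨g'⁻¹ * g, h⟩ x else 0)))
      ⊆ Set.range fun k : K => g * k := by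
  intro g' hg'
  by_cases h : g'⁻¹ * g ∈ K
  · exact ⟨⟨_, h⟩⁻¹, by simp⟩
  · refine (hg' ?_).elim
    simp only [dif_neg h]
    rw [hzero_hinner, _root_.map_zero]

open Classical in
variable (X) in
/-- The function on the coset `gK` with value `x` at `g`. -/
noncomputable def single (g : G) (x : X.E) : X.Induced :=
  mk (fun g' => if h : g'⁻¹ * g ∈ K then X.u ⟨g'⁻¹ * g, h⟩ x else 0)
    (fun g' k => by
      have e : (g' * k)⁻¹ * g ∈ K ↔ g'⁻¹ * g ∈ K := by
        rw [mul_inv_rev, mul_assoc]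
        exact K.mul_mem_cancel_left (K.inv_mem k.2)
      by_cases h : g'⁻¹ * g ∈ K
      · rw [dif_pos h, dif_pos (e.2 h), ← X.u_mul_apply]
        congr 2
        exact Subtype.ext (by simp [mul_assoc])
      · rw [dif_neg h, dif_neg (mt e.1 h), _root_.map_zero])
    (summable_of_hasFiniteSupport ((Set.finite_range _).subset (support_single_subset X g x)))

theorem val_single_mul (g : G) (k : K) (x : X.E) : (single X g x).val (g * k) = X.u k⁻¹ x := by
  have h : (g * k : G)⁻¹ * g ∈ K := by simp
  rw [single, val_mk, dif_pos h]
  congr 2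
  exact Subtype.ext (by simp)

theorem val_single_self (g : G) (x : X.E) : (single X g x).val g = x := by
  have := val_single_mul g 1 x
  rwa [Subgroup.coe_one, mul_one, inv_one, X.u_one_apply] at this

theorem val_single_of_ne {g g' : G} (h : (QuotientGroup.mk g' : G ⧸ K) ≠ QuotientGroup.mk g)
    (x : X.E) : (single X g x).val g' = 0 := by
  rw [single, val_mk, dif_neg (mt QuotientGroup.eq.2 h)]

theorem val_eq_of_mk_eq {g g' : G} (h : (QuotientGroup.mk g' : G ⧸ K) = QuotientGroup.mk g) :
    ∃ k : K, g' = g * k := by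
  refine ⟨⟨g⁻¹ * g', QuotientGroup.eq.1 h.symm⟩, by simp⟩

open Classical in
theorem val_single_val (ξ : X.Induced) (g g' : G) : (single X g (ξ.val g)).val g'
    = if (QuotientGroup.mk g' : G ⧸ K) = QuotientGroup.mk g then ξ.val g' else 0 := by
  split_ifs with h
  · obtain ⟨k, rfl⟩ := val_eq_of_mk_eq h
    rw [val_single_mul, val_mul]
  · exact val_single_of_ne h _

theorem hinner_single (g : G) (x : X.E) (ξ : X.Induced) : hinner B.carrier (single X g x) ξ
    = (Nat.card K : ℂ) • B.act g (hinner B.carrier x (ξ.val g)) := by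
  have := Fintype.ofFinite K
  have hinj : Function.Injective fun k : K => g * (k : G) := fun k l h =>
    Subtype.ext (mul_left_cancel h)
  have h := hasSum_hinner (single X g x) ξ
  rw [← hinj.hasSum_iff fun g' hg' => by
    have : (QuotientGroup.mk g' : G ⧸ K) ≠ QuotientGroup.mk g := fun e => by
      obtain ⟨k, rfl⟩ := val_eq_of_mk_eq e
      exact hg' ⟨k, rfl⟩
    rw [val_single_of_ne this, hzero_hinner, _root_.map_zero]] at h
  refine h.unique ?_
  have h2 := hasSum_fintype fun _ : K => B.act g (hinner B.carrier x (ξ.val g))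
  rw [Finset.sum_const, Finset.card_univ, ← Nat.card_eq_fintype_card,
    ← Nat.cast_smul_eq_nsmul ℂ] at h2
  refine h2.congr_fun fun k => ?_
  change B.act (g * k) (hinner B.carrier ((single X g x).val (g * k)) (ξ.val (g * k))) = _
  rw [val_single_mul, val_mul, hinner_u, B.act_mul_apply, Subgroup.coe_inv, B.act_act_inv]

theorem single_add (g : G) (x y : X.E) : single X g (x + y) = single X g x + single X g y :=
  hinner_ext (B := B.carrier) fun ξ => by
    rw [← star_hinner, hinner_single, hinner_add, ← star_hinner (single X g x),
      ← star_hinner (single X g y), hinner_single, hinner_single, ← star_add, ← smul_add,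
      ← _root_.map_add,
      hinner_add_left]

theorem single_smul (g : G) (c : ℂ) (x : X.E) : single X g (c • x) = c • single X g x :=
  hinner_ext (B := B.carrier) fun ξ => by
    rw [← star_hinner, hinner_single, hinner_csmul, ← star_hinner (single X g x), hinner_single,
      hinner_csmul_left', _root_.map_smul, smul_comm, star_smul, star_star]

theorem single_hsmul (g : G) (x : X.E) (b : B) :
    single X g (x <• b) = single X g x <• B.act g b :=
  hinner_ext (B := B.carrier) fun ξ => by
    rw [← star_hinner, hinner_single, hinner_smul, ← star_hinner (single X g x), hinner_single,
      hinner_smul_left, map_mul, map_star, ← mul_smul_comm, star_mul, star_star]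

variable (X) in
/-- `single` as a continuous linear map. -/
noncomputable def singleL (g : G) : X.E →L[ℂ] X.Induced :=
  LinearMap.mkContinuous
    { toFun := single X g, map_add' := single_add g, map_smul' := single_smul g }
    (Nat.card K) fun x => by
      have h1 : (1 : ℝ) ≤ Nat.card K := Nat.one_le_cast.2 Nat.card_pos
      refine (sq_le_sq₀ (norm_nonneg _) (by positivity)).1 ?_
      change ‖single X g x‖ ^ 2 ≤ _
      rw [← norm_hinner_self (B := B.carrier), hinner_single, val_single_self, norm_smul,
        B.norm_act, norm_hinner_self, mul_pow, sq (Nat.card K : ℝ)]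
      gcongr
      rw [Complex.norm_natCast]
      nlinarith

/-- The functions supported on one coset span a dense subspace of the induced module. -/
theorem mem_of_single_mem {M : Submodule ℂ X.Induced} (hM : IsClosed (M : Set X.Induced))
    (h : ∀ g x, single X g x ∈ M) (ξ : X.Induced) : ξ ∈ M := by
  classical
  refine hM.closure_subset_iff.2 le_rfl (Metric.mem_closure_iff.2 fun ε hε => ?_)
  obtain ⟨s, hs⟩ := ξ.exists_norm_le (half_pos hε)
  let c : Finset (G ⧸ K) := s.image QuotientGroup.mk
  refine ⟨∑ x ∈ c, single X x.out (ξ.val x.out), M.sum_mem fun x _ => h _ _, ?_⟩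
  have hv (g : G) : (∑ x ∈ c, single X x.out (ξ.val x.out)).val g
      = if (QuotientGroup.mk g : G ⧸ K) ∈ c then ξ.val g else 0 := by
    change valL X g _ = _
    rw [_root_.map_sum]
    change ∑ x ∈ c, (single X x.out (ξ.val x.out)).val g = _
    simp only [val_single_val, QuotientGroup.out_eq', Finset.sum_ite_eq]
  rw [dist_eq_norm]
  refine (hs _ (fun g => ?_) fun g hg => ?_).trans_lt (half_lt_self hε)
  · rw [val_sub, hv]
    split_ifs
    · exact Or.inr (sub_self _)
    · exact Or.inl (sub_zero _)
  · rw [val_sub, hv, if_pos (Finset.mem_image_of_mem _ hg), sub_self]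

theorem isCountablyGenerated : IsCountablyGenerated B.carrier X.Induced := by
  obtain ⟨s, hs, hd⟩ := X.countablyGenerated
  refine ⟨⋃ g : G, singleL X g '' s, Set.countable_iUnion fun g => hs.image _, fun ξ => ?_⟩
  refine mem_of_single_mem (Submodule.isClosed_topologicalClosure _) (fun g x => ?_) ξ
  exact mem_topologicalClosure_of_generators (singleL X g) hd
    (M := Submodule.span ℂ {z : X.Induced | ∃ y ∈ ⋃ g : G, singleL X g '' s, ∃ b : B, z = y <• b})
    (fun x hx b => Submodule.le_topologicalClosure _ (Submodule.subset_span
      ⟨single X g x, Set.mem_iUnion.2 ⟨g, x, hx, rfl⟩, B.act g b, single_hsmul g x b⟩)) x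

variable (X) in
/-- The operator that applies `S` at the point `g` and vanishes on the other cosets. -/
noncomputable def pointOp (g : G) (S : X.E →L[ℂ] X.E) : X.Induced →L[ℂ] X.Induced :=
  (singleL X g).comp (S.comp (valL X g))

theorem pointOp_mem_compactOps (g : G) {k : X.E →L[ℂ] X.E} (hk : k ∈ compactOps B.carrier X.E) :
    pointOp X g k ∈ compactOps B.carrier X.Induced := by
  let L : (X.E →L[ℂ] X.E) →ₗ[ℂ] (X.Induced →L[ℂ] X.Induced) :=
    { toFun := pointOp X g
      map_add' := fun k l => ContinuousLinearMap.ext fun x => _root_.map_add (singleL X g) _ _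
      map_smul' := fun c k => ContinuousLinearMap.ext fun x => _root_.map_smul (singleL X g) c _ }
  have hL : Continuous L :=
    (L.mkContinuous (‖singleL X g‖ * ‖valL X g‖) fun k => by
      refine (ContinuousLinearMap.opNorm_comp_le _ _).trans ?_
      rw [mul_assoc, mul_comm ‖valL X g‖]
      gcongr
      exact ContinuousLinearMap.opNorm_comp_le _ _).continuous
  have hc : (Nat.card K : ℂ) ≠ 0 := Nat.cast_ne_zero.2 Nat.card_pos.ne'
  refine mem_compactOps_of_map (B := B.carrier) L hL (fun x y => ?_) hk
  have : L (rankOne B.carrier x y)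
      = (Nat.card K : ℂ)⁻¹ • rankOne B.carrier (single X g x) (single X g y) :=
    ContinuousLinearMap.ext fun ξ => by
      change single X g (x <• hinner B.carrier y (ξ.val g))
        = (Nat.card K : ℂ)⁻¹ • (single X g x <• hinner B.carrier (single X g y) ξ)
      rw [single_hsmul, hinner_single, hsmul_csmul', smul_smul, inv_mul_cancel₀ hc, one_smul]
  rw [this]
  exact Submodule.smul_mem _ _ (rankOne_mem _ _)

end single

/-! ### The operators of the induced cycle -/

theorem norm_sum_act_le (F : Finset G) {a b : G → B} {C : ℝ} (h0 : ∀ g, 0 ≤ MulOpposite.op (a g))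
    (h : ∀ g, MulOpposite.op (a g) ≤ ((C ^ 2 : ℝ) : ℂ) • MulOpposite.op (b g)) :
    ‖∑ g ∈ F, B.act g (a g)‖ ≤ C ^ 2 * ‖∑ g ∈ F, B.act g (b g)‖ := by
  have h1 : MulOpposite.op (∑ g ∈ F, B.act g (a g))
      ≤ MulOpposite.op (((C ^ 2 : ℝ) : ℂ) • ∑ g ∈ F, B.act g (b g)) := by
    rw [Finset.smul_sum, Finset.op_sum, Finset.op_sum]
    refine Finset.sum_le_sum fun g _ => ?_
    rw [← _root_.map_smul]
    exact op_map_le _ (h g)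
  have h2 : 0 ≤ MulOpposite.op (∑ g ∈ F, B.act g (a g)) := by
    rw [Finset.op_sum]
    exact Finset.sum_nonneg fun g _ => op_map_nonneg _ (h0 g)
  have h3 := CStarAlgebra.norm_le_norm_of_nonneg_of_le h2 h1
  rw [norm_op, norm_op, norm_smul] at h3
  simpa using h3

variable (X) in
/-- The grading operator of the induced module. -/
noncomputable def gr : X.Induced →L[ℂ] X.Induced :=
  map (Equiv.refl G) (fun _ => X.gr) 1 zero_le_one
    (fun ξ g k => by
      change X.gr (ξ.val (g * k)) = X.u k⁻¹ (X.gr (ξ.val g))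
      rw [val_mul, X.u_gr])
    fun ξ F => by
      have h (g : G) : B.act g (hinner B.carrier (X.gr (ξ.val g)) (X.gr (ξ.val g)))
          = B.grading (B.act g (hinner B.carrier (ξ.val g) (ξ.val g))) := by
        rw [B.grading_act]
        exact congrArg (B.act g) (X.gr_inner (ξ.val g) (ξ.val g))
      rw [one_pow, one_mul]
      change ‖∑ g ∈ F, B.act g (hinner B.carrier (X.gr (ξ.val g)) (X.gr (ξ.val g)))‖ ≤ _
      simp only [h]
      rw [← _root_.map_sum]
      exact NonUnitalStarAlgHom.norm_apply_le _ _

theorem val_gr (ξ : X.Induced) (g : G) : (gr X ξ).val g = X.gr (ξ.val g) := val_map _ _ _ _ _ _ _ _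

variable (X) in
/-- The translation of functions by an element of the group. -/
noncomputable def translation (h : G) : X.Induced →L[ℂ] X.Induced :=
  map (Equiv.mulLeft h⁻¹) (fun _ => LinearMap.id) 1 zero_le_one
    (fun ξ g k => by
      change ξ.val (h⁻¹ * (g * k)) = X.u k⁻¹ (ξ.val (h⁻¹ * g))
      rw [← mul_assoc, val_mul])
    fun ξ F => by
      have e (g : G) : B.act g (hinner B.carrier (ξ.val (h⁻¹ * g)) (ξ.val (h⁻¹ * g)))
          = B.act h (B.act (h⁻¹ * g) (hinner B.carrier (ξ.val (h⁻¹ * g)) (ξ.val (h⁻¹ * g)))) := by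
        rw [← B.act_mul_apply, mul_inv_cancel_left]
      rw [one_pow, one_mul]
      change ‖∑ g ∈ F, B.act g (hinner B.carrier (ξ.val (h⁻¹ * g)) (ξ.val (h⁻¹ * g)))‖ ≤ _
      simp only [e]
      rw [← _root_.map_sum]
      exact NonUnitalStarAlgHom.norm_apply_le _ _

theorem val_translation (h : G) (ξ : X.Induced) (g : G) :
    (translation X h ξ).val g = ξ.val (h⁻¹ * g) := val_map _ _ _ _ _ _ _ _

/-- The pointwise application of an adjointable operator that commutes with the subgroup. -/
noncomputable def pointwise {S S' : X.E →L[ℂ] X.E} (hS : HasAdjoint B.carrier S S')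
    (hu : ∀ k x, S (X.u k x) = X.u k (S x)) : X.Induced →L[ℂ] X.Induced :=
  map (Equiv.refl G) (fun _ => S) ‖S‖ (norm_nonneg S)
    (fun ξ g k => by
      change S (ξ.val (g * k)) = X.u k⁻¹ (S (ξ.val g))
      rw [val_mul, hu])
    fun ξ F => norm_sum_act_le F (fun _ => CStarModule.inner_self_nonneg)
      fun g => hS.inner_self_le (ξ.val g)

theorem val_pointwise {S S' : X.E →L[ℂ] X.E} (hS : HasAdjoint B.carrier S S')
    (hu : ∀ k x, S (X.u k x) = X.u k (S x)) (ξ : X.Induced) (g : G) :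
    (pointwise hS hu ξ).val g = S (ξ.val g) := val_map _ _ _ _ _ _ _ _

theorem hasAdjoint_pointwise {S S' : X.E →L[ℂ] X.E} (hS : HasAdjoint B.carrier S S')
    (hu : ∀ k x, S (X.u k x) = X.u k (S x)) (hu' : ∀ k x, S' (X.u k x) = X.u k (S' x)) :
    HasAdjoint B.carrier (pointwise hS hu) (pointwise hS.symm hu') := fun ξ η => by
  refine (hasSum_hinner _ _).unique ((hasSum_hinner _ _).congr_fun fun g => ?_)
  rw [val_pointwise, val_pointwise, hS]

section multiplication

variable [TopologicalSpace G] [DiscreteTopology G]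

variable (X) in
/-- The multiplication by a function on `G/K`. -/
noncomputable def multiplication (f : C₀(G ⧸ K, ℂ)) : X.Induced →L[ℂ] X.Induced :=
  map (Equiv.refl G) (fun g => f (QuotientGroup.mk g) • LinearMap.id) ‖f‖ (norm_nonneg f)
    (fun ξ g k => by
      change f (QuotientGroup.mk (g * k)) • ξ.val (g * k)
        = X.u k⁻¹ (f (QuotientGroup.mk g) • ξ.val g)
      rw [val_mul, _root_.map_smul, QuotientGroup.mk_mul_of_mem g k.2])
    fun ξ F => norm_sum_act_le F (fun _ => CStarModule.inner_self_nonneg) fun g => by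
      set c := f (QuotientGroup.mk g)
      change MulOpposite.op (hinner B.carrier (c • ξ.val g) (c • ξ.val g)) ≤ _
      have h1 : MulOpposite.op (hinner B.carrier (c • ξ.val g) (c • ξ.val g))
          = ((‖c‖ ^ 2 : ℝ) : ℂ) • MulOpposite.op (hinner B.carrier (ξ.val g) (ξ.val g)) := by
        rw [hinner_csmul, hinner_csmul_left', smul_smul, op_smul]
        congr 1
        rw [Complex.ofReal_pow, ← Complex.mul_conj']
        rfl
      rw [h1]
      have h2 : (0 : (B.carrier)ᵐᵒᵖ) ≤ MulOpposite.op (hinner B.carrier (ξ.val g) (ξ.val g)) :=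
        CStarModule.inner_self_nonneg
      have h3 : ‖c‖ ^ 2 ≤ ‖f‖ ^ 2 := by
        gcongr
        exact ProjectionFamily.norm_apply_le K f _
      rw [Complex.coe_smul, Complex.coe_smul]
      exact smul_le_smul_of_nonneg_right h3 h2

theorem val_multiplication (f : C₀(G ⧸ K, ℂ)) (ξ : X.Induced) (g : G) :
    (multiplication X f ξ).val g = f (QuotientGroup.mk g) • ξ.val g := val_map _ _ _ _ _ _ _ _

theorem hinner_multiplication (f : C₀(G ⧸ K, ℂ)) (ξ η : X.Induced) :
    hinner B.carrier (multiplication X f ξ) η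
      = hinner B.carrier ξ (multiplication X (star f) η) := by
  refine (hasSum_hinner _ _).unique ((hasSum_hinner _ _).congr_fun fun g => ?_)
  rw [val_multiplication, val_multiplication, hinner_csmul_left', hinner_csmul]
  rfl

end multiplication

end Induced

end KasparovCycle

/-! ### The induced cycle -/

namespace KasparovCycle

section normalized

variable {K : Type v} [Group K] {B : GradedGAlgebra.{u} K}
variable {X : KasparovCycle (GradedGAlgebra.complex K) B}

theorem Tadj_u_of_T_u {A : GradedGAlgebra.{w} K} {X : KasparovCycle A B}
    (h : ∀ k x, X.T (X.u k x) = X.u k (X.T x)) (k : K) (x : X.E) :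
    X.Tadj (X.u k x) = X.u k (X.Tadj x) := by
  have e : X.u k * X.T * X.u k⁻¹ = X.T := ContinuousLinearMap.ext fun y => by
    change X.u k (X.T (X.u k⁻¹ y)) = X.T y
    rw [h, X.u_u_inv]
  have h1 := X.hasAdjoint_conj X.hasAdjoint_T k
  rw [e] at h1
  have h2 : X.u k (X.Tadj (X.u k⁻¹ (X.u k x))) = X.Tadj (X.u k x) :=
    DFunLike.congr_fun (h1.unique X.hasAdjoint_T) (X.u k x)
  rw [← h2, X.u_inv_u]

namespace IsNormalized

theorem Φ_apply (hX : X.IsNormalized) (a : ℂ) (x : X.E) : X.Φ a x = a • x := by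
  have e : a = a • (1 : ℂ) := (mul_one a).symm
  calc X.Φ a x = X.Φ (a • (1 : ℂ)) x := congrArg (fun b => X.Φ b x) e
    _ = a • X.Φ (1 : ℂ) x := X.Φ_smul_apply a (1 : ℂ) x
    _ = a • x := by rw [hX.1]

theorem mem_compactOps_of_mul (hX : X.IsNormalized) {S : X.E →L[ℂ] X.E}
    (h : S * X.Φ (1 : ℂ) ∈ compactOps B.carrier X.E) : S ∈ compactOps B.carrier X.E := by
  have e : S * X.Φ (1 : ℂ) = S := ContinuousLinearMap.ext fun x => congrArg S (hX.1 x)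
  rwa [e] at h

end IsNormalized

end normalized

namespace Induced

variable {G : Type v} [Group G] [Countable G] [TopologicalSpace G] [DiscreteTopology G]
variable {K : Subgroup G} [Finite K] {B : GradedGAlgebra.{u} G}

section

variable {A : GradedGAlgebra.{w} K} (X : KasparovCycle A (B.res K))

/-- The action of the group by translation. -/
noncomputable def translationHom : G →* (X.Induced →L[ℂ] X.Induced) where
  toFun := translation X
  map_one' := ContinuousLinearMap.ext fun ξ => ext fun g => by
    rw [val_translation, inv_one, one_mul]; rfl
  map_mul' h k := ContinuousLinearMap.ext fun ξ => ext fun g => by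
    change (translation X (h * k) ξ).val g = (translation X h (translation X k ξ)).val g
    rw [val_translation, val_translation, val_translation, mul_inv_rev, mul_assoc]

/-- The representation of `C₀(G/K)` by multiplication. -/
noncomputable def multiplicationHom :
    C₀(G ⧸ K, ℂ) →ₙₐ[ℂ] (X.Induced →L[ℂ] X.Induced) where
  toFun := multiplication X
  map_smul' c f := ContinuousLinearMap.ext fun ξ => ext fun g => by
    change (multiplication X (c • f : C₀(G ⧸ K, ℂ)) ξ).val g = (c • multiplication X f ξ).val g
    rw [val_multiplication, val_csmul, val_multiplication, smul_smul]
    rfl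
  map_zero' := ContinuousLinearMap.ext fun ξ => ext fun g => by
    change (multiplication X (0 : C₀(G ⧸ K, ℂ)) ξ).val g = 0
    rw [val_multiplication]
    exact zero_smul ℂ _
  map_add' f f' := ContinuousLinearMap.ext fun ξ => ext fun g => by
    change (multiplication X (f + f' : C₀(G ⧸ K, ℂ)) ξ).val g
      = (multiplication X f ξ + multiplication X f' ξ).val g
    rw [val_multiplication, val_add, val_multiplication, val_multiplication, ← add_smul]
    rfl
  map_mul' f f' := ContinuousLinearMap.ext fun ξ => ext fun g => by
    change (multiplication X (f * f' : C₀(G ⧸ K, ℂ)) ξ).val g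
      = (multiplication X f (multiplication X f' ξ)).val g
    rw [val_multiplication, val_multiplication, val_multiplication, smul_smul]
    rfl

theorem hasAdjoint_multiplication (f : C₀(G ⧸ K, ℂ)) :
    HasAdjoint B.carrier (multiplication X f) (multiplication X (star f)) :=
  hinner_multiplication f

theorem continuous_multiplicationHom : Continuous (multiplicationHom X) := by
  refine AddMonoidHomClass.continuous_of_bound (multiplicationHom X) 1 fun f => ?_
  rw [one_mul]
  exact norm_representation_le (B := B.carrier) (multiplicationHom X)
    (fun f => hasAdjoint_multiplication X f) f

variable {X}

/-- A pointwise operator with compact values has compact products with functions on `G/K`: this is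
clear for the characteristic functions of points, which span a dense subspace. -/
theorem mul_multiplication_mem_compactOps {R : X.Induced →L[ℂ] X.Induced} {S : X.E →L[ℂ] X.E}
    (hR : ∀ ξ g, (R ξ).val g = S (ξ.val g)) (hS : S ∈ compactOps B.carrier X.E)
    (f : GradedGAlgebra.cosets K) :
    R * multiplicationHom X f ∈ compactOps B.carrier X.Induced := by
  refine (ProjectionFamily.cosets K).mem_of_forall (Submodule.isClosed_topologicalClosure _)
    (LinearMap.mulLeft ℂ R ∘ₗ (multiplicationHom X :
      C₀(G ⧸ K, ℂ) →ₗ[ℂ] (X.Induced →L[ℂ] X.Induced)))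
    (continuous_const.mul (continuous_multiplicationHom X)) (fun c => ?_) f
  induction c using QuotientGroup.induction_on with
  | H g =>
  classical
  have e : R * multiplication X (GradedGAlgebra.delta K (QuotientGroup.mk g)) = pointOp X g S := by
    refine ContinuousLinearMap.ext fun ξ => ext fun g' => ?_
    change (R (multiplication X _ ξ)).val g' = (single X g (S (ξ.val g))).val g'
    rw [← hR, val_single_val, hR, hR, val_multiplication, GradedGAlgebra.delta_apply]
    split_ifs
    · rw [one_smul]
    · rw [zero_smul, _root_.map_zero]
  change R * multiplication X (GradedGAlgebra.delta K (QuotientGroup.mk g)) ∈ _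
  rw [e]
  exact pointOp_mem_compactOps g hS

end

end Induced

section induced

variable {G : Type v} [Group G] [Countable G] [TopologicalSpace G] [DiscreteTopology G]
variable {K : Subgroup G} [Finite K] {B : GradedGAlgebra.{u} G}
variable (X : KasparovCycle (GradedGAlgebra.complex K) (B.res K)) (hX : X.IsNormalized)

open Induced

theorem hasAdjoint_T_res {A : GradedGAlgebra.{w} K} (X : KasparovCycle A (B.res K)) :
    HasAdjoint B.carrier X.T X.Tadj := X.T_adjoint

/-- The pointwise application of the operator of a normalized cycle. -/
noncomputable def Induced.operator : X.Induced →L[ℂ] X.Induced :=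
  pointwise X.hasAdjoint_T_res hX.2

theorem Induced.val_operator (ξ : X.Induced) (g : G) :
    (Induced.operator X hX ξ).val g = X.T (ξ.val g) := val_pointwise _ _ _ _

/-- The pointwise application of the adjoint of the operator of a normalized cycle. -/
noncomputable def Induced.operatorAdj : X.Induced →L[ℂ] X.Induced :=
  pointwise X.hasAdjoint_T_res.symm (Tadj_u_of_T_u hX.2)

theorem Induced.val_operatorAdj (ξ : X.Induced) (g : G) :
    (Induced.operatorAdj X hX ξ).val g = X.Tadj (ξ.val g) := val_pointwise _ _ _ _

/-- The cycle induced from a normalized cycle. -/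
noncomputable def induced : KasparovCycle (GradedGAlgebra.cosets K) B where
  E := X.Induced
  countablyGenerated := Induced.isCountablyGenerated
  gr := Induced.gr X
  gr_gr ξ := Induced.ext fun g => by rw [val_gr, val_gr, X.gr_gr]
  gr_inner ξ η := by
    refine (hasSum_hinner _ _).unique (((hasSum_hinner ξ η).map B.grading
      (GradedGAlgebra.continuous_starHom _)).congr_fun fun g => ?_)
    rw [val_gr, val_gr, Function.comp_apply, B.grading_act]
    exact congrArg (B.act g) (X.gr_inner _ _)
  gr_smul ξ b := Induced.ext fun g => by
    rw [val_gr, Induced.val_hsmul, Induced.val_hsmul, val_gr, ← B.grading_act]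
    exact X.gr_smul _ _
  u := translationHom X
  u_inner h ξ η := by
    change hinner B.carrier (translation X h ξ) (translation X h η) = _
    have h1 := (Equiv.mulLeft h).hasSum_iff.2
      (hasSum_hinner (translation X h ξ) (translation X h η))
    refine h1.unique (((hasSum_hinner ξ η).map (B.act h)
      (GradedGAlgebra.continuous_starHom _)).congr_fun fun g => ?_)
    change B.act (h * g) (hinner B.carrier ((translation X h ξ).val (h * g))
      ((translation X h η).val (h * g))) = B.act h (B.act g _)
    rw [val_translation, val_translation, inv_mul_cancel_left, B.act_mul_apply]
  u_smul h ξ b := Induced.ext fun g => by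
    change (translation X h (ξ <• b)).val g = (translation X h ξ <• B.act h b).val g
    rw [val_translation, Induced.val_hsmul, Induced.val_hsmul, val_translation, mul_inv_rev,
      inv_inv, B.act_mul_apply]
  u_gr h ξ := Induced.ext fun g => by
    change (translation X h (Induced.gr X ξ)).val g = (Induced.gr X (translation X h ξ)).val g
    rw [val_translation, val_gr, val_gr, val_translation]
  Φ := multiplicationHom X
  Φ_adjoint f := hasAdjoint_multiplication X f
  Φ_gr := fun (f : C₀(G ⧸ K, ℂ)) ξ => Induced.ext fun g => by
    change (Induced.gr X (multiplication X f ξ)).val g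
      = (multiplication X f (Induced.gr X ξ)).val g
    rw [val_gr, val_multiplication, val_multiplication, val_gr, map_smul]
  Φ_u := fun h (f : C₀(G ⧸ K, ℂ)) ξ => Induced.ext fun g => by
    change (translation X h (multiplication X f ξ)).val g
      = (multiplication X (GradedGAlgebra.translate K h f) (translation X h ξ)).val g
    rw [val_translation, val_multiplication, val_multiplication, val_translation]
    rfl
  T := operator X hX
  Tadj := operatorAdj X hX
  T_adjoint := hasAdjoint_pointwise X.hasAdjoint_T_res hX.2 (Tadj_u_of_T_u hX.2)
  T_gr ξ := Induced.ext fun g => by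
    rw [val_gr, val_operator, val_neg, val_operator, val_gr, X.T_gr]
  compact_sub_adj := mul_multiplication_mem_compactOps (S := X.T - X.Tadj)
    (fun ξ g => by
      change (operator X hX ξ - operatorAdj X hX ξ).val g = _
      rw [val_sub, val_operator, val_operatorAdj]; rfl)
    (hX.mem_compactOps_of_mul (X.compact_sub_adj (1 : ℂ)))
  compact_sq := mul_multiplication_mem_compactOps (S := X.T * X.T - 1)
    (fun ξ g => by
      change (operator X hX (operator X hX ξ) - ξ).val g = _
      rw [val_sub, val_operator, val_operator]; rfl)
    (hX.mem_compactOps_of_mul (X.compact_sq (1 : ℂ)))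
  compact_equivariance h f := by
    have e : translationHom X h * operator X hX * translationHom X h⁻¹
        = operator X hX := ContinuousLinearMap.ext fun ξ => Induced.ext fun g => by
      change (translation X h (operator X hX (translation X h⁻¹ ξ))).val g = _
      rw [val_translation, val_operator, val_operator, val_translation, inv_inv,
        mul_inv_cancel_left]
    rw [e, sub_self, zero_mul]
    exact zero_mem _
  compact_commutator := fun (f : C₀(G ⧸ K, ℂ)) => by
    have e : operator X hX * multiplicationHom X f
        = multiplicationHom X f * operator X hX :=
      ContinuousLinearMap.ext fun ξ => Induced.ext fun g => by
        change (operator X hX (multiplication X f ξ)).val g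
          = (multiplication X f (operator X hX ξ)).val g
        rw [val_operator, val_multiplication, val_multiplication, val_operator, map_smul]
    change operator X hX * multiplicationHom X f
      - multiplicationHom X f * operator X hX ∈ _
    rw [e, sub_self]
    exact zero_mem _

/-- The inner product of the induced module is not divided by `|K|`, hence the factor `√|K|` in the
comparison map. -/
theorem isInduced_induced : IsInduced X (X.induced hX) := by
  have hK : (0 : ℝ) < Nat.card K := Nat.cast_pos.2 Nat.card_pos
  have hK' : (Nat.card K : ℂ) ≠ 0 := Nat.cast_ne_zero.2 Nat.card_pos.ne'
  let c : ℂ := (Real.sqrt (Nat.card K) : ℝ)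
  have hc2 : star c * c = Nat.card K := by
    change (starRingEnd ℂ) _ * _ = _
    rw [Complex.conj_ofReal, ← Complex.ofReal_mul, Real.mul_self_sqrt hK.le, Complex.ofReal_natCast]
  have hc : c ≠ 0 := fun h => hK' (by rw [← hc2, h, mul_zero])
  have hin (g : G) (x y : X.E) : B.act g (hinner B.carrier (c • x) (c • y))
      = (Nat.card K : ℂ) • B.act g (hinner B.carrier x y) := by
    rw [hinner_csmul, hinner_csmul_left', smul_smul, mul_comm, hc2, map_smul]
  let ι : X.Induced →ₗ[ℂ] (G → X.E) :=
    { toFun := fun ξ g => c • ξ.val g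
      map_add' := fun ξ η => funext fun g => smul_add c _ _
      map_smul' := fun d ξ => funext fun g => by
        change c • d • ξ.val g = d • c • ξ.val g
        rw [smul_smul, smul_smul, mul_comm] }
  refine ⟨ι, fun ξ η h => Induced.ext (X := X) fun g => smul_right_injective _ hc (congrFun h g),
    Set.ext fun f => ⟨?_, fun ⟨h1, h2⟩ => ?_⟩, fun (ξ η : X.Induced) => ?_,
    fun (ξ : X.Induced) b g => ?_, fun (ξ : X.Induced) g => ?_, fun f (ξ : X.Induced) g => ?_,
    fun h (ξ : X.Induced) g => ?_, fun (ξ : X.Induced) g => ?_⟩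
  · rintro ⟨ξ, rfl⟩
    change X.Induced at ξ
    refine ⟨fun g k => ?_, ?_⟩
    · exact (congrArg (c • ·) (ξ.val_mul g k)).trans (map_smul (X.u k⁻¹) c _).symm
    · exact ((hasSum_hinner ξ ξ).summable.const_smul (Nat.card K : ℂ)).congr fun g =>
        (hin g _ _).symm
  · have h3 : Summable fun g => B.act g (hinner B.carrier (c⁻¹ • f g) (c⁻¹ • f g)) := by
      have e (g) : (Nat.card K : ℂ)⁻¹ • B.act g (hinner B.carrier (f g) (f g))
          = B.act g (hinner B.carrier (c⁻¹ • f g) (c⁻¹ • f g)) := by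
        have := hin g (c⁻¹ • f g) (c⁻¹ • f g)
        rw [smul_inv_smul₀ hc] at this
        rw [this, inv_smul_smul₀ hK']
      exact (h2.const_smul (Nat.card K : ℂ)⁻¹).congr e
    refine ⟨Induced.mk (X := X) (fun g => c⁻¹ • f g) (fun g k => by rw [h1, map_smul]) h3,
      funext fun g => ?_⟩
    exact (congrArg (c • ·) (Induced.val_mk (X := X) _ _ _ g)).trans (smul_inv_smul₀ hc (f g))
  · refine (hasSum_hinner ξ η).congr_fun fun g => ?_
    exact (congrArg ((Nat.card K : ℂ)⁻¹ • ·) (hin g _ _)).trans (inv_smul_smul₀ hK' _)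
  · exact (congrArg (c • ·) (ξ.val_hsmul b g)).trans (hsmul_csmul (B := B.carrier) _ _ c).symm
  · exact (congrArg (c • ·) (val_gr ξ g)).trans (map_smul X.gr c _).symm
  · refine (congrArg (c • ·) (val_multiplication f ξ g)).trans ?_
    change c • f _ • ξ.val g = f _ • c • ξ.val g
    rw [smul_smul, smul_smul, mul_comm]
  · exact congrArg (c • ·) (val_translation h ξ g)
  · exact (congrArg (c • ·) (val_operator X hX ξ g)).trans (map_smul X.T c _).symm

end induced

end KasparovCycle

/-! ### Evaluation of induced cycles -/

section approximateUnit

variable {B : Type u} [NonUnitalCStarAlgebra B]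

theorem exists_norm_sub_mul_le (a : B) {ε : ℝ} (hε : 0 < ε) :
    ∃ e : B, ‖e‖ ≤ 1 ∧ ‖a - a * e‖ ≤ ε := by
  let _ : PartialOrder B := CStarAlgebra.spectralOrder B
  have : StarOrderedRing B := CStarAlgebra.spectralOrderedRing B
  have hu := CStarAlgebra.increasingApproximateUnit B
  obtain ⟨e, h1, h2⟩ := (hu.eventually_norm.and
    (Metric.tendsto_nhds.1 (hu.tendsto_mul_left a) ε hε)).exists
  rw [dist_comm, dist_eq_norm] at h2
  exact ⟨e, h1, h2.le⟩

variable [PartialOrder Bᵐᵒᵖ] [StarOrderedRing Bᵐᵒᵖ]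
variable {E : Type w} [NormedAddCommGroup E] [NormedSpace ℂ E] [SMul Bᵐᵒᵖ E] [CStarModule Bᵐᵒᵖ E]

theorem hinner_sub_hsmul (x : E) (e : B) : hinner B (x - x <• e) (x - x <• e)
    = (hinner B x x - hinner B x x * e) - star e * (hinner B x x - hinner B x x * e) := by
  rw [hinner_sub, hinner_sub_left, hinner_sub_left, hinner_smul_left, hinner_smul, hinner_smul,
    hinner_smul_left]
  noncomm_ring

/-- The right multiplications by an approximate unit converge to the identity. -/
theorem exists_norm_sub_hsmul_le (x : E) {ε : ℝ} (hε : 0 < ε) :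
    ∃ e : B, ‖e‖ ≤ 1 ∧ ‖x - x <• e‖ ≤ ε := by
  obtain ⟨e, h1, h2⟩ := exists_norm_sub_mul_le (hinner B x x) (ε := ε ^ 2 / 2) (by positivity)
  refine ⟨e, h1, (sq_le_sq₀ (norm_nonneg _) hε.le).1 ?_⟩
  rw [← norm_hinner_self (B := B), hinner_sub_hsmul]
  have h3 := norm_sub_le (hinner B x x - hinner B x x * e)
    (star e * (hinner B x x - hinner B x x * e))
  have h4 := norm_mul_le (star e) (hinner B x x - hinner B x x * e)
  rw [norm_star] at h4
  nlinarith [norm_nonneg (hinner B x x - hinner B x x * e)]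

end approximateUnit

section fibre

open unitInterval

variable {G : Type v} [Group G] {B : GradedGAlgebra.{u} G}

theorem GradedGAlgebra.norm_evalAt_le (t : I) (f : B.path) : ‖B.evalAt t f‖ ≤ ‖f‖ :=
  ContinuousMap.norm_coe_le_norm (f : C(I, B.carrier)) t

theorem GradedGAlgebra.continuous_evalAt (t : I) : Continuous (B.evalAt t) :=
  ContinuousEvalConst.continuous_eval_const (F := C(I, B.carrier)) t

variable {W : Type w} [NormedAddCommGroup W] [NormedSpace ℂ W] [SMul (B.path.carrier)ᵐᵒᵖ W]
  [CStarModule (B.path.carrier)ᵐᵒᵖ W]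
variable {F : Type w'} [NormedAddCommGroup F] [NormedSpace ℂ F] [SMul (B.carrier)ᵐᵒᵖ F]
  [CStarModule (B.carrier)ᵐᵒᵖ F]

theorem norm_le_of_hinner_evalAt {t : I} {π : W →ₗ[ℂ] F}
    (h : ∀ x y, hinner B.carrier (π x) (π y) = B.evalAt t (hinner B.path.carrier x y)) (x : W) :
    ‖π x‖ ≤ ‖x‖ := by
  refine (sq_le_sq₀ (norm_nonneg _) (norm_nonneg _)).1 ?_
  rw [← norm_hinner_self (B := B.carrier), h, ← norm_hinner_self (B := B.path.carrier)]
  exact B.norm_evalAt_le t _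

/-- Elements of the range of the evaluation map of a Hilbert `C([0,1], B)`-module have preimages of
comparable norm: a given preimage is multiplied by a function that cuts its norm down away from
`t`. -/
theorem exists_norm_le_of_hinner_evalAt {t : I} {π : W →ₗ[ℂ] F}
    (h : ∀ x y, hinner B.carrier (π x) (π y) = B.evalAt t (hinner B.path.carrier x y)) (x : W) :
    ∃ y, π y = π x ∧ ‖y‖ ≤ 2 * ‖π x‖ := by
  rcases (norm_nonneg (π x)).eq_or_lt with h0 | h0
  · exact ⟨0, by rw [map_zero, norm_eq_zero.1 h0.symm], by rw [norm_zero]; positivity⟩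
  obtain ⟨e, he, hx⟩ := exists_norm_sub_hsmul_le (B := B.path.carrier) x h0
  let a : C(I, B.carrier) := hinner B.path.carrier x x
  let e' : C(I, B.carrier) := e
  set m := ‖π x‖ ^ 2
  have hm : 0 < m := by positivity
  have ha : ‖a t‖ = m := by
    change ‖B.evalAt t (hinner B.path.carrier x x)‖ = ‖π x‖ ^ 2
    rw [← h, norm_hinner_self]
  let φ : C(I, ℝ) := ⟨fun s => m / max m ‖a s‖,
    continuous_const.div (by fun_prop) fun s => (hm.trans_le (le_max_left _ _)).ne'⟩
  have hφ (s : I) : φ s = m / max m ‖a s‖ := rfl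
  have hφt : φ t = 1 := by rw [hφ, ha, max_self, div_self hm.ne']
  have hφs (s : I) : φ s ^ 2 * ‖a s‖ ≤ m := by
    have hp := hm.trans_le (le_max_left m ‖a s‖)
    rw [hφ, div_pow, div_mul_eq_mul_div, div_le_iff₀ (by positivity), sq, sq, mul_assoc]
    gcongr
    · exact le_max_left _ _
    · exact le_max_right _ _
  let u : C(I, B.carrier) := ⟨fun s => ((φ s : ℝ) : ℂ) • e' s, by fun_prop⟩
  let v : C(I, B.carrier) := e' - u
  have hvt : B.evalAt t v = 0 := by
    change e' t - ((φ t : ℝ) : ℂ) • e' t = 0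
    rw [hφt, Complex.ofReal_one, one_smul, sub_self]
  have hsub : x - x <• (show B.path.carrier from v)
      = (x - x <• e) + x <• (show B.path.carrier from u) := by
    have : e = (show B.path.carrier from v) + (show B.path.carrier from u) :=
      (sub_add_cancel e' u).symm
    have h2 : x <• e = x <• (show B.path.carrier from v) + x <• (show B.path.carrier from u) := by
      conv_lhs => rw [this]
      exact hsmul_add _ _ _
    rw [h2]
    abel
  refine ⟨x - x <• (show B.path.carrier from v), ?_, ?_⟩
  · rw [map_sub, sub_eq_self, ← norm_eq_zero, ← sq_eq_zero_iff, ← norm_hinner_self (B := B.carrier),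
      h, hinner_smul]
    change ‖B.evalAt t _ * B.evalAt t v‖ = 0
    rw [hvt, mul_zero, norm_zero]
  · have hu : ‖x <• (show B.path.carrier from u)‖ ≤ ‖π x‖ := by
      refine (sq_le_sq₀ (norm_nonneg _) (norm_nonneg _)).1 ?_
      rw [← norm_hinner_self (B := B.path.carrier), hinner_smul, hinner_smul_left]
      refine (ContinuousMap.norm_le (star u * a * u) hm.le).2 fun s => ?_
      change ‖star (((φ s : ℝ) : ℂ) • e' s) * a s * (((φ s : ℝ) : ℂ) • e' s)‖ ≤ m
      have hs : ‖e' s‖ ≤ 1 := (e'.norm_coe_le_norm s).trans he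
      have hn : ‖((φ s : ℝ) : ℂ) • e' s‖ ≤ |φ s| := by
        rw [norm_smul, Complex.norm_real, Real.norm_eq_abs]
        exact mul_le_of_le_one_right (abs_nonneg _) hs
      calc _ ≤ ‖((φ s : ℝ) : ℂ) • e' s‖ * ‖a s‖ * ‖((φ s : ℝ) : ℂ) • e' s‖ := by
            refine (norm_mul_le _ _).trans ?_
            gcongr
            refine (norm_mul_le _ _).trans ?_
            rw [norm_star]
        _ ≤ |φ s| * ‖a s‖ * |φ s| := by gcongr
        _ = φ s ^ 2 * ‖a s‖ := by rw [← sq_abs]; ring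
        _ ≤ m := hφs s
    rw [hsub]
    refine (norm_add_le _ _).trans ?_
    linarith

/-- An evaluation map with dense range is surjective. -/
theorem surjective_of_hinner_evalAt [CompleteSpace W] {t : I} {π : W →ₗ[ℂ] F}
    (h : ∀ x y, hinner B.carrier (π x) (π y) = B.evalAt t (hinner B.path.carrier x y))
    (hd : DenseRange π) : Function.Surjective π := fun y => by
  let f : NormedAddGroupHom W F := π.toAddMonoidHom.mkNormedAddGroupHom 1 fun x => by
    rw [one_mul]
    exact norm_le_of_hinner_evalAt h x
  have h1 : f.SurjectiveOnWith f.range 2 := by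
    rintro _ ⟨x, rfl⟩
    exact exists_norm_le_of_hinner_evalAt h x
  obtain ⟨x, hx, -⟩ := controlled_closure_of_complete zero_lt_two zero_lt_one h1 y (hd y)
  exact ⟨x, hx⟩

end fibre

namespace KasparovCycle

open Induced

variable {G : Type v} [Group G] [Countable G] {K : Subgroup G} [Finite K] {B : GradedGAlgebra.{u} G}

section

variable {A : GradedGAlgebra.{w} K} {t : unitInterval}
variable {Z : KasparovCycle A (B.path.res K)} {X : KasparovCycle A (B.res K)}
variable {π : Z.E →ₗ[ℂ] X.E}

/-- The pointwise application of an evaluation map. -/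
noncomputable def Induced.evaluation
    (h : ∀ x y, hinner B.carrier (π x) (π y) = B.evalAt t (hinner B.path.carrier x y))
    (hu : ∀ k x, π (Z.u k x) = X.u k (π x)) : Z.Induced →L[ℂ] X.Induced :=
  Induced.map (Equiv.refl G) (fun _ => π) 1 zero_le_one
    (fun ξ g k => by
      change π (ξ.val (g * k)) = X.u k⁻¹ (π (ξ.val g))
      rw [val_mul, hu])
    fun ξ F => by
      have e : ∑ g ∈ F, B.act g (hinner B.carrier (π (ξ.val g)) (π (ξ.val g)))
          = B.evalAt t (∑ g ∈ F, B.path.act g (hinner B.path.carrier (ξ.val g) (ξ.val g))) := by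
        let ev : C(unitInterval, B.carrier) →+ B.carrier :=
          { toFun := fun f => f t, map_zero' := rfl, map_add' := fun _ _ => rfl }
        refine Eq.trans ?_ (map_sum ev
          (fun g => B.path.act g (hinner B.path.carrier (ξ.val g) (ξ.val g))) F).symm
        exact Finset.sum_congr rfl fun g _ => congrArg (B.act g) (h _ _)
      rw [one_pow, one_mul]
      exact (congrArg norm e).trans_le (B.norm_evalAt_le t _)

variable (h : ∀ x y, hinner B.carrier (π x) (π y) = B.evalAt t (hinner B.path.carrier x y))
    (hu : ∀ k x, π (Z.u k x) = X.u k (π x))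

theorem Induced.val_evaluation (ξ : Z.Induced) (g : G) :
    (Induced.evaluation h hu ξ).val g = π (ξ.val g) := val_map _ _ _ _ _ _ _ _

theorem Induced.hinner_evaluation (ξ η : Z.Induced) :
    hinner B.carrier (Induced.evaluation h hu ξ) (Induced.evaluation h hu η)
      = B.evalAt t (hinner B.path.carrier ξ η) := by
  let ev : C(unitInterval, B.carrier) →+ B.carrier :=
    { toFun := fun f => f t, map_zero' := rfl, map_add' := fun _ _ => rfl }
  refine (hasSum_hinner _ _).unique (((hasSum_hinner ξ η).map ev
    (B.continuous_evalAt t)).congr_fun fun g => ?_)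
  rw [val_evaluation, val_evaluation, h]
  rfl

theorem Induced.evaluation_single (g : G) (z : Z.E) :
    Induced.evaluation h hu (single Z g z) = single X g (π z) := Induced.ext fun g' => by
  rw [val_evaluation]
  by_cases hg : (QuotientGroup.mk g' : G ⧸ K) = QuotientGroup.mk g
  · obtain ⟨k, rfl⟩ := val_eq_of_mk_eq hg
    rw [val_single_mul, val_single_mul, hu]
  · rw [val_single_of_ne hg, val_single_of_ne hg, _root_.map_zero]

theorem Induced.surjective_evaluation (hs : Function.Surjective π) :
    Function.Surjective (Induced.evaluation h hu) := by
  refine surjective_of_hinner_evalAt (B := B) (t := t)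
    (π := (Induced.evaluation h hu).toLinearMap) (hinner_evaluation h hu) fun ξ => ?_
  refine mem_of_single_mem (M := (LinearMap.range
    (Induced.evaluation h hu).toLinearMap).topologicalClosure)
    (Submodule.isClosed_topologicalClosure _) (fun g x => ?_) ξ
  obtain ⟨z, rfl⟩ := hs x
  exact Submodule.le_topologicalClosure _ ⟨single Z g z, evaluation_single h hu g z⟩

end

variable [TopologicalSpace G] [DiscreteTopology G]
variable {t : unitInterval} {Z : KasparovCycle (GradedGAlgebra.complex K) (B.path.res K)}
variable {X : KasparovCycle (GradedGAlgebra.complex K) (B.res K)}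

theorem IsEvaluation.induced (hZ : Z.IsNormalized) (hX : X.IsNormalized)
    (h : IsEvaluation (B := B.res K) t Z X) :
    IsEvaluation t (Z.induced hZ) (X.induced hX) := by
  obtain ⟨π, h1, h2, h3, h4, h5, h6, h7⟩ := h
  replace h2 : ∀ x y, hinner B.carrier (π x) (π y)
    = B.evalAt t (hinner B.path.carrier x y) := h2
  refine ⟨(Induced.evaluation h2 h5).toLinearMap, surjective_evaluation h2 h5 h1,
    hinner_evaluation h2 h5, fun (ξ : Z.Induced) f => Induced.ext (X := X) fun g => ?_,
    fun (ξ : Z.Induced) => Induced.ext (X := X) fun g => ?_,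
    fun k (ξ : Z.Induced) => Induced.ext (X := X) fun g => ?_,
    fun (f : C₀(G ⧸ K, ℂ)) (ξ : Z.Induced) => Induced.ext (X := X) fun g => ?_,
    fun (ξ : Z.Induced) => Induced.ext (X := X) fun g => ?_⟩
  · change (Induced.evaluation h2 h5 (ξ <• f)).val g
      = (Induced.evaluation h2 h5 ξ <• B.evalAt t f).val g
    rw [val_evaluation, Induced.val_hsmul, Induced.val_hsmul, val_evaluation]
    exact h3 _ _
  · change (Induced.evaluation h2 h5 (Induced.gr Z ξ)).val g
      = (Induced.gr X (Induced.evaluation h2 h5 ξ)).val g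
    rw [val_evaluation, val_gr, val_gr, val_evaluation]
    exact h4 _
  · change (Induced.evaluation h2 h5 (translation Z k ξ)).val g
      = (translation X k (Induced.evaluation h2 h5 ξ)).val g
    rw [val_evaluation, val_translation, val_translation, val_evaluation]
  · change (Induced.evaluation h2 h5 (multiplication Z f ξ)).val g
      = (multiplication X f (Induced.evaluation h2 h5 ξ)).val g
    rw [val_evaluation, val_multiplication, val_multiplication, val_evaluation]
    exact map_smul π _ _
  · change (Induced.evaluation h2 h5 (operator Z hZ ξ)).val g
      = (operator X hX (Induced.evaluation h2 h5 ξ)).val g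
    rw [val_evaluation, val_operator, val_operator, val_evaluation]
    exact h7 _

end KasparovCycle

/-! ### The fibre of a cycle at the base point -/

section cosetSum

variable {G : Type v} [Group G] {K : Subgroup G} [Finite K]

/-- Every coset has `|K|` elements. -/
theorem HasSum.comp_quotientMk {V : Type*} [NormedAddCommGroup V] [NormedSpace ℂ V] {f : G ⧸ K → V}
    {a : V} (h : HasSum f a) :
    HasSum (fun g : G => f (QuotientGroup.mk g)) ((Nat.card K : ℂ) • a) := by
  classical
  have := Fintype.ofFinite K
  let F (k : K) (g : G) : V :=
    if g = (QuotientGroup.mk g : G ⧸ K).out * k then f (QuotientGroup.mk g) else 0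
  have hmk (x : G ⧸ K) (k : K) : (QuotientGroup.mk (x.out * (k : G)) : G ⧸ K) = x := by
    rw [QuotientGroup.mk_mul_of_mem _ k.2, QuotientGroup.out_eq']
  have hF (k : K) : HasSum (F k) a := by
    have hinj : Function.Injective fun x : G ⧸ K => x.out * (k : G) := fun x y hxy => by
      rw [← hmk x k, ← hmk y k]
      exact congrArg _ hxy
    refine (hinj.hasSum_iff fun g hg => if_neg fun e => hg ⟨_, e.symm⟩).1 (h.congr_fun fun x => ?_)
    change (if x.out * (k : G) = (QuotientGroup.mk (x.out * (k : G)) : G ⧸ K).out * k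
      then f (QuotientGroup.mk (x.out * (k : G))) else 0) = f x
    rw [hmk, if_pos rfl]
  have hs := hasSum_sum fun k (_ : k ∈ Finset.univ) => hF k
  rw [Finset.sum_const, Finset.card_univ, ← Nat.card_eq_fintype_card,
    ← Nat.cast_smul_eq_nsmul ℂ] at hs
  refine hs.congr_fun fun g => ?_
  let l : K := ⟨(QuotientGroup.mk g : G ⧸ K).out⁻¹ * g,
    QuotientGroup.eq.1 (QuotientGroup.out_eq' _)⟩
  have hl (k : K) : g = (QuotientGroup.mk g : G ⧸ K).out * k ↔ k = l := by
    rw [Subtype.ext_iff, eq_comm, ← eq_inv_mul_iff_mul_eq]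
  simp only [F, hl, Finset.sum_ite_eq', Finset.mem_univ, if_true]

end cosetSum

namespace KasparovCycle

variable {G : Type v} [Group G] [TopologicalSpace G] [DiscreteTopology G]
variable {K : Subgroup G} {B : GradedGAlgebra.{u} G}
variable (Y : KasparovCycle (GradedGAlgebra.cosets K) B)

/-- The projection onto the fibre at a point of `G/K`. -/
noncomputable def pointProj (x : G ⧸ K) : Y.E →L[ℂ] Y.E := Y.Φ (GradedGAlgebra.delta K x)

theorem Φ_pointProj (f : C₀(G ⧸ K, ℂ)) (x : G ⧸ K) (e : Y.E) :
    Y.Φ f (Y.pointProj x e) = f x • Y.pointProj x e := by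
  have h : f * GradedGAlgebra.delta K x = f x • GradedGAlgebra.delta K x :=
    ZeroAtInftyContinuousMap.ext fun y => by
      change f y * GradedGAlgebra.delta K x y = f x * GradedGAlgebra.delta K x y
      rw [GradedGAlgebra.delta_apply]
      split_ifs with hy
      · rw [hy]
      · rw [mul_zero, mul_zero]
  exact (Y.Φ_mul_apply f (GradedGAlgebra.delta K x) e).symm.trans
    ((congrArg (fun a => Y.Φ a e) h).trans (Y.Φ_smul_apply (f x) (GradedGAlgebra.delta K x) e))

theorem pointProj_Φ (f : C₀(G ⧸ K, ℂ)) (x : G ⧸ K) (e : Y.E) :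
    Y.pointProj x (Y.Φ f e) = f x • Y.pointProj x e := by
  rw [← Y.Φ_pointProj]
  exact (Y.Φ_mul_apply (GradedGAlgebra.delta K x) f e).symm.trans
    ((congrArg (fun a => Y.Φ a e) (mul_comm (G := C₀(G ⧸ K, ℂ)) _ _)).trans
      (Y.Φ_mul_apply f (GradedGAlgebra.delta K x) e))

theorem pointProj_self (x : G ⧸ K) (e : Y.E) :
    Y.pointProj x (Y.pointProj x e) = Y.pointProj x e := by
  refine (Y.Φ_pointProj (GradedGAlgebra.delta K x) x e).trans ?_
  rw [GradedGAlgebra.delta_apply, if_pos rfl, one_smul]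

theorem pointProj_of_ne {x y : G ⧸ K} (h : x ≠ y) (e : Y.E) :
    Y.pointProj y (Y.pointProj x e) = 0 := by
  refine (Y.Φ_pointProj (GradedGAlgebra.delta K y) x e).trans ?_
  rw [GradedGAlgebra.delta_apply, if_neg h, zero_smul]

theorem u_pointProj (g : G) (x : G ⧸ K) (e : Y.E) :
    Y.u g (Y.pointProj x e) = Y.pointProj (g • x) (Y.u g e) :=
  (Y.Φ_u g (GradedGAlgebra.delta K x) e).trans
    (congrArg (fun a => Y.Φ a (Y.u g e)) ((ProjectionFamily.cosets K).act_d g x))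

theorem gr_pointProj (x : G ⧸ K) (e : Y.E) : Y.gr (Y.pointProj x e) = Y.pointProj x (Y.gr e) :=
  Y.Φ_gr (GradedGAlgebra.delta K x) e

theorem hasAdjoint_pointProj (x : G ⧸ K) :
    HasAdjoint B.carrier (Y.pointProj x) (Y.pointProj x) :=
  Y.hasAdjoint_Φ_d (ProjectionFamily.cosets K) x

theorem hinner_pointProj (x : G ⧸ K) (e e' : Y.E) :
    hinner B.carrier (Y.pointProj x e) (Y.pointProj x e')
      = hinner B.carrier (Y.pointProj x e) e' := by
  rw [← Y.hasAdjoint_pointProj, pointProj_self]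

theorem smul_mk_one (g : G) : g • (QuotientGroup.mk 1 : G ⧸ K) = QuotientGroup.mk g :=
  congrArg QuotientGroup.mk (mul_one g)

variable (K) in
/-- The restriction of a cycle to the subgroup, with `ℂ` acting by the projection onto the fibre at
the base point of `G/K`. -/
noncomputable def compression : KasparovCycle (GradedGAlgebra.complex K) (B.res K) :=
  (Y.res K).pullback (GradedGAlgebra.pointInclusion K)

theorem unitProj_compression (e : Y.E) :
    unitProj (X := Y.compression) e = Y.pointProj (QuotientGroup.mk 1) e :=
  congrArg (fun a => Y.Φ a e)
    (one_smul ℂ (GradedGAlgebra.delta K (QuotientGroup.mk 1)) : (1 : ℂ) • _ = _)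

variable [Finite K]

/-- The fibre of a cycle at the base point of `G/K`, as a normalized cycle for the subgroup. -/
noncomputable def fibre : KasparovCycle (GradedGAlgebra.complex K) (B.res K) :=
  Y.compression.normalize

/-- The projection onto the fibre. -/
noncomputable def toFibre : Y.E →L[ℂ] Y.fibre.E := Y.compression.toUnital

/-- The inclusion of the fibre. -/
noncomputable def ofFibre : Y.fibre.E →L[ℂ] Y.E := Y.compression.unital.incl

theorem ofFibre_injective : Function.Injective Y.ofFibre := fun _ _ h => HilbertSubmodule.ext h

theorem ofFibre_toFibre (e : Y.E) : Y.ofFibre (Y.toFibre e) = Y.pointProj (QuotientGroup.mk 1) e :=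
  Y.unitProj_compression e

theorem toFibre_ofFibre (y : Y.fibre.E) : Y.toFibre (Y.ofFibre y) = y :=
  Y.compression.toUnital_incl y

theorem pointProj_ofFibre (y : Y.fibre.E) :
    Y.pointProj (QuotientGroup.mk 1) (Y.ofFibre y) = Y.ofFibre y := by
  rw [← ofFibre_toFibre, toFibre_ofFibre]

theorem hinner_ofFibre (y y' : Y.fibre.E) :
    hinner B.carrier (Y.ofFibre y) (Y.ofFibre y') = hinner B.carrier y y' := rfl

theorem ofFibre_u (k : K) (y : Y.fibre.E) : Y.ofFibre (Y.fibre.u k y) = Y.u k (Y.ofFibre y) := rfl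

theorem ofFibre_gr (y : Y.fibre.E) : Y.ofFibre (Y.fibre.gr y) = Y.gr (Y.ofFibre y) := rfl

theorem toFibre_u (k : K) (e : Y.E) : Y.toFibre (Y.u k e) = Y.fibre.u k (Y.toFibre e) := by
  refine Y.ofFibre_injective ?_
  rw [ofFibre_u, ofFibre_toFibre, ofFibre_toFibre, u_pointProj, smul_mk_one,
    show (QuotientGroup.mk (k : G) : G ⧸ K) = QuotientGroup.mk 1 from
      QuotientGroup.eq.2 (by simp)]

theorem toFibre_gr (e : Y.E) : Y.toFibre (Y.gr e) = Y.fibre.gr (Y.toFibre e) := by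
  refine Y.ofFibre_injective ?_
  rw [ofFibre_gr, ofFibre_toFibre, ofFibre_toFibre, gr_pointProj]

theorem toFibre_pointProj_of_ne {x : G ⧸ K} (h : x ≠ QuotientGroup.mk 1) (e : Y.E) :
    Y.toFibre (Y.pointProj x e) = 0 := by
  refine Y.ofFibre_injective ?_
  rw [ofFibre_toFibre, pointProj_of_ne Y h, map_zero]

theorem u_ofFibre_toFibre (g : G) (e : Y.E) :
    Y.u g (Y.ofFibre (Y.toFibre (Y.u g⁻¹ e))) = Y.pointProj (QuotientGroup.mk g) e := by
  rw [ofFibre_toFibre, u_pointProj, smul_mk_one, u_u_inv]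

theorem u_ofFibre (g : G) (y : Y.fibre.E) :
    Y.u g (Y.ofFibre y) = Y.pointProj (QuotientGroup.mk g) (Y.u g (Y.ofFibre y)) := by
  rw [← smul_mk_one, ← u_pointProj, pointProj_ofFibre]

/-- The operator of the fibre agrees with the operator of the cycle up to compact operators. -/
theorem fibre_T_sub_mem : Y.ofFibre.comp (Y.fibre.T.comp Y.toFibre)
    - Y.T * Y.pointProj (QuotientGroup.mk 1) ∈ compactOps B.carrier Y.E := by
  let S : Y.E →L[ℂ] Y.E := Y.compression.average Y.T
  let p : Y.E →L[ℂ] Y.E := Y.pointProj (QuotientGroup.mk 1)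
  let U : Y.E →L[ℂ] Y.E := Y.compression.unitProj
  have hp : U = p := ContinuousLinearMap.ext Y.unitProj_compression
  have h1 : (S - Y.T) * p ∈ compactOps B.carrier Y.E := by
    rw [← hp]
    exact Y.compression.average_T_sub_mem
  have h2 : S * p - p * S ∈ compactOps B.carrier Y.E := by
    rw [← hp]
    exact Y.compression.average_commutator_mem
  have h3 := mem_compactOps_mul (Y.hasAdjoint_pointProj (QuotientGroup.mk 1)) h2
  have e : Y.ofFibre.comp (Y.fibre.T.comp Y.toFibre) = p * S * p := by
    have e1 : Y.ofFibre.comp (Y.fibre.T.comp Y.toFibre) = U * S * U := rfl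
    rw [e1, hp]
  have hpp : p * p = p := ContinuousLinearMap.ext (Y.pointProj_self _)
  rw [e]
  convert sub_mem h1 h3 using 1
  change p * S * p - Y.T * p = (S - Y.T) * p - (S * p - p * S) * p
  rw [sub_mul, sub_mul, mul_assoc S p p, hpp]
  abel

end KasparovCycle

/-! ### Compression and induction are inverse to each other -/

namespace KasparovCycle

open Induced

variable {G : Type v} [Group G] [Countable G] [TopologicalSpace G] [DiscreteTopology G]
variable {K : Subgroup G} [Finite K] {B : GradedGAlgebra.{u} G}

section essential

variable (Y : KasparovCycle (GradedGAlgebra.cosets K) B)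

theorem fibre_isNormalized : Y.fibre.IsNormalized := Y.compression.isNormalized_normalize

/-- The essential submodule of a cycle over `C₀(G/K)`. -/
noncomputable abbrev fibres : InvariantSubmodule Y := Y.essential (ProjectionFamily.cosets K)

theorem hasSum_pointProj (e : Y.fibres.Elem) :
    HasSum (fun x => Y.pointProj x (Y.fibres.incl e)) (Y.fibres.incl e) := e.2

theorem hasSum_hinner_pointProj (e e' : Y.fibres.Elem) :
    HasSum (fun g : G => hinner B.carrier (Y.pointProj (QuotientGroup.mk g) (Y.fibres.incl e))
      (Y.pointProj (QuotientGroup.mk g) (Y.fibres.incl e')))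
      ((Nat.card K : ℂ) • hinner B.carrier e e') := by
  refine HasSum.comp_quotientMk (f := fun x => hinner B.carrier (Y.pointProj x (Y.fibres.incl e))
      (Y.pointProj x (Y.fibres.incl e'))) ?_
  let φ : Y.E →+ B.carrier := AddMonoidHom.mk' (fun z => hinner B.carrier (Y.fibres.incl e) z)
    fun _ _ => hinner_add _ _ _
  have h := (Y.hasSum_pointProj e').map φ
    ((continuous_hinner (B := B.carrier)).comp (continuous_const.prodMk continuous_id))
  refine h.congr_fun fun x => ?_
  rw [hinner_pointProj, Y.hasAdjoint_pointProj]
  rfl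

/-- The function on the group that an element of the essential submodule defines. -/
noncomputable def fibreFunction (e : Y.fibres.Elem) (g : G) : Y.fibre.E :=
  Y.toFibre (Y.u g⁻¹ (Y.fibres.incl e))

theorem act_hinner_fibreFunction (e e' : Y.fibres.Elem) (g : G) :
    B.act g (hinner B.carrier (Y.fibreFunction e g) (Y.fibreFunction e' g))
      = hinner B.carrier (Y.pointProj (QuotientGroup.mk g) (Y.fibres.incl e))
        (Y.pointProj (QuotientGroup.mk g) (Y.fibres.incl e')) := by
  rw [← hinner_ofFibre, ← Y.u_inner, fibreFunction, fibreFunction, u_ofFibre_toFibre,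
    u_ofFibre_toFibre]

theorem fibreFunction_mul (e : Y.fibres.Elem) (g : G) (k : K) :
    Y.fibreFunction e (g * k) = Y.fibre.u k⁻¹ (Y.fibreFunction e g) := by
  rw [fibreFunction, fibreFunction, ← toFibre_u, mul_inv_rev, u_mul_apply]
  rfl

variable (K) in
/-- The scaling factor `|K|^{-1/2}`. -/
noncomputable def scale : ℂ := ((Real.sqrt (Nat.card K))⁻¹ : ℝ)

variable (K) in
theorem star_scale_mul_scale : star (scale K) * scale K * Nat.card K = 1 := by
  have hK : (0 : ℝ) < Nat.card K := Nat.cast_pos.2 Nat.card_pos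
  change (starRingEnd ℂ) _ * _ * _ = _
  rw [scale, Complex.conj_ofReal, ← Complex.ofReal_mul, ← mul_inv, Real.mul_self_sqrt hK.le,
    ← Complex.ofReal_natCast, ← Complex.ofReal_mul, inv_mul_cancel₀ hK.ne', Complex.ofReal_one]

variable (K) in
theorem scale_ne_zero : scale K ≠ 0 := fun h => by
  have := star_scale_mul_scale K
  rw [h, mul_zero, zero_mul] at this
  exact zero_ne_one this

theorem summable_fibreFunction (e : Y.fibres.Elem) : Summable fun g =>
    B.act g (hinner B.carrier (Y.fibreFunction e g) (Y.fibreFunction e g)) :=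
  ((Y.hasSum_hinner_pointProj e e).congr_fun fun g => Y.act_hinner_fibreFunction e e g).summable

/-- The essential submodule as a submodule of the module induced from the fibre. -/
noncomputable def toInduced : Y.fibres.Elem →ₗ[ℂ] Y.fibre.Induced where
  toFun e := scale K • Induced.mk (Y.fibreFunction e) (Y.fibreFunction_mul e)
    (Y.summable_fibreFunction e)
  map_add' e e' := by
    rw [← smul_add]
    congr 1
    exact Induced.ext fun g => by
      rw [val_add, val_mk, val_mk, val_mk, fibreFunction, map_add, map_add, map_add]
      rfl
  map_smul' c e := by
    rw [RingHom.id_apply, smul_comm]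
    congr 1
    exact Induced.ext fun g => by
      rw [val_csmul, val_mk, val_mk, fibreFunction, map_smul, map_smul, map_smul]
      rfl

theorem val_toInduced (e : Y.fibres.Elem) (g : G) :
    (Y.toInduced e).val g = scale K • Y.toFibre (Y.u g⁻¹ (Y.fibres.incl e)) :=
  congrArg (scale K • ·) (Induced.val_mk (X := Y.fibre) (Y.fibreFunction e) (Y.fibreFunction_mul e)
    (Y.summable_fibreFunction e) g)

theorem hinner_toInduced (e e' : Y.fibres.Elem) :
    hinner B.carrier (Y.toInduced e) (Y.toInduced e') = hinner B.carrier e e' := by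
  refine (hasSum_hinner _ _).unique ?_
  have h := (Y.hasSum_hinner_pointProj e e').const_smul (star (scale K) * scale K)
  rw [smul_smul, star_scale_mul_scale, one_smul] at h
  refine h.congr_fun fun g => ?_
  rw [val_toInduced, val_toInduced, hinner_csmul, hinner_csmul_left', map_smul, map_smul, smul_smul,
    mul_comm]
  exact congrArg _ (Y.act_hinner_fibreFunction e e' g)

theorem u_ofFibre_mem (g : G) (y : Y.fibre.E) :
    Y.u g (Y.ofFibre y) ∈ Y.fibres.toSubmodule := by
  rw [u_ofFibre]
  exact Y.Φ_d_mem_essential (ProjectionFamily.cosets K) _ _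

theorem toInduced_u_ofFibre (g : G) (y : Y.fibre.E)
    (h : Y.u g (Y.ofFibre y) ∈ Y.fibres.toSubmodule) :
    Y.toInduced (Y.fibres.elem _ h) = scale K • single Y.fibre g y := Induced.ext fun g' => by
  rw [val_toInduced, val_csmul]
  congr 1
  change Y.toFibre (Y.u g'⁻¹ (Y.u g (Y.ofFibre y))) = _
  by_cases hg : (QuotientGroup.mk g' : G ⧸ K) = QuotientGroup.mk g
  · obtain ⟨k, rfl⟩ := val_eq_of_mk_eq hg
    rw [val_single_mul, mul_inv_rev, u_mul_apply, u_inv_u]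
    exact (Y.toFibre_u k⁻¹ _).trans (congrArg _ (Y.toFibre_ofFibre y))
  · rw [val_single_of_ne hg, u_ofFibre, u_pointProj, toFibre_pointProj_of_ne]
    intro h
    rw [inv_smul_eq_iff, smul_mk_one] at h
    exact hg h.symm

/-- The range is closed, as `toInduced` is isometric, and contains the functions supported on one
coset. -/
theorem surjective_toInduced : Function.Surjective Y.toInduced := by
  let Q := isometryOfInner B.carrier Y.toInduced Y.hinner_toInduced
  have hc : IsClosed (LinearMap.range Y.toInduced : Set Y.fibre.Induced) :=
    Q.isometry.isClosedEmbedding.isClosed_range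
  intro ξ
  refine mem_of_single_mem hc (fun g y => ?_) ξ
  refine ⟨(scale K)⁻¹ • Y.fibres.elem _ (Y.u_ofFibre_mem g y), ?_⟩
  rw [map_smul, toInduced_u_ofFibre, inv_smul_smul₀ (scale_ne_zero K)]

theorem toFibre_u_inv_Φ (f : C₀(G ⧸ K, ℂ)) (g : G) (e : Y.E) :
    Y.toFibre (Y.u g⁻¹ (Y.Φ f e)) = f (QuotientGroup.mk g) • Y.toFibre (Y.u g⁻¹ e) := by
  refine Y.ofFibre_injective ?_
  rw [map_smul, ofFibre_toFibre, ofFibre_toFibre]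
  refine (congrArg (Y.pointProj (QuotientGroup.mk 1)) (Y.Φ_u g⁻¹ f e)).trans ?_
  refine (Y.pointProj_Φ (GradedGAlgebra.translate K g⁻¹ f) _ _).trans ?_
  rw [GradedGAlgebra.translate_apply, inv_inv, smul_mk_one]

theorem operator_single {X : KasparovCycle (GradedGAlgebra.complex K) (B.res K)}
    (hX : X.IsNormalized) (g : G) (x : X.E) :
    operator X hX (single X g x) = single X g (X.T x) := Induced.ext fun g' => by
  rw [val_operator]
  by_cases hg : (QuotientGroup.mk g' : G ⧸ K) = QuotientGroup.mk g
  · obtain ⟨k, rfl⟩ := val_eq_of_mk_eq hg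
    rw [val_single_mul, val_single_mul, hX.2]
  · rw [val_single_of_ne hg, val_single_of_ne hg, _root_.map_zero]

/-- A cycle over `C₀(G/K)` is homotopic to the cycle induced from its fibre. The essential submodule
is unitarily equivalent to the module induced from the fibre, and on the projection onto the point
`gK` the operators agree, up to compact operators, since they do so at the base point. -/
theorem homotopic_induced_fibre : Homotopic Y (Y.fibre.induced Y.fibre_isNormalized) := by
  have : Countable (G ⧸ K) := Quotient.countable
  refine homotopic_of_essential (P := ProjectionFamily.cosets K)
    (Y' := Y.fibre.induced Y.fibre_isNormalized) Y.toInduced Y.surjective_toInduced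
    Y.hinner_toInduced (fun e => Induced.ext (X := Y.fibre) fun g => ?_)
    (fun h e => Induced.ext (X := Y.fibre) fun g => ?_)
    (fun (f : C₀(G ⧸ K, ℂ)) e => Induced.ext (X := Y.fibre) fun g => ?_)
    (fun h (ξ : Y.fibre.Induced) => Induced.ext (X := Y.fibre) fun g => ?_)
    (fun (f : C₀(G ⧸ K, ℂ)) (ξ : Y.fibre.Induced) => Induced.ext (X := Y.fibre) fun g => ?_)
    fun x => ?_
  · change (Y.toInduced _).val g = (Induced.gr Y.fibre (Y.toInduced e)).val g
    rw [val_gr, val_toInduced, val_toInduced, InvariantSubmodule.incl_gr, Y.u_gr, toFibre_gr,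
      map_smul]
  · change (Y.toInduced _).val g = (translation Y.fibre h (Y.toInduced e)).val g
    rw [val_translation, val_toInduced, val_toInduced, InvariantSubmodule.incl_u, mul_inv_rev,
      inv_inv, u_mul_apply]
  · refine (Y.val_toInduced _ g).trans
      ((congrArg (scale K • ·) (Y.toFibre_u_inv_Φ f g (Y.fibres.incl e))).trans ?_)
    refine Eq.trans ?_ (val_multiplication f (Y.toInduced e) g).symm
    rw [val_toInduced, smul_smul, smul_smul, mul_comm]
  · change (operator Y.fibre Y.fibre_isNormalized (translation Y.fibre h ξ)).val g
      = (translation Y.fibre h (operator Y.fibre Y.fibre_isNormalized ξ)).val g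
    rw [val_translation, val_operator, val_operator, val_translation]
  · change (operator Y.fibre Y.fibre_isNormalized (multiplication Y.fibre f ξ)).val g
      = (multiplication Y.fibre f (operator Y.fibre Y.fibre_isNormalized ξ)).val g
    rw [val_multiplication, val_operator, val_operator, val_multiplication, map_smul]
  · induction x using QuotientGroup.induction_on with
    | H g =>
    let S : Y.E →L[ℂ] Y.E := Y.ofFibre.comp (Y.fibre.T.comp Y.toFibre)
    let p : Y.E →L[ℂ] Y.E := Y.pointProj (QuotientGroup.mk 1)
    refine ⟨Y.u g * S * Y.u g⁻¹, ?_, fun e => ⟨Y.u_ofFibre_mem g _, ?_⟩⟩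
    · have h1 := Y.conj_mem_compactOps g Y.fibre_T_sub_mem
      have h2 : (Y.u g * Y.T * Y.u g⁻¹ - Y.T) * Y.pointProj (QuotientGroup.mk g)
          ∈ compactOps B.carrier Y.E :=
        Y.compact_equivariance g (GradedGAlgebra.delta K (QuotientGroup.mk g))
      convert add_mem h1 h2 using 1
      refine ContinuousLinearMap.ext fun e => ?_
      change Y.u g (S (Y.u g⁻¹ e)) - Y.T (Y.pointProj (QuotientGroup.mk g) e)
        = Y.u g (S (Y.u g⁻¹ e) - Y.T (p (Y.u g⁻¹ e)))
          + (Y.u g (Y.T (Y.u g⁻¹ (Y.pointProj (QuotientGroup.mk g) e)))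
            - Y.T (Y.pointProj (QuotientGroup.mk g) e))
      rw [u_pointProj, ← smul_mk_one g, inv_smul_smul, map_sub]
      abel
    · have h1 : Y.essentialΦ (ProjectionFamily.cosets K) ((ProjectionFamily.cosets K).d
          (QuotientGroup.mk g)) e
          = Y.fibres.elem _ (Y.u_ofFibre_mem g (Y.toFibre (Y.u g⁻¹ e))) :=
        HilbertSubmodule.ext (Y.u_ofFibre_toFibre g e).symm
      have h2 : operator Y.fibre Y.fibre_isNormalized (Y.toInduced
          (Y.fibres.elem _ (Y.u_ofFibre_mem g (Y.toFibre (Y.u g⁻¹ e)))))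
          = scale K • single Y.fibre g (Y.fibre.T (Y.toFibre (Y.u g⁻¹ e))) := by
        rw [toInduced_u_ofFibre, map_smul, operator_single]
      exact (Y.toInduced_u_ofFibre g _ _).trans (h2.symm.trans
        (congrArg (fun z => operator Y.fibre Y.fibre_isNormalized (Y.toInduced z)) h1.symm))

end essential

section compression

variable (X : KasparovCycle (GradedGAlgebra.complex K) (B.res K)) (hX : X.IsNormalized)

open Classical in
theorem val_pointProj_induced (ξ : X.Induced) (x : G ⧸ K) (g : G) :
    Induced.val (X := X) ((X.induced hX).pointProj x ξ) g
      = if (QuotientGroup.mk g : G ⧸ K) = x then ξ.val g else 0 := by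
  refine (val_multiplication (GradedGAlgebra.delta K x) ξ g).trans ?_
  rw [GradedGAlgebra.delta_apply]
  split_ifs
  · rw [one_smul]
  · rw [zero_smul]

theorem pointProj_induced (ξ : X.Induced) :
    (X.induced hX).pointProj (QuotientGroup.mk 1) ξ = single X 1 (ξ.val 1) :=
  Induced.ext (X := X) fun g => by
    classical
    rw [val_pointProj_induced, val_single_val]

/-- The compression of the cycle induced from `X` is homotopic to `X`: the fibre of the induced
module at the base point consists of the functions supported on the subgroup, which are determined
by their value at `1`. -/
theorem homotopic_compression_induced : Homotopic (X.induced hX).compression X := by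
  let C := (X.induced hX).compression
  have hmem (e : C.unital.Elem) : single X 1 (Induced.val (X := X) (C.unital.incl e) 1)
      = C.unital.incl e :=
    (X.pointProj_induced hX _).symm.trans
      (((X.induced hX).unitProj_compression _).symm.trans (C.unitProj_incl e))
  have hone (ξ : X.Induced) : Induced.val (X := X) (C.unitProj ξ) 1 = ξ.val 1 := by
    classical
    refine (congrArg (fun η => Induced.val (X := X) η 1)
      ((X.induced hX).unitProj_compression ξ)).trans ?_
    rw [val_pointProj_induced, if_pos rfl]
  have hT (ξ : X.Induced) : C.unitProj (operator X hX ξ) = operator X hX (C.unitProj ξ) := by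
    classical
    refine ((X.induced hX).unitProj_compression _).trans (Eq.trans ?_
      (congrArg (operator X hX) ((X.induced hX).unitProj_compression ξ)).symm)
    refine Induced.ext (X := X) fun g => ?_
    refine (X.val_pointProj_induced hX _ _ _).trans ((val_operator X hX _ g).trans ?_).symm
    refine (congrArg X.T (X.val_pointProj_induced hX ξ _ g)).trans ?_
    rw [val_operator]
    split_ifs
    · rfl
    · rw [map_zero]
  let q : C.unital.Elem →ₗ[ℂ] X.E :=
    { toFun := fun e => (scale K)⁻¹ • Induced.val (X := X) (C.unital.incl e) 1
      map_add' := fun e e' => smul_add (scale K)⁻¹ (Induced.val (X := X) (C.unital.incl e) 1)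
        (Induced.val (X := X) (C.unital.incl e') 1)
      map_smul' := fun c e => by
        change (scale K)⁻¹ • c • Induced.val (X := X) (C.unital.incl e) 1
          = c • (scale K)⁻¹ • Induced.val (X := X) (C.unital.incl e) 1
        rw [smul_smul, smul_smul, mul_comm] }
  refine homotopic_of_essential (P := ProjectionFamily.complex K) q (fun x => ?_) (fun e e' => ?_)
    (fun e => ?_) (fun k e => ?_) (fun a e => ?_) hX.2 (fun a x => ?_) fun j => ?_
  · refine ⟨C.toUnital (scale K • single X 1 x), ?_⟩
    refine (congrArg ((scale K)⁻¹ • ·) (hone (scale K • single X 1 x))).trans ?_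
    rw [val_csmul, val_single_self, inv_smul_smul₀ (scale_ne_zero K)]
  · let ξ : X.Induced := C.unital.incl e
    let η : X.Induced := C.unital.incl e'
    have h1 : hinner B.carrier ((scale K)⁻¹ • ξ.val 1) ((scale K)⁻¹ • η.val 1)
        = hinner B.carrier (single X 1 (ξ.val 1)) η := by
      have h2 := star_scale_mul_scale K
      have h3 := scale_ne_zero K
      rw [hinner_single, hinner_csmul, hinner_csmul_left', smul_smul, star_inv₀, map_one]
      congr 1
      have h4 : star (scale K) ≠ 0 := star_ne_zero.2 h3
      field_simp
      rw [← h2]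
      ring
    exact h1.trans (congrArg (fun z => hinner B.carrier z η) (hmem e))
  · exact (congrArg ((scale K)⁻¹ • ·) (val_gr _ 1)).trans (map_smul X.gr _ _).symm
  · refine (congrArg ((scale K)⁻¹ • ·) (val_translation (X := X) (k : G) _ 1)).trans ?_
    have h1 := Induced.val_mul (X := X) (C.unital.incl e) 1 k⁻¹
    rw [one_mul, inv_inv] at h1
    rw [mul_one]
    exact (congrArg ((scale K)⁻¹ • ·) h1).trans (map_smul (X.u k) _ _).symm
  · have ha : (show ℂ from a) • GradedGAlgebra.delta K (QuotientGroup.mk 1)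
        (QuotientGroup.mk 1 : G ⧸ K) = (show ℂ from a) := by
      rw [GradedGAlgebra.delta_apply, if_pos rfl, smul_eq_mul, mul_one]
    refine (congrArg ((scale K)⁻¹ • ·) ((val_multiplication (X := X)
      (GradedGAlgebra.scalarDelta K (QuotientGroup.mk 1) a) _ 1).trans
        (congrArg (· • Induced.val (X := X) (C.unital.incl e) 1) ha))).trans ?_
    refine Eq.trans ?_ (hX.Φ_apply a (q e)).symm
    change (scale K)⁻¹ • (show ℂ from a) • Induced.val (X := X) (C.unital.incl e) 1
      = (show ℂ from a) • (scale K)⁻¹ • Induced.val (X := X) (C.unital.incl e) 1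
    rw [smul_smul, smul_smul, mul_comm]
  · exact (congrArg X.T (hX.Φ_apply a x)).trans
      ((map_smul X.T (show ℂ from a) x).trans (hX.Φ_apply a (X.T x)).symm)
  · let O : C.E →L[ℂ] C.E := operator X hX
    refine ⟨O * C.unitProj, ?_, fun ξ => ⟨C.mem_unital.2 ?_, ?_⟩⟩
    · have h0 : O * C.unitProj - C.T * C.Φ ((ProjectionFamily.complex K).d j) = 0 :=
        sub_self (O * C.unitProj)
      rw [h0]
      exact zero_mem _
    · exact (hT _).trans (congrArg O (C.unitProj_unitProj ξ))
    · exact (congrArg ((scale K)⁻¹ • ·) (val_operator X hX (C.unitProj ξ) 1)).trans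
        (map_smul X.T _ _).symm

end compression

end KasparovCycle

/-! ### The inverse of the compression map -/

section inverse

variable {G : Type v} [Group G] [Countable G] [TopologicalSpace G] [DiscreteTopology G]
variable {K : Subgroup G} {B : GradedGAlgebra.{u} G}

open KasparovCycle

/-- Any two cycles induced from the same cycle are unitarily equivalent. -/
theorem IsInduced.isIso {X : KasparovCycle (GradedGAlgebra.complex K) (B.res K)}
    {Y Y' : KasparovCycle (GradedGAlgebra.cosets K) B} (h : IsInduced X Y) (h' : IsInduced X Y') :
    IsIso Y Y' := by
  obtain ⟨ι, hi, hr, h1, h2, h3, h4, h5, h6⟩ := h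
  obtain ⟨κ, ki, kr, k1, k2, k3, k4, k5, k6⟩ := h'
  have hk (ξ : Y.E) : ∃ η, κ η = ι ξ := by
    have : ι ξ ∈ Set.range κ := by
      rw [kr, ← hr]
      exact ⟨ξ, rfl⟩
    exact this
  choose e he using hk
  refine ⟨{ toFun := e
            map_add' := fun ξ η => ki (by rw [he, map_add, map_add, he, he])
            map_smul' := fun c ξ => ki (by rw [he, map_smul, RingHom.id_apply, map_smul, he]) },
    fun η => ?_, fun ξ η => ?_, fun ξ b => ki (funext fun g => ?_),
    fun ξ => ki (funext fun g => ?_), fun g ξ => ki (funext fun g' => ?_),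
    fun (f : C₀(G ⧸ K, ℂ)) ξ => ki (funext fun g => ?_), fun ξ => ki (funext fun g => ?_)⟩
  · have : κ η ∈ Set.range ι := by
      rw [hr, ← kr]
      exact ⟨η, rfl⟩
    obtain ⟨ξ, hξ⟩ := this
    exact ⟨ξ, ki ((he ξ).trans hξ)⟩
  · refine (k1 _ _).unique ((h1 ξ η).congr_fun fun g => ?_)
    change (Nat.card K : ℂ)⁻¹ • B.act g (hinner (B.res K).carrier (κ (e ξ) g) (κ (e η) g)) = _
    rw [he, he]
  · exact (congrFun (he _) g).trans ((h2 ξ b g).trans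
      ((congrArg (fun z => z <• (show (B.res K).carrier from B.act g⁻¹ b))
        (congrFun (he ξ) g)).symm.trans (k2 (e ξ) b g).symm))
  · exact (congrFun (he _) g).trans ((h3 ξ g).trans
      ((congrArg X.gr (congrFun (he ξ) g)).symm.trans (k3 (e ξ) g).symm))
  · exact (congrFun (he _) g').trans ((h5 g ξ g').trans
      ((congrFun (he ξ) _).symm.trans (k5 g (e ξ) g').symm))
  · exact (congrFun (he _) g).trans ((h4 f ξ g).trans
      ((congrArg (f (QuotientGroup.mk g) • ·) (congrFun (he ξ) g)).symm.trans (k4 f (e ξ) g).symm))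
  · exact (congrFun (he _) g).trans ((h6 ξ g).trans
      ((congrArg X.T (congrFun (he ξ) g)).symm.trans (k6 (e ξ) g).symm))

variable [Finite K]

/-- Induction of homotopy classes: the class of a cycle is sent to the class of the cycle induced
from its normalization. -/
noncomputable def KK.ind (K : Subgroup G) [Finite K] (B : GradedGAlgebra.{u} G) :
    KK (GradedGAlgebra.complex K) (B.res K) → KK (GradedGAlgebra.cosets K) B :=
  Quot.lift (fun X => KK.mk (X.normalize.induced X.isNormalized_normalize)) fun X Y h => by
    obtain ⟨Z, hZ, h0, h1⟩ := h.normalize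
    exact KK.mk_eq ⟨KasparovCycle.induced (B := B.path) Z hZ,
      IsEvaluation.induced (B := B) hZ X.isNormalized_normalize h0,
      IsEvaluation.induced (B := B) hZ Y.isNormalized_normalize h1⟩

theorem KK.comp_ind (x : KK (GradedGAlgebra.complex K) (B.res K)) :
    KK.comp K B (KK.ind K B x) = x := by
  induction x using Quot.ind with
  | mk X =>
    exact (KK.mk_eq (homotopic_compression_induced X.normalize X.isNormalized_normalize)).trans
      (KK.mk_eq X.homotopic_normalize).symm

theorem KK.ind_comp (y : KK (GradedGAlgebra.cosets K) B) : KK.ind K B (KK.comp K B y) = y := by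
  induction y using Quot.ind with
  | mk Y => exact (KK.mk_eq Y.homotopic_induced_fibre).symm

end inverse

theorem mainTheorem10 {G : Type v} [Group G] [TopologicalSpace G] [DiscreteTopology G]
    [Countable G] (K : Subgroup G) [Finite K] (B : GradedGAlgebra.{u} G) (n : ℕ) :
    ∃ e : KK (GradedGAlgebra.cosets K) (B.cliffordPow n) ≃+
        KK (GradedGAlgebra.complex K) ((B.cliffordPow n).res K),
      (∀ x, e x = KK.comp K (B.cliffordPow n) x) ∧
      (∀ y : KK (GradedGAlgebra.complex K) ((B.cliffordPow n).res K),
        ∃ X : KasparovCycle (GradedGAlgebra.complex K) ((B.cliffordPow n).res K),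
          X.IsNormalized ∧ KK.mk X = y) ∧
      ∀ X : KasparovCycle (GradedGAlgebra.complex K) ((B.cliffordPow n).res K), X.IsNormalized →
        (∃ Y : KasparovCycle (GradedGAlgebra.cosets K) (B.cliffordPow n), IsInduced X Y) ∧
        ∀ Y : KasparovCycle (GradedGAlgebra.cosets K) (B.cliffordPow n), IsInduced X Y →
          e.symm (KK.mk X) = KK.mk Y := by
  refine ⟨AddEquiv.ofBijective (KK.comp K (B.cliffordPow n))
    ⟨Function.LeftInverse.injective KK.ind_comp, Function.RightInverse.surjective KK.comp_ind⟩,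
    fun _ => rfl, fun y => ?_, fun X hX => ⟨⟨_, X.isInduced_induced hX⟩, fun Y hY => ?_⟩⟩
  · induction y using Quot.ind with
    | mk X => exact ⟨X.normalize, X.isNormalized_normalize, (KK.mk_eq X.homotopic_normalize).symm⟩
  · rw [AddEquiv.symm_apply_eq, KK.mk_eq (hY.isIso (X.isInduced_induced hX)).homotopic]
    exact (KK.mk_eq (X.homotopic_compression_induced hX)).symm
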